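/- Let $C$ be a pointed algebraic theory: a category with finite sums $+$ and a zero object $0$ in which every object is isomorphic to a finite sum of copies of one object $\Omega$. Let $\iota_i$, $\rho_i$ denote the injections and retractions of a sum, $\nabla\colon\Omega+\Omega\to\Omega$ the folding map and $\sigma$ the interchange of $\Omega+\Omega$. Let $\Lambda=\mathbb Z[C(\Omega,\Omega)]/\mathbb Z\cdot 0$ be the reduced monoid ring of $C(\Omega,\Omega)$ and $U=\mathbb Z[C(\Omega,-)]$ the standard projective functor. For a functor $F\colon C\to\mathfrak{Ab}$ let $\mathrm{cr}_kF(M_1,\dots,M_k)$ be the common kernel of the maps $F(M_1+\dots+M_k)\to F(\sum_{i\ne j}M_i)$, $1\le j\le k$, induced by the retractions; $F$ is quadratic if $\mathrm{cr}_3F=0$. Let $T_{11}\mathrm{cr}_2U$ be the bilinearisation of $\mathrm{cr}_2U$. The group $T_{11}\mathrm{cr}_2U(\Omega,\Omega)$ is a left $\Lambda\otimes\Lambda$-module by functoriality, a right $\Lambda$-module by precomposition, and it has the involution that interchanges the two arguments. For $\xi\colon\Omega\to\Omega+\Omega$, let $[\xi]$ be the class of the projection of $\xi\in U(\Omega+\Omega)$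 to $\mathrm{cr}_2U(\Omega,\Omega)$. A quadratic module is a diagram $$T_{11}\mathrm{cr}_2U(\Omega,\Omega)\otimes_\Lambda M_e\xrightarrow{\ \hat H\ }M_{ee}\xrightarrow{\ P\ }M_e,\qquad T\colon M_{ee}\to M_{ee},$$ such that: - $M_e$ is a left $\Lambda$-module; - $M_{ee}$ is a symmetric left $\Lambda\otimes\Lambda$-module with involution $T$, i.e. $T$ is additive, $T^2=1$ and $T((a\otimes b)m)=(b\otimes a)Tm$, and the operation is bilinear: $(\nabla\xi\otimes 1)m=(\rho_1\xi\otimes 1)m+(\rho_2\xi\otimes 1)m$ for all $\xi\colon\Omega\to\Omega+\Omega$ (hence also in the second factor); - $P$ is a homomorphism of $\Lambda$-modules, with respect to the diagonal operation $\alpha\mapsto\alpha\otimes\alpha$ of $\Lambda$ on $M_{ee}$, and $PT=P$; - $\hat H$ is a homomorphism of symmetric $\Lambda\otimes\Lambda$-modules; - for all $\xi\colon\Omega\to\Omega+\Omega$ and $x\in M_e$: $(\nabla\xi)x=(\rho_1\xi)x+(\rho_2\xi)x+P\hat H([\xi]\otimes x)$; - for all $\xi\colon\Omega\to\Omega+\Omega$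 and $m\in M_{ee}$: $\hat H([\xi]\otimes Pm)=(\rho_1\xi\otimes\rho_2\xi)m+T\big((\rho_2\xi\otimes\rho_1\xi)m\big)$. Morphisms of quadratic modules are pairs of module homomorphisms commuting with $T$, $P$ and $\hat H$. Theorem. The category of quadratic functors $F\colon C\to\mathfrak{Ab}$ with $F(0)=0$ is equivalent to the category of quadratic modules. The equivalence takes $F$ to $M_e=F(\Omega)$ and $M_{ee}=\mathrm{cr}_2F(\Omega,\Omega)$, on which $\Lambda$ and $\Lambda\otimes\Lambda$ operate by functoriality, with $T$ the restriction of $F(\sigma)$, $P$ the restriction of $F(\nabla)$, and $\hat H([\xi]\otimes x)$ the projection of $F(\xi)x$ to the cross-effect; and it takes a natural transformation to its restrictions. -/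

import Mathlib

open CategoryTheory CategoryTheory.Limits
open scoped TensorProduct

universe w v u

namespace QuadraticClassification

noncomputable section

/-! ### Cross-effects and polynomial functors -/

section CrossEffects

variable {C : Type u} [Category.{v} C] [HasFiniteCoproducts C]

/-- The folding map. -/
def fold (X : C) : X ⨿ X ⟶ X := coprod.desc (𝟙 X) (𝟙 X)

/-- The interchange of the two summands. -/
def swap (X Y : C) : X ⨿ Y ⟶ Y ⨿ X := coprod.desc coprod.inr coprod.inl

theorem inl_fold (X : C) : coprod.inl ≫ fold X = 𝟙 X := coprod.inl_desc _ _
theorem inr_fold (X : C) : coprod.inr ≫ fold X = 𝟙 X := coprod.inr_desc _ _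
theorem inl_swap (X Y : C) : coprod.inl ≫ swap X Y = coprod.inr := coprod.inl_desc _ _
theorem inr_swap (X Y : C) : coprod.inr ≫ swap X Y = coprod.inl := coprod.inr_desc _ _

theorem map_fold {X X' : C} (f : X ⟶ X') : fold X ≫ f = coprod.map f f ≫ fold X' := by
  refine coprod.hom_ext ?_ ?_
  · rw [coprod.inl_map_assoc, inl_fold, ← Category.assoc, inl_fold, Category.comp_id,
      Category.id_comp]
  · rw [coprod.inr_map_assoc, inr_fold, ← Category.assoc, inr_fold, Category.comp_id,
      Category.id_comp]

variable [HasZeroMorphisms C]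

/-- The retraction of a finite sum onto the sum of all summands except the `j`-th one. -/
def retraction {k : ℕ} (M : Fin k → C) (j : Fin k) :
    (∐ M) ⟶ ∐ (fun i : {i : Fin k // i ≠ j} => M i) :=
  Sigma.desc fun i =>
    if h : i = j then 0 else Sigma.ι (fun i : {i : Fin k // i ≠ j} => M i) ⟨i, h⟩

/-- The cross-effect `cr_k F (M₁, …, M_k)`: the common kernel of the maps which `F` induces
from the retractions. -/
def crossEffect (F : C ⥤ AddCommGrpCat.{w}) {k : ℕ} (M : Fin k → C) : AddSubgroup (F.obj (∐ M)) :=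
  ⨅ j : Fin k, (F.map (retraction M j)).hom.ker

/-- `F` is polynomial of degree `n` if its cross-effect of rank `n + 1` vanishes. -/
def IsPolynomial (n : ℕ) (F : C ⥤ AddCommGrpCat.{w}) : Prop :=
  ∀ M : Fin (n + 1) → C, crossEffect F M = ⊥

/-- The retractions `ρ₁`, `ρ₂` of a sum of two objects. -/
def rho₁ (X Y : C) : X ⨿ Y ⟶ X := coprod.desc (𝟙 X) 0

/-- See `rho₁`. -/
def rho₂ (X Y : C) : X ⨿ Y ⟶ Y := coprod.desc 0 (𝟙 Y)

theorem inl_rho₁ (X Y : C) : coprod.inl ≫ rho₁ X Y = 𝟙 X := coprod.inl_desc _ _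
theorem inr_rho₁ (X Y : C) : coprod.inr ≫ rho₁ X Y = 0 := coprod.inr_desc _ _
theorem inl_rho₂ (X Y : C) : coprod.inl ≫ rho₂ X Y = 0 := coprod.inl_desc _ _
theorem inr_rho₂ (X Y : C) : coprod.inr ≫ rho₂ X Y = 𝟙 Y := coprod.inr_desc _ _

theorem swap_rho₁ (X Y : C) : swap X Y ≫ rho₁ Y X = rho₂ X Y := by
  refine coprod.hom_ext ?_ ?_
  · rw [← Category.assoc, inl_swap, inr_rho₁, inl_rho₂]
  · rw [← Category.assoc, inr_swap, inl_rho₁, inr_rho₂]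

theorem swap_rho₂ (X Y : C) : swap X Y ≫ rho₂ Y X = rho₁ X Y := by
  refine coprod.hom_ext ?_ ?_
  · rw [← Category.assoc, inl_swap, inr_rho₂, inl_rho₁]
  · rw [← Category.assoc, inr_swap, inl_rho₂, inr_rho₁]

/-- The second cross-effect `cr₂ F (X, Y)`, written with the binary sum. -/
def cr₂ (F : C ⥤ AddCommGrpCat.{w}) (X Y : C) : AddSubgroup (F.obj (X ⨿ Y)) :=
  (F.map (rho₂ X Y)).hom.ker ⊓ (F.map (rho₁ X Y)).hom.ker

theorem mem_cr₂ {F : C ⥤ AddCommGrpCat.{w}} {X Y : C} {x : F.obj (X ⨿ Y)} :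
    x ∈ cr₂ F X Y ↔ F.map (rho₂ X Y) x = 0 ∧ F.map (rho₁ X Y) x = 0 := Iff.rfl

/-- A map of sums commuting with the retractions restricts to second cross-effects. -/
theorem map_mem_cr₂ (F : C ⥤ AddCommGrpCat.{w}) {X Y X' Y' : C} (f : X ⟶ X') (g : Y ⟶ Y')
    {x : F.obj (X ⨿ Y)} (hx : x ∈ cr₂ F X Y) : F.map (coprod.map f g) x ∈ cr₂ F X' Y' := by
  rw [mem_cr₂] at hx ⊢
  have h₂ : coprod.map f g ≫ rho₂ X' Y' = rho₂ X Y ≫ g := by ext <;> simp [rho₂]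
  have h₁ : coprod.map f g ≫ rho₁ X' Y' = rho₁ X Y ≫ f := by ext <;> simp [rho₁]
  constructor
  · rw [← ConcreteCategory.comp_apply, ← F.map_comp, h₂, F.map_comp, ConcreteCategory.comp_apply,
      hx.1, map_zero]
  · rw [← ConcreteCategory.comp_apply, ← F.map_comp, h₁, F.map_comp, ConcreteCategory.comp_apply,
      hx.2, map_zero]

theorem swap_mem_cr₂ (F : C ⥤ AddCommGrpCat.{w}) {X Y : C}
    {x : F.obj (X ⨿ Y)} (hx : x ∈ cr₂ F X Y) : F.map (swap X Y) x ∈ cr₂ F Y X := by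
  rw [mem_cr₂] at hx ⊢
  have h₂ : swap X Y ≫ rho₂ Y X = rho₁ X Y := swap_rho₂ X Y
  have h₁ : swap X Y ≫ rho₁ Y X = rho₂ X Y := swap_rho₁ X Y
  constructor
  · rw [← ConcreteCategory.comp_apply, ← F.map_comp, h₂, hx.2]
  · rw [← ConcreteCategory.comp_apply, ← F.map_comp, h₁, hx.1]

theorem app_mem_cr₂ {F G : C ⥤ AddCommGrpCat.{w}} (η : F ⟶ G) {X Y : C}
    {x : F.obj (X ⨿ Y)} (hx : x ∈ cr₂ F X Y) : η.app (X ⨿ Y) x ∈ cr₂ G X Y := by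
  rw [mem_cr₂] at hx ⊢
  constructor
  · rw [← ConcreteCategory.comp_apply, ← η.naturality, ConcreteCategory.comp_apply, hx.1, map_zero]
  · rw [← ConcreteCategory.comp_apply, ← η.naturality, ConcreteCategory.comp_apply, hx.2, map_zero]

/-- Functoriality of `cr₂ F` in its two arguments. -/
def cr₂Map (F : C ⥤ AddCommGrpCat.{w}) {X Y X' Y' : C} (f : X ⟶ X') (g : Y ⟶ Y') :
    cr₂ F X Y →+ cr₂ F X' Y' :=
  ((F.map (coprod.map f g)).hom.comp (cr₂ F X Y).subtype).codRestrict _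
    fun x => map_mem_cr₂ F f g x.2

/-- The interchange `cr₂ F (X, Y) → cr₂ F (Y, X)`. -/
def cr₂Swap (F : C ⥤ AddCommGrpCat.{w}) (X Y : C) : cr₂ F X Y →+ cr₂ F Y X :=
  ((F.map (swap X Y)).hom.comp (cr₂ F X Y).subtype).codRestrict _
    fun x => swap_mem_cr₂ F x.2

/-- Functoriality of `cr₂ F (X, Y)` in `F`. -/
def cr₂Nat {F G : C ⥤ AddCommGrpCat.{w}} (η : F ⟶ G) (X Y : C) : cr₂ F X Y →+ cr₂ G X Y :=
  ((η.app (X ⨿ Y)).hom.comp (cr₂ F X Y).subtype).codRestrict _ fun x => app_mem_cr₂ η x.2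

/-- The projection `F(ι₁ ⋄ ι₂)` of `F (X + Y)` onto the second cross-effect, where
`F(ι₁ ⋄ ι₂) = F(ι₁ + ι₂) - F(ι₁ρ₁) - F(ι₂ρ₂) + F(0)` is the deviation of `ι₁`, `ι₂`. -/
def cr₂Proj (F : C ⥤ AddCommGrpCat.{w}) (X Y : C) : F.obj (X ⨿ Y) →+ cr₂ F X Y :=
  (AddMonoidHom.id _ - (F.map (rho₁ X Y ≫ coprod.inl)).hom - (F.map (rho₂ X Y ≫ coprod.inr)).hom
    + (F.map (0 : X ⨿ Y ⟶ X ⨿ Y)).hom).codRestrict _ fun x => by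
  have e : ∀ {A : C} (f : X ⨿ Y ⟶ X ⨿ Y) (g : X ⨿ Y ⟶ A),
      F.map g (F.map f x) = F.map (f ≫ g) x := fun f g => by
    rw [F.map_comp, ConcreteCategory.comp_apply]
  have a₁ : (rho₁ X Y ≫ coprod.inl) ≫ rho₁ X Y = rho₁ X Y := by
    rw [Category.assoc, inl_rho₁, Category.comp_id]
  have a₂ : (rho₁ X Y ≫ coprod.inl) ≫ rho₂ X Y = 0 := by
    rw [Category.assoc, inl_rho₂, comp_zero]
  have b₁ : (rho₂ X Y ≫ coprod.inr) ≫ rho₁ X Y = 0 := by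
    rw [Category.assoc, inr_rho₁, comp_zero]
  have b₂ : (rho₂ X Y ≫ coprod.inr) ≫ rho₂ X Y = rho₂ X Y := by
    rw [Category.assoc, inr_rho₂, Category.comp_id]
  rw [mem_cr₂]
  constructor
  · change F.map _ (x - F.map _ x - F.map _ x + F.map _ x) = 0
    rw [map_add, map_sub, map_sub, e, e, e, a₂, b₂, zero_comp]
    abel
  · change F.map _ (x - F.map _ x - F.map _ x + F.map _ x) = 0
    rw [map_add, map_sub, map_sub, e, e, e, a₁, b₁, zero_comp]
    abel

/-! ### Bilinearisation -/

/-- The subgroup of `cr₂ F (X, Y)` to be divided out in order to bilinearise: the sum of the images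
of `cr₂ (cr₂ F (-, Y)) (X, X)` and of `cr₂ (cr₂ F (X, -)) (Y, Y)` under the folding maps. -/
def bilinKer (F : C ⥤ AddCommGrpCat.{w}) (X Y : C) : AddSubgroup (cr₂ F X Y) :=
  ((cr₂Map F (rho₁ X X) (𝟙 Y)).ker ⊓ (cr₂Map F (rho₂ X X) (𝟙 Y)).ker).map
      (cr₂Map F (fold X) (𝟙 Y)) ⊔
    ((cr₂Map F (𝟙 X) (rho₁ Y Y)).ker ⊓ (cr₂Map F (𝟙 X) (rho₂ Y Y)).ker).map
      (cr₂Map F (𝟙 X) (fold Y))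

/-- The bilinearisation `T₁₁ cr₂ F (X, Y)` of the second cross-effect. -/
abbrev T₁₁cr₂ (F : C ⥤ AddCommGrpCat.{w}) (X Y : C) : Type w := cr₂ F X Y ⧸ bilinKer F X Y

theorem cr₂Map_comp (F : C ⥤ AddCommGrpCat.{w}) {X Y X' Y' X'' Y'' : C} (f : X ⟶ X') (g : Y ⟶ Y')
    (f' : X' ⟶ X'') (g' : Y' ⟶ Y'') (x : cr₂ F X Y) :
    cr₂Map F f' g' (cr₂Map F f g x) = cr₂Map F (f ≫ f') (g ≫ g') x := by
  apply Subtype.ext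
  change F.map _ (F.map _ _) = F.map _ _
  rw [← ConcreteCategory.comp_apply, ← F.map_comp, coprod.map_map]

theorem cr₂Map_id (F : C ⥤ AddCommGrpCat.{w}) (X Y : C) (x : cr₂ F X Y) :
    cr₂Map F (𝟙 X) (𝟙 Y) x = x := by
  apply Subtype.ext
  change F.map _ x.1 = x.1
  rw [coprod.map_id_id, F.map_id, ConcreteCategory.id_apply]

theorem cr₂Map_zero_left (F : C ⥤ AddCommGrpCat.{w}) {X Y X' Y' : C} (g : Y ⟶ Y') (x : cr₂ F X Y) :
    cr₂Map F (0 : X ⟶ X') g x = 0 := by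
  apply Subtype.ext
  change F.map _ x.1 = 0
  have h : coprod.map (0 : X ⟶ X') g = rho₂ X Y ≫ g ≫ coprod.inr := by
    refine coprod.hom_ext ?_ ?_
    · rw [coprod.inl_map, ← Category.assoc, inl_rho₂, zero_comp, zero_comp]
    · rw [coprod.inr_map, ← Category.assoc, inr_rho₂, Category.id_comp]
  rw [h, F.map_comp, ConcreteCategory.comp_apply, (mem_cr₂.1 x.2).1, map_zero]

theorem cr₂Map_zero_right (F : C ⥤ AddCommGrpCat.{w}) {X Y X' Y' : C} (f : X ⟶ X') (x : cr₂ F X Y) :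
    cr₂Map F f (0 : Y ⟶ Y') x = 0 := by
  apply Subtype.ext
  change F.map _ x.1 = 0
  have h : coprod.map f (0 : Y ⟶ Y') = rho₁ X Y ≫ f ≫ coprod.inl := by
    refine coprod.hom_ext ?_ ?_
    · rw [coprod.inl_map, ← Category.assoc, inl_rho₁, Category.id_comp]
    · rw [coprod.inr_map, ← Category.assoc, inr_rho₁, zero_comp, zero_comp]
  rw [h, F.map_comp, ConcreteCategory.comp_apply, (mem_cr₂.1 x.2).2, map_zero]

theorem cr₂Swap_cr₂Map (F : C ⥤ AddCommGrpCat.{w}) {X Y X' Y' : C} (f : X ⟶ X') (g : Y ⟶ Y')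
    (x : cr₂ F X Y) : cr₂Swap F X' Y' (cr₂Map F f g x) = cr₂Map F g f (cr₂Swap F X Y x) := by
  apply Subtype.ext
  change F.map _ (F.map _ _) = F.map _ (F.map _ _)
  have h : coprod.map f g ≫ swap X' Y' = swap X Y ≫ coprod.map g f := by
    refine coprod.hom_ext ?_ ?_
    · rw [coprod.inl_map_assoc, inl_swap, ← Category.assoc, inl_swap, coprod.inr_map]
    · rw [coprod.inr_map_assoc, inr_swap, ← Category.assoc, inr_swap, coprod.inl_map]
  rw [← ConcreteCategory.comp_apply, ← F.map_comp, h, F.map_comp, ConcreteCategory.comp_apply]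

theorem cr₂Nat_cr₂Map {F G : C ⥤ AddCommGrpCat.{w}} (η : F ⟶ G) {X Y X' Y' : C}
    (f : X ⟶ X') (g : Y ⟶ Y') (x : cr₂ F X Y) :
    cr₂Nat η X' Y' (cr₂Map F f g x) = cr₂Map G f g (cr₂Nat η X Y x) := by
  apply Subtype.ext
  change η.app _ (F.map _ _) = G.map _ (η.app _ _)
  rw [← ConcreteCategory.comp_apply, η.naturality, ConcreteCategory.comp_apply]

theorem map_rho₁_fold {X X' : C} (f : X ⟶ X') : rho₁ X X ≫ f = coprod.map f f ≫ rho₁ X' X' := by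
  refine coprod.hom_ext ?_ ?_
  · rw [coprod.inl_map_assoc, inl_rho₁, ← Category.assoc, inl_rho₁, Category.comp_id,
      Category.id_comp]
  · rw [coprod.inr_map_assoc, inr_rho₁, ← Category.assoc, inr_rho₁, comp_zero, zero_comp]

theorem map_rho₂_fold {X X' : C} (f : X ⟶ X') : rho₂ X X ≫ f = coprod.map f f ≫ rho₂ X' X' := by
  refine coprod.hom_ext ?_ ?_
  · rw [coprod.inl_map_assoc, inl_rho₂, ← Category.assoc, inl_rho₂, comp_zero, zero_comp]
  · rw [coprod.inr_map_assoc, inr_rho₂, ← Category.assoc, inr_rho₂, Category.comp_id,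
      Category.id_comp]

theorem bilinKer_le_map (F : C ⥤ AddCommGrpCat.{w}) {X Y X' Y' : C} (f : X ⟶ X') (g : Y ⟶ Y') :
    bilinKer F X Y ≤ (bilinKer F X' Y').comap (cr₂Map F f g) := by
  refine sup_le ?_ ?_
  · rintro _ ⟨z, ⟨h₁, h₂⟩, rfl⟩
    refine AddSubgroup.mem_sup_left ⟨cr₂Map F (coprod.map f f) g z, ⟨?_, ?_⟩, ?_⟩
    · change cr₂Map F _ _ _ = 0
      replace h₁ : cr₂Map F _ _ z = 0 := h₁
      rw [cr₂Map_comp, ← map_rho₁_fold, Category.comp_id, ← Category.id_comp g, ← cr₂Map_comp, h₁,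
        map_zero]
    · change cr₂Map F _ _ _ = 0
      replace h₂ : cr₂Map F _ _ z = 0 := h₂
      rw [cr₂Map_comp, ← map_rho₂_fold, Category.comp_id, ← Category.id_comp g, ← cr₂Map_comp, h₂,
        map_zero]
    · rw [cr₂Map_comp, cr₂Map_comp, map_fold, Category.comp_id, Category.id_comp]
  · rintro _ ⟨z, ⟨h₁, h₂⟩, rfl⟩
    refine AddSubgroup.mem_sup_right ⟨cr₂Map F f (coprod.map g g) z, ⟨?_, ?_⟩, ?_⟩
    · change cr₂Map F _ _ _ = 0
      replace h₁ : cr₂Map F _ _ z = 0 := h₁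
      rw [cr₂Map_comp, ← map_rho₁_fold, Category.comp_id, ← Category.id_comp f, ← cr₂Map_comp, h₁,
        map_zero]
    · change cr₂Map F _ _ _ = 0
      replace h₂ : cr₂Map F _ _ z = 0 := h₂
      rw [cr₂Map_comp, ← map_rho₂_fold, Category.comp_id, ← Category.id_comp f, ← cr₂Map_comp, h₂,
        map_zero]
    · rw [cr₂Map_comp, cr₂Map_comp, map_fold, Category.comp_id, Category.id_comp]

theorem bilinKer_le_swap (F : C ⥤ AddCommGrpCat.{w}) (X Y : C) :
    bilinKer F X Y ≤ (bilinKer F Y X).comap (cr₂Swap F X Y) := by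
  refine sup_le ?_ ?_
  · rintro _ ⟨z, ⟨h₁, h₂⟩, rfl⟩
    refine AddSubgroup.mem_sup_right ⟨cr₂Swap F _ _ z, ⟨?_, ?_⟩, (cr₂Swap_cr₂Map _ _ _ _).symm⟩
    · exact (cr₂Swap_cr₂Map _ _ _ _).symm.trans ((congrArg _ h₁).trans (map_zero _))
    · exact (cr₂Swap_cr₂Map _ _ _ _).symm.trans ((congrArg _ h₂).trans (map_zero _))
  · rintro _ ⟨z, ⟨h₁, h₂⟩, rfl⟩
    refine AddSubgroup.mem_sup_left ⟨cr₂Swap F _ _ z, ⟨?_, ?_⟩, (cr₂Swap_cr₂Map _ _ _ _).symm⟩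
    · exact (cr₂Swap_cr₂Map _ _ _ _).symm.trans ((congrArg _ h₁).trans (map_zero _))
    · exact (cr₂Swap_cr₂Map _ _ _ _).symm.trans ((congrArg _ h₂).trans (map_zero _))

theorem bilinKer_le_nat {F G : C ⥤ AddCommGrpCat.{w}} (η : F ⟶ G) (X Y : C) :
    bilinKer F X Y ≤ (bilinKer G X Y).comap (cr₂Nat η X Y) := by
  refine sup_le ?_ ?_
  · rintro _ ⟨z, ⟨h₁, h₂⟩, rfl⟩
    refine AddSubgroup.mem_sup_left ⟨cr₂Nat η _ _ z, ⟨?_, ?_⟩, (cr₂Nat_cr₂Map _ _ _ _).symm⟩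
    · exact (cr₂Nat_cr₂Map _ _ _ _).symm.trans ((congrArg _ h₁).trans (map_zero _))
    · exact (cr₂Nat_cr₂Map _ _ _ _).symm.trans ((congrArg _ h₂).trans (map_zero _))
  · rintro _ ⟨z, ⟨h₁, h₂⟩, rfl⟩
    refine AddSubgroup.mem_sup_right ⟨cr₂Nat η _ _ z, ⟨?_, ?_⟩, (cr₂Nat_cr₂Map _ _ _ _).symm⟩
    · exact (cr₂Nat_cr₂Map _ _ _ _).symm.trans ((congrArg _ h₁).trans (map_zero _))
    · exact (cr₂Nat_cr₂Map _ _ _ _).symm.trans ((congrArg _ h₂).trans (map_zero _))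

/-- Functoriality of `T₁₁ cr₂ F (X, Y)` in `X` and `Y`. -/
def T₁₁Map (F : C ⥤ AddCommGrpCat.{w}) {X Y X' Y' : C} (f : X ⟶ X') (g : Y ⟶ Y') :
    T₁₁cr₂ F X Y →+ T₁₁cr₂ F X' Y' :=
  QuotientAddGroup.map _ _ (cr₂Map F f g) (bilinKer_le_map F f g)

/-- The interchange `T₁₁ cr₂ F (X, Y) → T₁₁ cr₂ F (Y, X)`. -/
def T₁₁Swap (F : C ⥤ AddCommGrpCat.{w}) (X Y : C) : T₁₁cr₂ F X Y →+ T₁₁cr₂ F Y X :=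
  QuotientAddGroup.map _ _ (cr₂Swap F X Y) (bilinKer_le_swap F X Y)

/-- Functoriality of `T₁₁ cr₂ F (X, Y)` in `F`. -/
def T₁₁Nat {F G : C ⥤ AddCommGrpCat.{w}} (η : F ⟶ G) (X Y : C) : T₁₁cr₂ F X Y →+ T₁₁cr₂ G X Y :=
  QuotientAddGroup.map _ _ (cr₂Nat η X Y) (bilinKer_le_nat η X Y)

end CrossEffects

/-! ### The reduced monoid ring -/

section Ring

variable {C : Type u} [Category.{v} C] [HasZeroMorphisms C]

/-- The relation `[0] = 0` in the monoid ring `ℤ[C(Ω, Ω)]`. -/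
inductive ReducedRel (Ω : C) : MonoidAlgebra ℤ (End Ω) → MonoidAlgebra ℤ (End Ω) → Prop
  | zero : ReducedRel Ω (MonoidAlgebra.single (0 : Ω ⟶ Ω) 1) 0

/-- The reduced monoid ring `Λ` of `C(Ω, Ω)`: the monoid ring over `ℤ`, modulo the zero arrow.
The product of `End Ω` is composition in the usual order, `α * β = β ≫ α`. -/
def ReducedRing (Ω : C) : Type v := RingQuot (ReducedRel Ω)

instance (Ω : C) : Ring (ReducedRing Ω) := inferInstanceAs (Ring (RingQuot (ReducedRel Ω)))

/-- The projection of the monoid ring onto `Λ`. -/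
def ReducedRing.mk (Ω : C) : MonoidAlgebra ℤ (End Ω) →+* ReducedRing Ω :=
  RingQuot.mkRingHom (ReducedRel Ω)

/-- The class in `Λ` of an arrow `Ω ⟶ Ω`. -/
def arrow {Ω : C} : End Ω →* ReducedRing Ω :=
  (ReducedRing.mk Ω).toMonoidHom.comp (MonoidAlgebra.of ℤ (End Ω))

theorem arrow_zero {Ω : C} : arrow (0 : Ω ⟶ Ω) = 0 :=
  (RingQuot.mkRingHom_rel (ReducedRel.zero (Ω := Ω))).trans (map_zero _)

/-- The universal property of `Λ`. -/
def ReducedRing.lift {Ω : C} {R : Type*} [Ring R] (f : End Ω →* R) (hf : f (0 : Ω ⟶ Ω) = 0) :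
    ReducedRing Ω →+* R :=
  RingQuot.lift ⟨(MonoidAlgebra.lift ℤ R (End Ω) f).toRingHom, by
    rintro _ _ ⟨⟩
    change MonoidAlgebra.lift ℤ R (End Ω) f _ = MonoidAlgebra.lift ℤ R (End Ω) f 0
    rw [MonoidAlgebra.lift_single, hf, smul_zero, map_zero]⟩

theorem ReducedRing.lift_arrow {Ω : C} {R : Type*} [Ring R] (f : End Ω →* R) (hf : f (0 : Ω ⟶ Ω) = 0)
    (α : End Ω) : ReducedRing.lift f hf (arrow α) = f α := by
  refine (RingQuot.lift_mkRingHom_apply (MonoidAlgebra.lift ℤ R (End Ω) f).toRingHom _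
    (MonoidAlgebra.single α 1)).trans ?_
  change MonoidAlgebra.lift ℤ R (End Ω) f (MonoidAlgebra.single α 1) = f α
  rw [MonoidAlgebra.lift_single, one_smul]

theorem ReducedRing.induction {Ω : C} {p : ReducedRing Ω → Prop} (h : ∀ α, p (arrow α))
    (h0 : p 0) (hadd : ∀ x y, p x → p y → p (x + y)) (hneg : ∀ x, p x → p (-x)) (x) : p x := by
  obtain ⟨y, rfl⟩ := RingQuot.mkRingHom_surjective (ReducedRel Ω) x
  change p (ReducedRing.mk Ω y)
  induction y using MonoidAlgebra.induction_on with
  | of α => exact h α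
  | add x y hx hy => rw [map_add]; exact hadd _ _ hx hy
  | smul r x hx =>
    rw [map_zsmul]
    induction r with
    | zero => rw [zero_smul]; exact h0
    | succ n hn => rw [add_smul, one_smul]; exact hadd _ _ hn hx
    | pred n hn => rw [sub_smul, one_smul, sub_eq_add_neg]; exact hadd _ _ hn (hneg _ hx)

/-- The diagonal `Λ → Λ ⊗ Λ`, the ring homomorphism with `[α] ↦ [α] ⊗ [α]`. -/
def diagonal (Ω : C) : ReducedRing Ω →+* ReducedRing Ω ⊗[ℤ] ReducedRing Ω :=
  ReducedRing.lift
    { toFun := fun α => arrow α ⊗ₜ[ℤ] arrow α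
      map_one' := by rw [map_one]; rfl
      map_mul' := fun α β => by rw [map_mul, Algebra.TensorProduct.tmul_mul_tmul] }
    (by
      change arrow (0 : Ω ⟶ Ω) ⊗ₜ[ℤ] arrow (0 : Ω ⟶ Ω) = 0
      rw [arrow_zero, TensorProduct.zero_tmul])

end Ring

/-! ### Tensor products over a non-commutative ring -/

section Balanced

variable (S R A B : Type*) [Ring S] [Ring R] [AddCommGroup A] [AddCommGroup B]
  [Module S A] [Module Rᵐᵒᵖ A] [SMulCommClass S Rᵐᵒᵖ A] [Module R B]

/-- The relations `a r ⊗ b = a ⊗ r b`. This set of relations is stable under `S`, so that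
its `S`-span is the subgroup it generates. -/
def balancedRel : Submodule S (A ⊗[ℤ] B) :=
  Submodule.span S {z | ∃ (a : A) (r : R) (b : B),
    z = (MulOpposite.op r • a) ⊗ₜ[ℤ] b - a ⊗ₜ[ℤ] (r • b)}

/-- The tensor product `A ⊗_R B` of an `S`-`R`-bimodule and a left `R`-module,
as a left `S`-module. -/
abbrev BalancedTensor : Type _ := (A ⊗[ℤ] B) ⧸ balancedRel S R A B

variable {A B}

/-- The pure tensors of `A ⊗_R B`. -/
def btmul (a : A) (b : B) : BalancedTensor S R A B := Submodule.Quotient.mk (a ⊗ₜ[ℤ] b)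

end Balanced

/-! ### The bimodule `T₁₁ cr₂ U (Ω, Ω)` -/

section Bimodule

variable {C : Type u} [Category.{v} C] [HasZeroMorphisms C] [HasFiniteCoproducts C]

/-- The standard projective functor `U = ℤ[C(Ω, -)]`. -/
def standardProjective (Ω : C) : C ⥤ AddCommGrpCat.{v} :=
  coyoneda.obj (Opposite.op Ω) ⋙ AddCommGrpCat.free

/-- Precomposition with `α : Ω ⟶ Ω`, as an endomorphism of `U`. -/
def precomp {Ω : C} (α : Ω ⟶ Ω) : standardProjective Ω ⟶ standardProjective Ω :=
  Functor.whiskerRight (coyoneda.map α.op) AddCommGrpCat.free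

/-- The group `T₁₁ cr₂ U (Ω, Ω)`. -/
def TU (Ω : C) : Type v := T₁₁cr₂ (standardProjective Ω) Ω Ω

instance (Ω : C) : AddCommGroup (TU Ω) :=
  inferInstanceAs (AddCommGroup (T₁₁cr₂ (standardProjective Ω) Ω Ω))

/-- The class `[ξ]` of `ξ : Ω ⟶ Ω + Ω` in `T₁₁ cr₂ U (Ω, Ω)`. -/
def cls {Ω : C} (ξ : Ω ⟶ Ω ⨿ Ω) : TU Ω :=
  QuotientAddGroup.mk (cr₂Proj (standardProjective Ω) Ω Ω (FreeAbelianGroup.of ξ))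

/-- The involution of `T₁₁ cr₂ U (Ω, Ω)`, interchanging the two arguments. -/
def TUSwap (Ω : C) : TU Ω →+ TU Ω := T₁₁Swap (standardProjective Ω) Ω Ω

/-- The operation of a pair of arrows on `T₁₁ cr₂ U (Ω, Ω)` by functoriality. -/
def TUMap {Ω : C} (α β : Ω ⟶ Ω) : TU Ω →ₗ[ℤ] TU Ω :=
  (T₁₁Map (standardProjective Ω) α β).toIntLinearMap

/-- The operation of an arrow on `T₁₁ cr₂ U (Ω, Ω)` by precomposition. -/
def TUPre {Ω : C} (α : Ω ⟶ Ω) : TU Ω →ₗ[ℤ] TU Ω :=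
  (T₁₁Nat (precomp α) Ω Ω).toIntLinearMap

theorem TUMap_comp {Ω : C} (α β α' β' : Ω ⟶ Ω) (t : TU Ω) :
    TUMap α' β' (TUMap α β t) = TUMap (α ≫ α') (β ≫ β') t := by
  obtain ⟨x, rfl⟩ := QuotientAddGroup.mk_surjective t
  exact congrArg QuotientAddGroup.mk (cr₂Map_comp _ _ _ _ _ x)

theorem TUMap_id {Ω : C} (t : TU Ω) : TUMap (𝟙 Ω) (𝟙 Ω) t = t := by
  obtain ⟨x, rfl⟩ := QuotientAddGroup.mk_surjective t
  exact congrArg QuotientAddGroup.mk (cr₂Map_id _ _ _ x)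

theorem TUMap_zero_left {Ω : C} (β : Ω ⟶ Ω) (t : TU Ω) : TUMap 0 β t = 0 := by
  obtain ⟨x, rfl⟩ := QuotientAddGroup.mk_surjective t
  exact congrArg QuotientAddGroup.mk (cr₂Map_zero_left _ _ x)

theorem TUMap_zero_right {Ω : C} (α : Ω ⟶ Ω) (t : TU Ω) : TUMap α 0 t = 0 := by
  obtain ⟨x, rfl⟩ := QuotientAddGroup.mk_surjective t
  exact congrArg QuotientAddGroup.mk (cr₂Map_zero_right _ _ x)

theorem TUPre_comp {Ω : C} (α β : Ω ⟶ Ω) (t : TU Ω) :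
    TUPre α (TUPre β t) = TUPre (α ≫ β) t := by
  obtain ⟨x, rfl⟩ := QuotientAddGroup.mk_surjective t
  refine congrArg QuotientAddGroup.mk (Subtype.ext ?_)
  change (precomp α).app _ ((precomp β).app _ x.1) = (precomp (α ≫ β)).app _ x.1
  have h : precomp (α ≫ β) = precomp β ≫ precomp α := by
    refine (congrArg (fun η => Functor.whiskerRight η AddCommGrpCat.free) ?_).trans
      (Functor.whiskerRight_comp _ _ _)
    rw [op_comp, coyoneda.map_comp]
  rw [h, NatTrans.comp_app, ConcreteCategory.comp_apply]

theorem TUPre_id {Ω : C} (t : TU Ω) : TUPre (𝟙 Ω) t = t := by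
  obtain ⟨x, rfl⟩ := QuotientAddGroup.mk_surjective t
  refine congrArg QuotientAddGroup.mk (Subtype.ext ?_)
  change (precomp (𝟙 Ω)).app _ x.1 = x.1
  have h : precomp (𝟙 Ω) = 𝟙 (standardProjective Ω) := by
    refine (congrArg (fun η => Functor.whiskerRight η AddCommGrpCat.free) ?_).trans
      (Functor.whiskerRight_id' _)
    rw [op_id, coyoneda.map_id]
  rw [h, NatTrans.id_app, ConcreteCategory.id_apply]

theorem TUPre_zero {Ω : C} (t : TU Ω) : TUPre 0 t = 0 := by
  obtain ⟨x, rfl⟩ := QuotientAddGroup.mk_surjective t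
  refine congrArg QuotientAddGroup.mk (Subtype.ext ?_)
  have h : (precomp (0 : Ω ⟶ Ω)).app (Ω ⨿ Ω) =
      (standardProjective Ω).map (rho₁ Ω Ω ≫ (0 : Ω ⟶ Ω ⨿ Ω)) := by
    refine congrArg AddCommGrpCat.free.map ?_
    ext ξ
    change (0 : Ω ⟶ Ω) ≫ ξ = ξ ≫ rho₁ Ω Ω ≫ 0
    rw [zero_comp, comp_zero, comp_zero]
  change (precomp 0).app _ x.1 = 0
  rw [h, Functor.map_comp, ConcreteCategory.comp_apply, (mem_cr₂.1 x.2).2, map_zero]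

theorem TUPre_TUMap {Ω : C} (γ α β : Ω ⟶ Ω) (t : TU Ω) :
    TUPre γ (TUMap α β t) = TUMap α β (TUPre γ t) := by
  obtain ⟨x, rfl⟩ := QuotientAddGroup.mk_surjective t
  exact congrArg QuotientAddGroup.mk (cr₂Nat_cr₂Map _ _ _ x)

/-- The left operation of `Λ` on the first argument of `T₁₁ cr₂ U (Ω, Ω)`. -/
def actFst (Ω : C) : ReducedRing Ω →+* Module.End ℤ (TU Ω) :=
  ReducedRing.lift
    { toFun := fun α => TUMap α (𝟙 Ω)
      map_one' := LinearMap.ext fun t => TUMap_id t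
      map_mul' := fun α β => LinearMap.ext fun t => by
        change TUMap (β ≫ α) (𝟙 Ω) t = TUMap α (𝟙 Ω) (TUMap β (𝟙 Ω) t)
        rw [TUMap_comp, Category.comp_id] }
    (LinearMap.ext fun t => TUMap_zero_left _ t)

/-- The left operation of `Λ` on the second argument of `T₁₁ cr₂ U (Ω, Ω)`. -/
def actSnd (Ω : C) : ReducedRing Ω →+* Module.End ℤ (TU Ω) :=
  ReducedRing.lift
    { toFun := fun β => TUMap (𝟙 Ω) β
      map_one' := LinearMap.ext fun t => TUMap_id t
      map_mul' := fun α β => LinearMap.ext fun t => by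
        change TUMap (𝟙 Ω) (β ≫ α) t = TUMap (𝟙 Ω) α (TUMap (𝟙 Ω) β t)
        rw [TUMap_comp, Category.comp_id] }
    (LinearMap.ext fun t => TUMap_zero_right _ t)

/-- The right operation of `Λ` on `T₁₁ cr₂ U (Ω, Ω)`. -/
def actRight (Ω : C) : ReducedRing Ω →+* (Module.End ℤ (TU Ω))ᵐᵒᵖ :=
  ReducedRing.lift
    { toFun := fun γ => MulOpposite.op (TUPre γ)
      map_one' := congrArg MulOpposite.op (LinearMap.ext fun t => TUPre_id t)
      map_mul' := fun α β => congrArg MulOpposite.op (LinearMap.ext fun t => by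
        change TUPre (β ≫ α) t = TUPre β (TUPre α t)
        rw [TUPre_comp]) }
    (congrArg MulOpposite.op (LinearMap.ext fun t => TUPre_zero t))

theorem actFst_arrow {Ω : C} (α : Ω ⟶ Ω) : actFst Ω (arrow α) = TUMap α (𝟙 Ω) :=
  ReducedRing.lift_arrow _ _ _

theorem actSnd_arrow {Ω : C} (β : Ω ⟶ Ω) : actSnd Ω (arrow β) = TUMap (𝟙 Ω) β :=
  ReducedRing.lift_arrow _ _ _

theorem actRight_arrow {Ω : C} (γ : Ω ⟶ Ω) :
    actRight Ω (arrow γ) = MulOpposite.op (TUPre γ) :=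
  ReducedRing.lift_arrow _ _ _

theorem act_commute (Ω : C) (x y : ReducedRing Ω) : Commute (actFst Ω x) (actSnd Ω y) := by
  induction x using ReducedRing.induction with
  | h0 => rw [map_zero]; exact Commute.zero_left _
  | hadd x x' hx hx' => rw [map_add]; exact hx.add_left hx'
  | hneg x hx => rw [map_neg]; exact hx.neg_left
  | h α =>
    induction y using ReducedRing.induction with
    | h0 => rw [map_zero]; exact Commute.zero_right _
    | hadd x x' hx hx' => rw [map_add]; exact hx.add_right hx'
    | hneg x hx => rw [map_neg]; exact hx.neg_right
    | h β =>
      rw [actFst_arrow, actSnd_arrow]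
      refine LinearMap.ext fun t => ?_
      change TUMap α (𝟙 Ω) (TUMap (𝟙 Ω) β t) = TUMap (𝟙 Ω) β (TUMap α (𝟙 Ω) t)
      rw [TUMap_comp, TUMap_comp, Category.comp_id, Category.id_comp, Category.comp_id,
        Category.id_comp]

/-- The left operation of `Λ ⊗ Λ` on `T₁₁ cr₂ U (Ω, Ω)`. -/
def actLeft (Ω : C) : ReducedRing Ω ⊗[ℤ] ReducedRing Ω →+* Module.End ℤ (TU Ω) :=
  (Algebra.TensorProduct.lift (actFst Ω).toIntAlgHom (actSnd Ω).toIntAlgHom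
    (act_commute Ω)).toRingHom

theorem actLeft_tmul {Ω : C} (x y : ReducedRing Ω) :
    actLeft Ω (x ⊗ₜ y) = actFst Ω x * actSnd Ω y :=
  Algebra.TensorProduct.lift_tmul _ _ _ _ _

instance (Ω : C) : Module (ReducedRing Ω ⊗[ℤ] ReducedRing Ω) (TU Ω) :=
  Module.compHom (TU Ω) (actLeft Ω)

instance (Ω : C) : Module (ReducedRing Ω)ᵐᵒᵖ (TU Ω) :=
  Module.compHom (TU Ω) ((RingEquiv.opOp _).symm.toRingHom.comp (RingHom.op (actRight Ω)))

instance (Ω : C) : SMulCommClass (ReducedRing Ω ⊗[ℤ] ReducedRing Ω) (ReducedRing Ω)ᵐᵒᵖ (TU Ω) where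
  smul_comm s r t := by
    suffices h : ∀ r : ReducedRing Ω, Commute (actLeft Ω s) (actRight Ω r).unop from
      LinearMap.congr_fun (h r.unop).eq t
    clear t r
    intro r
    induction r using ReducedRing.induction with
    | h0 => rw [map_zero]; exact Commute.zero_right _
    | hadd x x' hx hx' => rw [map_add]; exact hx.add_right hx'
    | hneg x hx => rw [map_neg]; exact hx.neg_right
    | h γ =>
      rw [actRight_arrow, MulOpposite.unop_op]
      induction s using TensorProduct.induction_on with
      | zero => rw [map_zero]; exact Commute.zero_left _
      | add x x' hx hx' => rw [map_add]; exact hx.add_left hx'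
      | tmul x y =>
        rw [actLeft_tmul]
        refine Commute.mul_left ?_ ?_
        · induction x using ReducedRing.induction with
          | h0 => rw [map_zero]; exact Commute.zero_left _
          | hadd x x' hx hx' => rw [map_add]; exact hx.add_left hx'
          | hneg x hx => rw [map_neg]; exact hx.neg_left
          | h α =>
            rw [actFst_arrow]
            exact LinearMap.ext fun t => (TUPre_TUMap _ _ _ t).symm
        · induction y using ReducedRing.induction with
          | h0 => rw [map_zero]; exact Commute.zero_left _
          | hadd x x' hx hx' => rw [map_add]; exact hx.add_left hx'
          | hneg x hx => rw [map_neg]; exact hx.neg_left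
          | h β =>
            rw [actSnd_arrow]
            exact LinearMap.ext fun t => (TUPre_TUMap _ _ _ t).symm

/-- The pure tensors of `T₁₁ cr₂ U (Ω, Ω) ⊗_Λ M`. -/
abbrev tens {Ω : C} {M : Type w} [AddCommGroup M] [Module (ReducedRing Ω) M] (t : TU Ω) (x : M) :
    BalancedTensor (ReducedRing Ω ⊗[ℤ] ReducedRing Ω) (ReducedRing Ω) (TU Ω) M :=
  btmul _ _ t x

end Bimodule

/-! ### Quadratic modules and quadratic functors -/

section Quadratic

variable {C : Type u} [Category.{v} C] [HasZeroMorphisms C] [HasFiniteCoproducts C]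

/-- Diagrams `T₁₁ cr₂ U (Ω, Ω) ⊗_Λ M_e ⟶ M_ee ⟶ M_e`, with an involution `T` of `M_ee`. -/
structure QuadraticModule (Ω : C) where
  /-- The left `Λ`-module `M_e`. -/
  Me : Type w
  [grpMe : AddCommGroup Me]
  [modMe : Module (ReducedRing Ω) Me]
  /-- The symmetric left `Λ ⊗ Λ`-module `M_ee`. -/
  Mee : Type w
  [grpMee : AddCommGroup Mee]
  [modMee : Module (ReducedRing Ω ⊗[ℤ] ReducedRing Ω) Mee]
  /-- The involution of `M_ee`. -/
  T : Mee →+ Mee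
  /-- The homomorphism `P`. -/
  P : Mee →+ Me
  /-- The homomorphism `Ĥ`. -/
  H : BalancedTensor (ReducedRing Ω ⊗[ℤ] ReducedRing Ω) (ReducedRing Ω) (TU Ω) Me
    →ₗ[ReducedRing Ω ⊗[ℤ] ReducedRing Ω] Mee
  T_T : ∀ m, T (T m) = m
  /-- `T ((a ⊗ b) m) = (b ⊗ a) T m`. -/
  T_smul : ∀ (s : ReducedRing Ω ⊗[ℤ] ReducedRing Ω) (m : Mee),
    T (s • m) = Algebra.TensorProduct.comm ℤ (ReducedRing Ω) (ReducedRing Ω) s • T m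
  /-- The operation of arrows on the first tensor factor is linear, that is, `Λ ⊗ Λ` operates
  through the linearisation of `Λ`. By symmetry, the same holds for the second factor. -/
  fold_smul : ∀ (ξ : Ω ⟶ Ω ⨿ Ω) (m : Mee),
    (arrow (ξ ≫ fold Ω) ⊗ₜ[ℤ] (1 : ReducedRing Ω)) • m =
      (arrow (ξ ≫ rho₁ Ω Ω) ⊗ₜ[ℤ] (1 : ReducedRing Ω)) • m +
        (arrow (ξ ≫ rho₂ Ω Ω) ⊗ₜ[ℤ] (1 : ReducedRing Ω)) • m
  /-- `P` is `Λ`-linear with respect to the diagonal operation of `Λ` on `M_ee`. -/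
  P_smul : ∀ (r : ReducedRing Ω) (m : Mee), P (diagonal Ω r • m) = r • P m
  P_T : ∀ m, P (T m) = P m
  /-- `Ĥ` commutes with the involutions, the one on the domain interchanging the two arguments of
  `cr₂`. -/
  H_swap : ∀ (t : TU Ω) (x : Me), H (tens (TUSwap Ω t) x) = T (H (tens t x))
  /-- `(∇ξ) x = (ρ₁ξ) x + (ρ₂ξ) x + P Ĥ ([ξ] ⊗ x)`. -/
  qm₁ : ∀ (ξ : Ω ⟶ Ω ⨿ Ω) (x : Me), arrow (ξ ≫ fold Ω) • x =
    arrow (ξ ≫ rho₁ Ω Ω) • x + arrow (ξ ≫ rho₂ Ω Ω) • x + P (H (tens (cls ξ) x))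
  /-- `Ĥ ([ξ] ⊗ P m) = (ρ₁ξ ⊗ ρ₂ξ) m + T ((ρ₂ξ ⊗ ρ₁ξ) m)`. -/
  qm₂ : ∀ (ξ : Ω ⟶ Ω ⨿ Ω) (m : Mee), H (tens (cls ξ) (P m)) =
    (arrow (ξ ≫ rho₁ Ω Ω) ⊗ₜ[ℤ] arrow (ξ ≫ rho₂ Ω Ω)) • m +
      T ((arrow (ξ ≫ rho₂ Ω Ω) ⊗ₜ[ℤ] arrow (ξ ≫ rho₁ Ω Ω)) • m)

namespace QuadraticModule

attribute [instance] grpMe modMe grpMee modMee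

/-- Morphisms of quadratic modules: pairs of module homomorphisms compatible with `T`, `P`, `Ĥ`. -/
@[ext]
structure Hom {Ω : C} (M N : QuadraticModule.{w} Ω) where
  /-- The component `M_e → N_e`. -/
  e : M.Me →ₗ[ReducedRing Ω] N.Me
  /-- The component `M_ee → N_ee`. -/
  ee : M.Mee →ₗ[ReducedRing Ω ⊗[ℤ] ReducedRing Ω] N.Mee
  comm_T : ∀ m, ee (M.T m) = N.T (ee m)
  comm_P : ∀ m, e (M.P m) = N.P (ee m)
  comm_H : ∀ (t : TU Ω) (x : M.Me), ee (M.H (tens t x)) = N.H (tens t (e x))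

instance (Ω : C) : Category (QuadraticModule.{w} Ω) where
  Hom := Hom
  id M := ⟨LinearMap.id, LinearMap.id, fun _ => rfl, fun _ => rfl, fun _ _ => rfl⟩
  comp f g := ⟨g.e.comp f.e, g.ee.comp f.ee,
    fun m => (congrArg g.ee (f.comm_T m)).trans (g.comm_T _),
    fun m => (congrArg g.e (f.comm_P m)).trans (g.comm_P _),
    fun t x => (congrArg g.ee (f.comm_H t x)).trans (g.comm_H t _)⟩

end QuadraticModule

open scoped ZeroObject in
/-- Quadratic functors `F : C ⥤ Ab` with `F(0) = 0`. -/
def reducedQuadratic (C : Type u) [Category.{v} C] [HasZeroObject C] [HasZeroMorphisms C]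
    [HasFiniteCoproducts C] : ObjectProperty (C ⥤ AddCommGrpCat.{w}) :=
  fun F => IsPolynomial 2 F ∧ IsZero (F.obj (0 : C))

/-- The category of quadratic functors `F : C ⥤ Ab` with `F(0) = 0`, as a full subcategory of the
category of functors. -/
abbrev QuadraticFunctor (C : Type u) [Category.{v} C] [HasZeroObject C] [HasZeroMorphisms C]
    [HasFiniteCoproducts C] :=
  (reducedQuadratic.{w} C).FullSubcategory

/-- The quadratic module `M` is the one belonging to `F`: there are given isomorphisms
`a : M_e ≅ F(Ω)` and `b : M_ee ≅ cr₂ F (Ω, Ω)`, under which the module structures and `T`, `P`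
are induced by functoriality, and `Ĥ ([ξ] ⊗ x)` is the projection of `F(ξ) x` to the
cross-effect. -/
structure Realizes {Ω : C} (F : C ⥤ AddCommGrpCat.{w}) (M : QuadraticModule.{w} Ω)
    (a : M.Me ≃+ F.obj Ω) (b : M.Mee ≃+ cr₂ F Ω Ω) : Prop where
  smul_e : ∀ (α : Ω ⟶ Ω) (x : M.Me), a (arrow α • x) = F.map α (a x)
  smul_ee : ∀ (α β : Ω ⟶ Ω) (m : M.Mee),
    b ((arrow α ⊗ₜ[ℤ] arrow β : ReducedRing Ω ⊗[ℤ] ReducedRing Ω) • m) = cr₂Map F α β (b m)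
  map_T : ∀ m : M.Mee, b (M.T m) = cr₂Swap F Ω Ω (b m)
  map_P : ∀ m : M.Mee, a (M.P m) = F.map (fold Ω) (b m : F.obj (Ω ⨿ Ω))
  map_H : ∀ (ξ : Ω ⟶ Ω ⨿ Ω) (x : M.Me),
    b (M.H (tens (cls ξ) x)) = cr₂Proj F Ω Ω (F.map ξ (a x))

end Quadratic

end

end QuadraticClassification

namespace QuadraticClassification

noncomputable section

/-! ### Quadratic maps on sets of arrows -/

section Expansion

variable {C : Type u} [Category.{v} C] [HasFiniteCoproducts C] [HasZeroMorphisms C]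

attribute [local simp] coprod.inl_desc coprod.inr_desc coprod.inl_desc_assoc coprod.inr_desc_assoc

/-! A quadratic functor with `F(0) = 0` splits on a finite sum into the values on the single
summands and the second cross-effects of pairs of summands, and its second cross-effect is additive
in each argument. On sums of copies of `Ω` everything is therefore governed by `F(Ω)` and
`cr₂F(Ω,Ω)`.

From functors to modules: an element of `F(Ω)` is a Yoneda map `U → F`. On cross-effects it factors
through the bilinearisation, because `cr₂F` is already biadditive; this is `Ĥ`. The relation for
`∇ξ` says that `F(∇)` of the projection to the cross-effect measures the failure of additivity of `ξ
↦ F(ξ)x` (`IsPolynomial.isQuadraticMap`), and the relation for `Ĥ([ξ] ⊗ Pm)` is the case `∇ ≫ ξ` of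
the formula for the effect of an arrow between sums on cross-effects
(`IsPolynomial.cr₂Proj_map_coe`).

From modules to functors: the value at `X` should be the abelian group generated by symbols `(g, x)`
and `(f, g, m)`, with `f, g : Ω ⟶ X`, `x ∈ M_e`, `m ∈ M_ee`, subject to the relations that hold in
every quadratic functor. No quotient is formed; instead the homomorphisms out of this group are
axiomatised as `Evaluation`. If `X` is presented as a sum of `n` copies of `Ω`, the group can be
written down: it is `M_e^n × M_ee^(pairs)`, with a universal evaluation whose coordinates come from
the retractions of `X` to `Ω` and to `Ω + Ω`. The two compatibility relations between `P` and `Ĥ`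
are what makes these coordinates evaluations (`Evaluation.ofArrow`, `Evaluation.ofArrowSum`, with
`hopf_fold`).

Universality rests on one expansion: a quadratic map on arrows into a sum is the sum of its values
on single summands and of its deviations on pairs (`IsQuadraticMap.eq_sum`). Applied to an
evaluation, it expresses all values through those at the injections (`Evaluation.p_eq_sum`,
`Evaluation.q_eq_sum`), with coefficients that are the coordinates of the universal evaluation.
Functoriality is then formal, and the same expansion shows that the functor is quadratic.

If a quadratic `F` has the module `M`, evaluation in `F` gives a comparison from the functor of `M`
to `F`. It is onto by expanding the identity of `X`, and injective because the coordinates can be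
read off in `F`. This isomorphism gives faithfulness and fullness; essential surjectivity is
`functorOf_realizes`. -/

/-- The pairs of indices in increasing order. -/
abbrev Pairs (n : ℕ) : Type := {q : Fin n × Fin n // q.1 < q.2}

theorem sum_pairs {A : Type*} [AddCommMonoid A] {n : ℕ} (f : Fin n → Fin n → A) :
    ∑ q : Pairs n, f q.1.1 q.1.2 =
      ∑ k : Fin n, ∑ j ∈ Finset.univ.filter (· < k), f j k := by
  rw [← Finset.sum_subtype (Finset.univ.filter fun q : Fin n × Fin n => q.1 < q.2) (by simp)
    (fun q => f q.1 q.2), Finset.sum_filter, Fintype.sum_prod_type, Finset.sum_comm]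
  simp only [Finset.sum_filter]

/-- Trichotomy of the indices. Applied to a biadditive double sum, the diagonal will become the part
coming from `P`, and the two halves off the diagonal will be joined by `T`. -/
theorem sum_sum_eq_diag_add_pairs {A : Type*} [AddCommMonoid A] {n : ℕ} (f : Fin n → Fin n → A) :
    ∑ j, ∑ k, f j k = ∑ j, f j j + ∑ q : Pairs n, (f q.1.1 q.1.2 + f q.1.2 q.1.1) := by
  rw [Finset.sum_add_distrib, sum_pairs, sum_pairs fun j k => f k j]
  have h : ∀ j k : Fin n, f j k =
      (if j = k then f j k else 0) + ((if j < k then f j k else 0) + if k < j then f j k else 0) := by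
    intro j k
    rcases lt_trichotomy j k with h | h | h
    · simp [h, h.ne, h.not_gt]
    · simp [h]
    · simp [h, h.ne', h.not_gt]
  rw [Finset.sum_congr rfl fun j _ => Finset.sum_congr rfl fun k _ => h j k]
  simp only [Finset.sum_add_distrib, Finset.sum_ite_eq, Finset.mem_univ, if_true, Finset.sum_filter]
  rw [Finset.sum_comm (f := fun j k => if j < k then f j k else 0)]

/-- The additivity of `c` in its set argument reduces it to singletons; adjoining the elements one
by one then accumulates one deviation per pair. This is the combinatorial core of the expansion of a
quadratic map. -/
theorem eq_sum_add_sum_of_insert {A : Type*} [AddCommGroup A] {J : Type*} [LinearOrder J]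
    {u : Finset J → A} {c : Finset J → J → A} (hu₀ : u ∅ = 0)
    (hu : ∀ j S, j ∉ S → u (insert j S) = u S + u {j} + c S j) (hc₀ : ∀ j, c ∅ j = 0)
    (hc : ∀ k j S, k ∉ S → j ∉ insert k S → c (insert k S) j = c S j + c {k} j) (S : Finset J) :
    u S = ∑ i ∈ S, u {i} + ∑ k ∈ S, ∑ j ∈ S.filter (· < k), c {j} k := by
  have hc' : ∀ j S, j ∉ S → c S j = ∑ k ∈ S, c {k} j := by
    intro j S
    induction S using Finset.induction_on with
    | empty => intro; rw [hc₀, Finset.sum_empty]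
    | insert k S hk ih =>
      intro hj
      rw [hc k j S hk hj, ih fun h => hj (Finset.mem_insert_of_mem h), Finset.sum_insert hk,
        add_comm]
  -- Since the element adjoined is the maximum, its deviations against `S` are exactly the terms
  -- with second index `j`, and no earlier term changes. This puts each pair in increasing order.
  induction S using Finset.induction_on_max with
  | empty => simp [hu₀]
  | insert j S hS ih =>
    have hj : j ∉ S := fun h => lt_irrefl _ (hS j h)
    have e₁ : (insert j S).filter (· < j) = S := by
      ext i
      simp only [Finset.mem_filter, Finset.mem_insert]
      constructor
      · rintro ⟨rfl | h, h'⟩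
        · exact absurd h' (lt_irrefl _)
        · exact h
      · exact fun h => ⟨Or.inr h, hS i h⟩
    have e₂ : ∀ k ∈ S, (insert j S).filter (· < k) = S.filter (· < k) := by
      intro k hk
      ext i
      simp only [Finset.mem_filter, Finset.mem_insert]
      constructor
      · rintro ⟨rfl | h, h'⟩
        · exact absurd (hS k hk) h'.not_gt
        · exact ⟨h, h'⟩
      · exact fun h => ⟨Or.inr h.1, h.2⟩
    rw [hu j S hj, Finset.sum_insert hj, Finset.sum_insert hj, e₁,
      Finset.sum_congr rfl fun k hk => congrArg (fun s => ∑ j ∈ s, c {j} k) (e₂ k hk), ih,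
      hc' j S hj]
    abel

/-- A map `p` on arrows `W ⟶ X` which is quadratic with respect to the folding map, where `κ` is
its deviation. -/
structure IsQuadraticMap {W X : C} {A : Type*} [AddCommGroup A] (p : (W ⟶ X) → A)
    (κ : (W ⟶ X ⨿ X) → A) : Prop where
  map_fold : ∀ ξ, p (ξ ≫ fold X) = p (ξ ≫ rho₁ X X) + p (ξ ≫ rho₂ X X) + κ ξ
  dev_add : ∀ ξ : W ⟶ (X ⨿ X) ⨿ X, κ (ξ ≫ coprod.map (fold X) (𝟙 X)) =
    κ (ξ ≫ coprod.map (rho₁ X X) (𝟙 X)) + κ (ξ ≫ coprod.map (rho₂ X X) (𝟙 X))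

namespace IsQuadraticMap

variable {W X : C} {A : Type*} [AddCommGroup A] {p : (W ⟶ X) → A} {κ : (W ⟶ X ⨿ X) → A}

theorem dev_zero (h : IsQuadraticMap p κ) : κ 0 = 0 := by
  simpa using h.dev_add 0

theorem map_zero (h : IsQuadraticMap p κ) : p 0 = 0 := by
  simpa [h.dev_zero] using h.map_fold 0

end IsQuadraticMap

variable {n : ℕ} (M : Fin n → C)

/-- The endomorphism of a sum which is the identity on the summands in `S`, and zero on the
others. -/
def restrictTo (S : Finset (Fin n)) : ∐ M ⟶ ∐ M :=
  Sigma.desc fun i => if i ∈ S then Sigma.ι M i else 0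

/-- The map which sends the summands in `S` to the first copy of the sum, those in `T` to the
second one. -/
def separate (S T : Finset (Fin n)) : ∐ M ⟶ (∐ M) ⨿ (∐ M) :=
  Sigma.desc fun i => if i ∈ S then Sigma.ι M i ≫ coprod.inl else
    if i ∈ T then Sigma.ι M i ≫ coprod.inr else 0

/-- The analogue of `separate` for three sets of summands. -/
def separate₃ (S S' T : Finset (Fin n)) : ∐ M ⟶ ((∐ M) ⨿ (∐ M)) ⨿ (∐ M) :=
  Sigma.desc fun i => if i ∈ S then Sigma.ι M i ≫ coprod.inl ≫ coprod.inl else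
    if i ∈ S' then Sigma.ι M i ≫ coprod.inr ≫ coprod.inl else
    if i ∈ T then Sigma.ι M i ≫ coprod.inr else 0

theorem restrictTo_empty : restrictTo M ∅ = 0 := by
  refine Sigma.hom_ext _ _ fun i => ?_
  simp [restrictTo]

theorem restrictTo_univ : restrictTo M Finset.univ = 𝟙 _ := by
  refine Sigma.hom_ext _ _ fun i => ?_
  simp [restrictTo]

theorem separate_fold (S T : Finset (Fin n)) :
    separate M S T ≫ fold _ = restrictTo M (S ∪ T) := by
  refine Sigma.hom_ext _ _ fun i => ?_
  by_cases h₁ : i ∈ S <;> by_cases h₂ : i ∈ T <;>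
    simp [separate, restrictTo, h₁, h₂, inl_fold, inr_fold]

theorem separate_rho₁ (S T : Finset (Fin n)) :
    separate M S T ≫ rho₁ _ _ = restrictTo M S := by
  refine Sigma.hom_ext _ _ fun i => ?_
  by_cases h₁ : i ∈ S <;> by_cases h₂ : i ∈ T <;>
    simp [separate, restrictTo, h₁, h₂, inl_rho₁, inr_rho₁]

/-- Disjointness matters here only: in `separate` the first set takes precedence, so a summand in
both sets would be missing from the second copy. -/
theorem separate_rho₂ {S T : Finset (Fin n)} (h : Disjoint S T) :
    separate M S T ≫ rho₂ _ _ = restrictTo M T := by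
  refine Sigma.hom_ext _ _ fun i => ?_
  by_cases h₁ : i ∈ S <;> by_cases h₂ : i ∈ T
  · exact absurd h₂ (Finset.disjoint_left.1 h h₁)
  all_goals simp [separate, restrictTo, h₁, h₂, inl_rho₂, inr_rho₂]

theorem separate₃_fold (S S' T : Finset (Fin n)) :
    separate₃ M S S' T ≫ coprod.map (fold _) (𝟙 _) = separate M (S ∪ S') T := by
  refine Sigma.hom_ext _ _ fun i => ?_
  by_cases h₁ : i ∈ S <;> by_cases h₂ : i ∈ S' <;> by_cases h₃ : i ∈ T <;>
    simp [separate, separate₃, h₁, h₂, h₃, fold]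

theorem separate₃_rho₁ {S S' T : Finset (Fin n)} (h : Disjoint S' T) :
    separate₃ M S S' T ≫ coprod.map (rho₁ _ _) (𝟙 _) = separate M S T := by
  refine Sigma.hom_ext _ _ fun i => ?_
  by_cases h₁ : i ∈ S <;> by_cases h₂ : i ∈ S' <;> by_cases h₃ : i ∈ T
  any_goals first
    | exact absurd h₃ (Finset.disjoint_left.1 h h₂)
    | simp [separate, separate₃, h₁, h₂, h₃, rho₁]

theorem separate₃_rho₂ {S S' T : Finset (Fin n)} (h : Disjoint S S') (h' : Disjoint S T) :
    separate₃ M S S' T ≫ coprod.map (rho₂ _ _) (𝟙 _) = separate M S' T := by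
  refine Sigma.hom_ext _ _ fun i => ?_
  by_cases h₁ : i ∈ S <;> by_cases h₂ : i ∈ S' <;> by_cases h₃ : i ∈ T
  any_goals first
    | exact absurd h₃ (Finset.disjoint_left.1 h' h₁)
    | exact absurd h₂ (Finset.disjoint_left.1 h h₁)
    | simp [separate, separate₃, h₁, h₂, h₃, rho₂]

/-- The value of a quadratic map on an arrow into a sum. -/
theorem IsQuadraticMap.eq_sum {W : C} {A : Type*} [AddCommGroup A] {p : (W ⟶ ∐ M) → A}
    {κ : (W ⟶ (∐ M) ⨿ (∐ M)) → A} (h : IsQuadraticMap p κ) (g : W ⟶ ∐ M) :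
    p g = ∑ i, p (g ≫ restrictTo M {i}) +
      ∑ q : Pairs n, κ (g ≫ separate M {q.1.1} {q.1.2}) := by
  rw [sum_pairs fun j k => κ (g ≫ separate M {j} {k})]
  -- The set function is the value at `g` cut down to the summands in `S`, and `c S j` is the
  -- deviation between the part in `S` and the summand `j`. The hypotheses on `u` come from
  -- `map_fold` at `separate`, those on `c` from `map_fold` and from `dev_add` at `separate₃`.
  have key := eq_sum_add_sum_of_insert (u := fun S => p (g ≫ restrictTo M S))
    (c := fun S j => κ (g ≫ separate M S {j})) ?_ ?_ ?_ ?_ Finset.univ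
  · simpa only [restrictTo_univ, Category.comp_id] using key
  · simp only [restrictTo_empty, comp_zero, h.map_zero]
  · intro j S hj
    have := h.map_fold (g ≫ separate M S {j})
    rwa [Category.assoc, Category.assoc, Category.assoc, separate_fold, separate_rho₁,
      separate_rho₂ M (Finset.disjoint_singleton_right.2 hj), Finset.union_comm,
      ← Finset.insert_eq] at this
  · intro j
    have := h.map_fold (g ≫ separate M ∅ {j})
    rw [Category.assoc, Category.assoc, Category.assoc, separate_fold, separate_rho₁,
      separate_rho₂ M (Finset.disjoint_empty_left _), Finset.empty_union, restrictTo_empty,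
      comp_zero, h.map_zero, zero_add] at this
    simpa using this
  · intro k j S hk hj
    have hj' : j ∉ S := fun h => hj (Finset.mem_insert_of_mem h)
    have hjk : k ≠ j := by rintro rfl; exact hj (Finset.mem_insert_self _ _)
    have := h.dev_add (g ≫ separate₃ M S {k} {j})
    rwa [Category.assoc, Category.assoc, Category.assoc, separate₃_fold,
      separate₃_rho₁ M (by simpa using hjk),
      separate₃_rho₂ M (by simpa using hk) (by simpa using hj'),
      Finset.union_comm, ← Finset.insert_eq] at this

end Expansion

end

end QuadraticClassification

namespace QuadraticClassification

noncomputable section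

/-! ### Second cross-effects of quadratic functors -/

section MapApply

variable {C : Type u} [Category.{v} C]

theorem map_map_apply (F : C ⥤ AddCommGrpCat.{w}) {X Y Z : C} (f : X ⟶ Y) (g : Y ⟶ Z)
    (x : F.obj X) : F.map g (F.map f x) = F.map (f ≫ g) x := by
  rw [F.map_comp, ConcreteCategory.comp_apply]

theorem map_id_apply (F : C ⥤ AddCommGrpCat.{w}) {X : C} (x : F.obj X) : F.map (𝟙 X) x = x := by
  rw [F.map_id, ConcreteCategory.id_apply]

theorem map_eq_zero_of_fac {F : C ⥤ AddCommGrpCat.{w}} {X Y Z : C} {f : X ⟶ Y} {g : Y ⟶ Z}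
    {h : X ⟶ Z} {x : F.obj X} (hx : F.map f x = 0) (hfg : h = f ≫ g) : F.map h x = 0 := by
  rw [hfg, ← map_map_apply, hx, map_zero]

end MapApply

section SecondCrossEffect

variable {C : Type u} [Category.{v} C] [HasFiniteCoproducts C] [HasZeroMorphisms C]

attribute [local simp] coprod.inl_desc coprod.inr_desc coprod.inl_desc_assoc coprod.inr_desc_assoc

variable (F : C ⥤ AddCommGrpCat.{w})

theorem coe_cr₂Map {X Y X' Y' : C} (f : X ⟶ X') (g : Y ⟶ Y') (z : cr₂ F X Y) :
    (cr₂Map F f g z).1 = F.map (coprod.map f g) z.1 := rfl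

theorem coe_cr₂Swap {X Y : C} (z : cr₂ F X Y) : (cr₂Swap F X Y z).1 = F.map (swap X Y) z.1 := rfl

theorem coe_cr₂Proj {X Y : C} (z : F.obj (X ⨿ Y)) : (cr₂Proj F X Y z).1 =
    z - F.map (rho₁ X Y ≫ coprod.inl) z - F.map (rho₂ X Y ≫ coprod.inr) z +
      F.map (0 : X ⨿ Y ⟶ X ⨿ Y) z := rfl

theorem map_zero_of_mem_cr₂ {X Y Z : C} (z : cr₂ F X Y) : F.map (0 : X ⨿ Y ⟶ Z) z.1 = 0 :=
  map_eq_zero_of_fac (mem_cr₂.1 z.2).1 comp_zero.symm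

/-- All three correction terms of the projection factor through one of the retractions, which kill
the cross-effect. -/
theorem cr₂Proj_coe {X Y : C} (z : cr₂ F X Y) : cr₂Proj F X Y z.1 = z := by
  apply Subtype.ext
  rw [coe_cr₂Proj, map_zero_of_mem_cr₂, map_eq_zero_of_fac (mem_cr₂.1 z.2).1 rfl,
    map_eq_zero_of_fac (mem_cr₂.1 z.2).2 rfl]
  abel

theorem cr₂Proj_map {X Y X' Y' : C} (f : X ⟶ X') (g : Y ⟶ Y') (z : F.obj (X ⨿ Y)) :
    cr₂Proj F X' Y' (F.map (coprod.map f g) z) = cr₂Map F f g (cr₂Proj F X Y z) := by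
  apply Subtype.ext
  simp only [coe_cr₂Proj, coe_cr₂Map, map_add, map_sub, map_map_apply]
  have h₁ : coprod.map f g ≫ rho₁ X' Y' ≫ coprod.inl =
      (rho₁ X Y ≫ coprod.inl) ≫ coprod.map f g := by ext <;> simp [rho₁]
  have h₂ : coprod.map f g ≫ rho₂ X' Y' ≫ coprod.inr =
      (rho₂ X Y ≫ coprod.inr) ≫ coprod.map f g := by ext <;> simp [rho₂]
  rw [h₁, h₂, comp_zero, zero_comp]

theorem cr₂Proj_swap {X Y : C} (z : F.obj (X ⨿ Y)) :
    cr₂Proj F Y X (F.map (swap X Y) z) = cr₂Swap F X Y (cr₂Proj F X Y z) := by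
  apply Subtype.ext
  simp only [coe_cr₂Proj, coe_cr₂Swap, map_add, map_sub, map_map_apply]
  have h₁ : swap X Y ≫ rho₁ Y X ≫ coprod.inl = (rho₂ X Y ≫ coprod.inr) ≫ swap X Y := by
    ext <;> simp [rho₁, rho₂, swap]
  have h₂ : swap X Y ≫ rho₂ Y X ≫ coprod.inr = (rho₁ X Y ≫ coprod.inl) ≫ swap X Y := by
    ext <;> simp [rho₁, rho₂, swap]
  rw [h₁, h₂, comp_zero, zero_comp]
  abel

theorem cr₂Proj_map_inl {X Y : C} (x : F.obj X) :
    cr₂Proj F X Y (F.map coprod.inl x) = 0 := by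
  apply Subtype.ext
  simp only [coe_cr₂Proj, map_map_apply, comp_zero]
  rw [← Category.assoc, inl_rho₁, Category.id_comp, ← Category.assoc, inl_rho₂, zero_comp]
  simp

theorem cr₂Proj_map_inr {X Y : C} (x : F.obj Y) :
    cr₂Proj F X Y (F.map coprod.inr x) = 0 := by
  apply Subtype.ext
  simp only [coe_cr₂Proj, map_map_apply, comp_zero]
  rw [← Category.assoc, inr_rho₁, ← Category.assoc coprod.inr (rho₂ X Y), inr_rho₂,
    Category.id_comp, zero_comp]
  simp

theorem cr₂Nat_cr₂Proj {F G : C ⥤ AddCommGrpCat.{w}} (η : F ⟶ G) {X Y : C} (z : F.obj (X ⨿ Y)) :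
    cr₂Nat η X Y (cr₂Proj F X Y z) = cr₂Proj G X Y (η.app _ z) := by
  apply Subtype.ext
  change η.app _ (cr₂Proj F X Y z).1 = _
  have h : ∀ f : X ⨿ Y ⟶ X ⨿ Y, η.app _ (F.map f z) = G.map f (η.app _ z) := fun f => by
    rw [← ConcreteCategory.comp_apply, η.naturality, ConcreteCategory.comp_apply]
  simp only [coe_cr₂Proj, map_add, map_sub, h]

variable {F}

/-- Under the identification of the iterated binary sum with the ternary one, the two hypotheses and
the vanishing of `z` under `rho₁` say that `z` lies in the third cross-effect. Only the one-sided
inverse `θ'` of `θ` is needed to return. -/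
theorem IsPolynomial.eq_zero_of_left_fin (hF : IsPolynomial 2 F) (M : Fin 3 → C)
    (z : cr₂ F (M 0 ⨿ M 1) (M 2)) (h₁ : cr₂Map F (rho₁ (M 0) (M 1)) (𝟙 (M 2)) z = 0)
    (h₂ : cr₂Map F (rho₂ (M 0) (M 1)) (𝟙 (M 2)) z = 0) : z = 0 := by
  replace h₁ : F.map (coprod.map (rho₁ (M 0) (M 1)) (𝟙 (M 2))) z.1 = 0 := congrArg Subtype.val h₁
  replace h₂ : F.map (coprod.map (rho₂ (M 0) (M 1)) (𝟙 (M 2))) z.1 = 0 := congrArg Subtype.val h₂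
  have h₃ := (mem_cr₂.1 z.2).2
  let θ : (M 0 ⨿ M 1) ⨿ M 2 ⟶ ∐ M :=
    coprod.desc (coprod.desc (Sigma.ι M 0) (Sigma.ι M 1)) (Sigma.ι M 2)
  let θ' : ∐ M ⟶ (M 0 ⨿ M 1) ⨿ M 2 := Sigma.desc fun i => match i with
    | 0 => coprod.inl ≫ coprod.inl
    | 1 => coprod.inr ≫ coprod.inl
    | 2 => coprod.inr
  have e₀ : Sigma.ι M 0 ≫ θ' = coprod.inl ≫ coprod.inl := Sigma.ι_desc _ _
  have e₁ : Sigma.ι M 1 ≫ θ' = coprod.inr ≫ coprod.inl := Sigma.ι_desc _ _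
  have e₂ : Sigma.ι M 2 ≫ θ' = coprod.inr := Sigma.ι_desc _ _
  have hθ : θ ≫ θ' = 𝟙 _ := by
    refine coprod.hom_ext (coprod.hom_ext ?_ ?_) ?_
    · simpa [θ] using e₀
    · simpa [θ] using e₁
    · simpa [θ] using e₂
  have r' : ∀ j : Fin 3, Sigma.ι M j ≫ retraction M j = 0 := fun j => by
    rw [retraction, Sigma.ι_desc, dif_pos rfl]
  have hz : F.map θ z.1 ∈ crossEffect F M := by
    rw [crossEffect, AddSubgroup.mem_iInf]
    intro j
    change F.map (retraction M j) (F.map θ z.1) = 0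
    rw [map_map_apply]
    fin_cases j
    · refine map_eq_zero_of_fac h₂ (g := coprod.desc (Sigma.ι M 1 ≫ retraction M 0)
        (Sigma.ι M 2 ≫ retraction M 0)) ?_
      refine coprod.hom_ext (coprod.hom_ext ?_ ?_) ?_
      · simpa [θ, rho₂] using r' 0
      · simp [θ, rho₂]
      · simp [θ]
    · refine map_eq_zero_of_fac h₁ (g := coprod.desc (Sigma.ι M 0 ≫ retraction M 1)
        (Sigma.ι M 2 ≫ retraction M 1)) ?_
      refine coprod.hom_ext (coprod.hom_ext ?_ ?_) ?_
      · simp [θ, rho₁]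
      · simpa [θ, rho₁] using r' 1
      · simp [θ]
    · refine map_eq_zero_of_fac h₃ (g := coprod.inl ≫ θ ≫ retraction M 2) ?_
      refine coprod.hom_ext (coprod.hom_ext ?_ ?_) ?_
      · simp [θ, rho₁]
      · simp [θ, rho₁]
      · simpa [θ, rho₁] using r' 2
  rw [hF M, AddSubgroup.mem_bot] at hz
  apply Subtype.ext
  rw [← map_id_apply F z.1, ← hθ, ← map_map_apply, hz, map_zero]
  rfl

/-- The second cross-effect of a quadratic functor is additive in the first argument. -/
theorem IsPolynomial.eq_zero_of_left (hF : IsPolynomial 2 F) {X X' Y : C} (z : cr₂ F (X ⨿ X') Y)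
    (h₁ : cr₂Map F (rho₁ X X') (𝟙 Y) z = 0) (h₂ : cr₂Map F (rho₂ X X') (𝟙 Y) z = 0) : z = 0 :=
  hF.eq_zero_of_left_fin ![X, X', Y] z h₁ h₂

/-- The difference of the two sides is killed by both retractions of the first argument, so the
vanishing criterion applies. -/
theorem IsPolynomial.eq_add_left (hF : IsPolynomial 2 F) {X X' Y : C} (z : cr₂ F (X ⨿ X') Y) :
    z = cr₂Map F (rho₁ X X' ≫ coprod.inl) (𝟙 Y) z + cr₂Map F (rho₂ X X' ≫ coprod.inr) (𝟙 Y) z := by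
  rw [← sub_eq_zero, ← sub_sub]
  refine hF.eq_zero_of_left _ ?_ ?_
  · simp only [map_sub, cr₂Map_comp, Category.comp_id, Category.assoc, inl_rho₁, inr_rho₁,
      comp_zero, cr₂Map_zero_left, sub_self]
  · simp only [map_sub, cr₂Map_comp, Category.comp_id, Category.assoc, inl_rho₂, inr_rho₂,
      comp_zero, cr₂Map_zero_left, sub_zero, sub_self]

theorem cr₂Swap_cr₂Swap {X Y : C} (z : cr₂ F X Y) : cr₂Swap F Y X (cr₂Swap F X Y z) = z := by
  apply Subtype.ext
  rw [coe_cr₂Swap, coe_cr₂Swap, map_map_apply,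
    show swap X Y ≫ swap Y X = 𝟙 _ by ext <;> simp [swap], map_id_apply]

theorem IsPolynomial.eq_add_right (hF : IsPolynomial 2 F) {X Y Y' : C} (z : cr₂ F X (Y ⨿ Y')) :
    z = cr₂Map F (𝟙 X) (rho₁ Y Y' ≫ coprod.inl) z + cr₂Map F (𝟙 X) (rho₂ Y Y' ≫ coprod.inr) z := by
  have h := congrArg (cr₂Swap F _ _) (hF.eq_add_left (cr₂Swap F _ _ z))
  rwa [map_add, cr₂Swap_cr₂Map, cr₂Swap_cr₂Map, cr₂Swap_cr₂Swap] at h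

/-- Fold the decomposition of `eq_add_left` for the image of `z` under `ξ`. This is the bilinearity
required of `M_ee`. -/
theorem IsPolynomial.cr₂Map_comp_fold (hF : IsPolynomial 2 F) {W X Y Y' : C} (ξ : W ⟶ X ⨿ X)
    (g : Y ⟶ Y') (z : cr₂ F W Y) : cr₂Map F (ξ ≫ fold X) g z =
      cr₂Map F (ξ ≫ rho₁ X X) g z + cr₂Map F (ξ ≫ rho₂ X X) g z := by
  have h := congrArg (cr₂Map F (fold X) (𝟙 Y')) (hF.eq_add_left (cr₂Map F ξ g z))
  simpa only [map_add, cr₂Map_comp, Category.comp_id, Category.assoc, inl_fold, inr_fold] using h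

/-- The map which a quadratic functor induces between cross-effects by an arbitrary arrow
between sums. -/
theorem IsPolynomial.cr₂Proj_map_coe (hF : IsPolynomial 2 F) {X X' Y Y' : C}
    (f : X ⨿ X' ⟶ Y ⨿ Y') (z : cr₂ F X X') : cr₂Proj F Y Y' (F.map f z.1) =
      cr₂Map F (coprod.inl ≫ f ≫ rho₁ Y Y') (coprod.inr ≫ f ≫ rho₂ Y Y') z +
        cr₂Swap F Y' Y
          (cr₂Map F (coprod.inl ≫ f ≫ rho₂ Y Y') (coprod.inr ≫ f ≫ rho₁ Y Y') z) := by
  -- Any arrow out of `X ⨿ X'` is a folding after a map of summands, so `F(f)z` is the folding of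
  -- `y`. Decomposing `y` in both arguments gives four pieces. The two unmixed ones come from `F(Y)`
  -- and `F(Y')` and vanish in the cross-effect; the mixed ones are the two terms claimed.
  let y := cr₂Map F (coprod.inl ≫ f) (coprod.inr ≫ f) z
  have hy : F.map f z.1 = F.map (fold _) y.1 := by
    rw [coe_cr₂Map, map_map_apply, show coprod.map (coprod.inl ≫ f) (coprod.inr ≫ f) ≫ fold _ = f by
      ext <;> simp [fold]]
  have hL := hF.eq_add_left y
  rw [hF.eq_add_right (cr₂Map F (rho₁ Y Y' ≫ coprod.inl) _ y),
    hF.eq_add_right (cr₂Map F (rho₂ Y Y' ≫ coprod.inr) _ y)] at hL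
  simp only [cr₂Map_comp, Category.comp_id, Category.id_comp] at hL
  rw [hy, hL]
  simp only [AddSubgroup.coe_add, map_add]
  have e₁ : cr₂Proj F Y Y' (F.map (fold _) (cr₂Map F (rho₁ Y Y' ≫ coprod.inl)
      (rho₁ Y Y' ≫ coprod.inl) y).1) = 0 := by
    rw [coe_cr₂Map, map_map_apply, ← map_fold, ← Category.assoc, ← map_map_apply F _ coprod.inl,
      cr₂Proj_map_inl]
  have e₂ : cr₂Proj F Y Y' (F.map (fold _) (cr₂Map F (rho₂ Y Y' ≫ coprod.inr)
      (rho₂ Y Y' ≫ coprod.inr) y).1) = 0 := by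
    rw [coe_cr₂Map, map_map_apply, ← map_fold, ← Category.assoc, ← map_map_apply F _ coprod.inr,
      cr₂Proj_map_inr]
  have e₃ : cr₂Proj F Y Y' (F.map (fold _) (cr₂Map F (rho₁ Y Y' ≫ coprod.inl)
      (rho₂ Y Y' ≫ coprod.inr) y).1) = cr₂Map F (rho₁ Y Y') (rho₂ Y Y') y := by
    rw [coe_cr₂Map, map_map_apply, show coprod.map (rho₁ Y Y' ≫ coprod.inl)
      (rho₂ Y Y' ≫ coprod.inr) ≫ fold _ = coprod.map (rho₁ Y Y') (rho₂ Y Y') by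
        ext <;> simp [fold], ← coe_cr₂Map, cr₂Proj_coe]
  have e₄ : cr₂Proj F Y Y' (F.map (fold _) (cr₂Map F (rho₂ Y Y' ≫ coprod.inr)
      (rho₁ Y Y' ≫ coprod.inl) y).1) =
        cr₂Swap F Y' Y (cr₂Map F (rho₂ Y Y') (rho₁ Y Y') y) := by
    rw [coe_cr₂Map, map_map_apply, show coprod.map (rho₂ Y Y' ≫ coprod.inr)
      (rho₁ Y Y' ≫ coprod.inl) ≫ fold _ = coprod.map (rho₂ Y Y') (rho₁ Y Y') ≫ swap _ _ by
        ext <;> simp [fold, swap], ← map_map_apply, ← coe_cr₂Map, ← coe_cr₂Swap, cr₂Proj_coe]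
  rw [e₁, e₂, e₃, e₄, zero_add, add_zero, cr₂Map_comp, cr₂Map_comp, Category.assoc,
    Category.assoc, Category.assoc, Category.assoc]

open scoped ZeroObject in
omit [HasFiniteCoproducts C] in
theorem map_eq_zero_of_isZero [HasZeroObject C] (hF : IsZero (F.obj (0 : C))) {X Y : C}
    (x : F.obj X) : F.map (0 : X ⟶ Y) x = 0 := by
  refine map_eq_zero_of_fac (f := (0 : X ⟶ 0)) (g := 0) ?_ comp_zero.symm
  have := AddCommGrpCat.subsingleton_of_isZero hF
  exact Subsingleton.elim _ _

/-- The value of a quadratic functor on the arrows into a fixed object is quadratic. -/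
theorem IsPolynomial.isQuadraticMap (hF : IsPolynomial 2 F)
    (hF₀ : ∀ {X Y : C} (x : F.obj X), F.map (0 : X ⟶ Y) x = 0) {W X : C} (y : F.obj W) :
    IsQuadraticMap (fun f : W ⟶ X => F.map f y)
      (fun ξ => F.map (fold X) (cr₂Proj F X X (F.map ξ y)).1) where
  map_fold ξ := by
    simp only [coe_cr₂Proj, map_add, map_sub, map_map_apply, Category.assoc, inl_fold, inr_fold,
      Category.comp_id, hF₀, map_zero]
    abel
  dev_add ξ := by
    simp only [← map_map_apply F ξ, cr₂Proj_map]
    rw [← AddMonoidHom.map_add, ← AddSubgroup.coe_add]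
    congr 2
    have := hF.cr₂Map_comp_fold (𝟙 _) (𝟙 X) (cr₂Proj F (X ⨿ X) X (F.map ξ y))
    simpa only [Category.id_comp] using this

end SecondCrossEffect

end

end QuadraticClassification

namespace QuadraticClassification

noncomputable section

/-! ### Generators of `T₁₁ cr₂ U (Ω, Ω)` and of `Λ ⊗ Λ`, and the tensor product over `Λ` -/

section Generators

variable {C : Type u} [Category.{v} C] [HasZeroMorphisms C] [HasFiniteCoproducts C] {Ω : C}

attribute [local simp] coprod.inl_desc coprod.inr_desc coprod.inl_desc_assoc coprod.inr_desc_assoc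

/-- The projection of `cr₂ U (Ω, Ω)` to `T₁₁ cr₂ U (Ω, Ω)`. -/
def TU.mk (Ω : C) : cr₂ (standardProjective Ω) Ω Ω →+ TU Ω :=
  QuotientAddGroup.mk' (bilinKer (standardProjective Ω) Ω Ω)

/-- The projection of `U (Ω + Ω)` to `T₁₁ cr₂ U (Ω, Ω)`. -/
def clsHom (Ω : C) : (standardProjective Ω).obj (Ω ⨿ Ω) →+ TU Ω :=
  (TU.mk Ω).comp (cr₂Proj (standardProjective Ω) Ω Ω)

/-- `T₁₁ cr₂ U (Ω, Ω)` is a quotient of `cr₂ U (Ω, Ω)`, which is a retract of the free abelian group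
`U(Ω + Ω)` on the arrows `ξ`. Hence the classes of arrows generate it. -/
theorem TU.induction {p : TU Ω → Prop} (h : ∀ ξ, p (cls ξ)) (h0 : p 0)
    (hadd : ∀ x y, p x → p y → p (x + y)) (hneg : ∀ x, p x → p (-x)) (t : TU Ω) : p t := by
  obtain ⟨z, rfl⟩ := QuotientAddGroup.mk_surjective t
  have e : clsHom Ω z.1 = QuotientAddGroup.mk z :=
    congrArg QuotientAddGroup.mk (cr₂Proj_coe _ z)
  refine e ▸ ?_
  generalize z.1 = y
  clear e z
  change FreeAbelianGroup (Ω ⟶ Ω ⨿ Ω) at y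
  induction y using FreeAbelianGroup.induction_on with
  | zero => exact (map_zero (clsHom Ω)).symm ▸ h0
  | of ξ => exact h ξ
  | neg ξ ih => exact (map_neg (clsHom Ω) (FreeAbelianGroup.of ξ)).symm ▸ hneg _ ih
  | add x y hx hy => exact (map_add (clsHom Ω) x y).symm ▸ hadd _ _ hx hy

theorem TUMap_cls (α β : Ω ⟶ Ω) (ξ : Ω ⟶ Ω ⨿ Ω) :
    TUMap α β (cls ξ) = cls (ξ ≫ coprod.map α β) :=
  congrArg QuotientAddGroup.mk (cr₂Proj_map (standardProjective Ω) α β (FreeAbelianGroup.of ξ)).symm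

theorem TUPre_cls (γ : Ω ⟶ Ω) (ξ : Ω ⟶ Ω ⨿ Ω) : TUPre γ (cls ξ) = cls (γ ≫ ξ) :=
  congrArg QuotientAddGroup.mk (cr₂Nat_cr₂Proj (precomp γ) (FreeAbelianGroup.of ξ))

theorem TUSwap_cls (ξ : Ω ⟶ Ω ⨿ Ω) : TUSwap Ω (cls ξ) = cls (ξ ≫ swap Ω Ω) :=
  congrArg QuotientAddGroup.mk (cr₂Proj_swap (standardProjective Ω) (FreeAbelianGroup.of ξ)).symm

theorem smul_cls (α β : Ω ⟶ Ω) (ξ : Ω ⟶ Ω ⨿ Ω) :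
    (arrow α ⊗ₜ[ℤ] arrow β : ReducedRing Ω ⊗[ℤ] ReducedRing Ω) • cls ξ =
      cls (ξ ≫ coprod.map α β) := by
  change actLeft Ω (arrow α ⊗ₜ[ℤ] arrow β) (cls ξ) = _
  rw [actLeft_tmul, actFst_arrow, actSnd_arrow, Module.End.mul_apply, TUMap_comp, TUMap_cls,
    Category.id_comp, Category.comp_id]

theorem op_smul_cls (γ : Ω ⟶ Ω) (ξ : Ω ⟶ Ω ⨿ Ω) :
    MulOpposite.op (arrow γ : ReducedRing Ω) • cls ξ = cls (γ ≫ ξ) := by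
  change (actRight Ω (arrow γ)).unop (cls ξ) = _
  rw [actRight_arrow, MulOpposite.unop_op, TUPre_cls]

/-- The class of an arrow is additive in the first argument. -/
theorem cls_map_fold (ξ : Ω ⟶ (Ω ⨿ Ω) ⨿ Ω) : cls (ξ ≫ coprod.map (fold Ω) (𝟙 Ω)) =
    cls (ξ ≫ coprod.map (rho₁ Ω Ω) (𝟙 Ω)) + cls (ξ ≫ coprod.map (rho₂ Ω Ω) (𝟙 Ω)) := by
  let U := standardProjective Ω
  let y := cr₂Proj U (Ω ⨿ Ω) Ω (FreeAbelianGroup.of ξ)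
  have e : ∀ f : Ω ⨿ Ω ⟶ Ω, cls (ξ ≫ coprod.map f (𝟙 Ω)) =
      TU.mk Ω (cr₂Map U f (𝟙 Ω) y) := fun f =>
    congrArg QuotientAddGroup.mk (cr₂Proj_map U f (𝟙 Ω) (FreeAbelianGroup.of ξ))
  -- The component of `y` in the cross-effect of `cr₂ U (-, Ω)`; its folding belongs to the subgroup
  -- that is divided out, and expands to the difference of the two sides.
  let z := y - cr₂Map U (rho₁ Ω Ω ≫ coprod.inl) (𝟙 Ω) y -
    cr₂Map U (rho₂ Ω Ω ≫ coprod.inr) (𝟙 Ω) y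
  have hz : cr₂Map U (fold Ω) (𝟙 Ω) z ∈ bilinKer U Ω Ω := by
    refine AddSubgroup.mem_sup_left ⟨z, ⟨?_, ?_⟩, rfl⟩
    · change cr₂Map U _ _ z = 0
      simp only [z, map_sub, cr₂Map_comp, Category.comp_id, Category.assoc, inl_rho₁, inr_rho₁,
        comp_zero, cr₂Map_zero_left, sub_self]
    · change cr₂Map U _ _ z = 0
      simp only [z, map_sub, cr₂Map_comp, Category.comp_id, Category.assoc, inl_rho₂, inr_rho₂,
        comp_zero, cr₂Map_zero_left, sub_zero, sub_self]
  simp only [z, map_sub, cr₂Map_comp, Category.comp_id, Category.assoc, inl_fold, inr_fold] at hz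
  rw [e, e, e, ← sub_eq_zero, ← sub_sub, ← map_sub, ← map_sub]
  exact (QuotientAddGroup.eq_zero_iff _).2 hz

-- Pairs of arrows generate `Λ ⊗ Λ` additively. There is no separate case of zero, since the zero
-- arrow already represents it.
omit [HasFiniteCoproducts C] in
theorem tensor_induction {p : ReducedRing Ω ⊗[ℤ] ReducedRing Ω → Prop}
    (h : ∀ α β, p (arrow α ⊗ₜ[ℤ] arrow β))
    (hadd : ∀ x y, p x → p y → p (x + y)) (hneg : ∀ x, p x → p (-x)) (s) : p s := by
  have h0 : p 0 := by
    have := h (0 : Ω ⟶ Ω) (0 : Ω ⟶ Ω)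
    rwa [arrow_zero, TensorProduct.zero_tmul] at this
  induction s using TensorProduct.induction_on with
  | zero => exact h0
  | add x y hx hy => exact hadd _ _ hx hy
  | tmul x y =>
    induction x using ReducedRing.induction with
    | h0 => rw [TensorProduct.zero_tmul]; exact h0
    | hadd x x' hx hx' => rw [TensorProduct.add_tmul]; exact hadd _ _ hx hx'
    | hneg x hx => rw [TensorProduct.neg_tmul]; exact hneg _ hx
    | h α =>
      induction y using ReducedRing.induction with
      | h0 => rw [TensorProduct.tmul_zero]; exact h0
      | hadd x x' hx hx' => rw [TensorProduct.tmul_add]; exact hadd _ _ hx hx'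
      | hneg x hx => rw [TensorProduct.tmul_neg]; exact hneg _ hx
      | h β => exact h α β

omit [HasFiniteCoproducts C] in
theorem diagonal_arrow (α : Ω ⟶ Ω) : diagonal Ω (arrow α) = arrow α ⊗ₜ[ℤ] arrow α :=
  ReducedRing.lift_arrow _ _ _

omit [HasFiniteCoproducts C] in
/-- Additive maps out of a `Λ ⊗ Λ`-module are linear if they commute with pairs of arrows. -/
theorem map_smul_of_arrow {A B : Type*} [AddCommGroup A] [AddCommGroup B]
    [Module (ReducedRing Ω ⊗[ℤ] ReducedRing Ω) A] [Module (ReducedRing Ω ⊗[ℤ] ReducedRing Ω) B]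
    (f : A →+ B) (hf : ∀ (α β : Ω ⟶ Ω) (m : A),
      f ((arrow α ⊗ₜ[ℤ] arrow β : ReducedRing Ω ⊗[ℤ] ReducedRing Ω) • m) =
        (arrow α ⊗ₜ[ℤ] arrow β : ReducedRing Ω ⊗[ℤ] ReducedRing Ω) • f m)
    (s : ReducedRing Ω ⊗[ℤ] ReducedRing Ω) (m : A) : f (s • m) = s • f m := by
  induction s using tensor_induction with
  | h α β => exact hf α β m
  | hadd x y hx hy => rw [add_smul, add_smul, map_add, hx, hy]
  | hneg x hx => rw [neg_smul, neg_smul, map_neg, hx]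

omit [HasFiniteCoproducts C] in
theorem map_smul_of_arrow' {A B : Type*} [AddCommGroup A] [AddCommGroup B]
    [Module (ReducedRing Ω) A] [Module (ReducedRing Ω) B]
    (f : A →+ B) (hf : ∀ (α : Ω ⟶ Ω) (m : A),
      f ((arrow α : ReducedRing Ω) • m) = (arrow α : ReducedRing Ω) • f m)
    (s : ReducedRing Ω) (m : A) : f (s • m) = s • f m := by
  induction s using ReducedRing.induction with
  | h α => exact hf α m
  | h0 => rw [zero_smul, zero_smul, map_zero]
  | hadd x y hx hy => rw [add_smul, add_smul, map_add, hx, hy]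
  | hneg x hx => rw [neg_smul, neg_smul, map_neg, hx]

variable {M : Type w} [AddCommGroup M] [Module (ReducedRing Ω) M]

theorem tens_add_left (t t' : TU Ω) (x : M) : tens (t + t') x = tens t x + tens t' x := by
  unfold tens btmul
  rw [TensorProduct.add_tmul, Submodule.Quotient.mk_add]

theorem tens_zero_left (x : M) : tens (0 : TU Ω) x = 0 := by
  unfold tens btmul
  rw [TensorProduct.zero_tmul, Submodule.Quotient.mk_zero]

theorem tens_neg_left (t : TU Ω) (x : M) : tens (-t) x = -tens t x := by
  unfold tens btmul
  rw [TensorProduct.neg_tmul, Submodule.Quotient.mk_neg]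

theorem tens_add_right (t : TU Ω) (x x' : M) : tens t (x + x') = tens t x + tens t x' := by
  unfold tens btmul
  rw [TensorProduct.tmul_add, Submodule.Quotient.mk_add]

theorem smul_tens (s : ReducedRing Ω ⊗[ℤ] ReducedRing Ω) (t : TU Ω) (x : M) :
    s • tens t x = tens (s • t) x := rfl

theorem tens_smul (t : TU Ω) (r : ReducedRing Ω) (x : M) :
    tens t (r • x) = tens (MulOpposite.op r • t) x := by
  refine ((Submodule.Quotient.eq _).2 ?_).symm
  exact Submodule.subset_span ⟨t, r, x, rfl⟩

end Generators

/-! ### The quadratic module of a quadratic functor -/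

section QuadraticModuleOf

variable {C : Type u} [Category.{v} C] [HasZeroMorphisms C] [HasFiniteCoproducts C]
  (F : C ⥤ AddCommGrpCat.{w}) (Ω : C)

/-- The operation of `Λ` on `F (Ω)`. -/
def endAction (hF₀ : ∀ {X Y : C} (x : F.obj X), F.map (0 : X ⟶ Y) x = 0) :
    ReducedRing Ω →+* Module.End ℤ (F.obj Ω) :=
  ReducedRing.lift
    { toFun := fun α => (F.map α).hom.toIntLinearMap
      map_one' := LinearMap.ext fun x => map_id_apply F x
      map_mul' := fun α β => LinearMap.ext fun x => (map_map_apply F β α x).symm }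
    (LinearMap.ext fun x => hF₀ x)

omit [HasFiniteCoproducts C] in
theorem endAction_arrow (hF₀ : ∀ {X Y : C} (x : F.obj X), F.map (0 : X ⟶ Y) x = 0) (α : Ω ⟶ Ω)
    (x : F.obj Ω) : endAction F Ω hF₀ (arrow α) x = F.map α x :=
  LinearMap.congr_fun (ReducedRing.lift_arrow _ _ α) x

/-- The operation of `Λ` on the first argument of `cr₂ F (Ω, Ω)`. -/
def crossActionFst : ReducedRing Ω →+* Module.End ℤ (cr₂ F Ω Ω) :=
  ReducedRing.lift
    { toFun := fun α => (cr₂Map F α (𝟙 Ω)).toIntLinearMap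
      map_one' := LinearMap.ext fun x => cr₂Map_id F Ω Ω x
      map_mul' := fun α β => LinearMap.ext fun x => by
        change cr₂Map F (β ≫ α) (𝟙 Ω) x = cr₂Map F α (𝟙 Ω) (cr₂Map F β (𝟙 Ω) x)
        rw [cr₂Map_comp, Category.comp_id] }
    (LinearMap.ext fun x => cr₂Map_zero_left F _ x)

/-- The operation of `Λ` on the second argument of `cr₂ F (Ω, Ω)`. -/
def crossActionSnd : ReducedRing Ω →+* Module.End ℤ (cr₂ F Ω Ω) :=
  ReducedRing.lift
    { toFun := fun α => (cr₂Map F (𝟙 Ω) α).toIntLinearMap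
      map_one' := LinearMap.ext fun x => cr₂Map_id F Ω Ω x
      map_mul' := fun α β => LinearMap.ext fun x => by
        change cr₂Map F (𝟙 Ω) (β ≫ α) x = cr₂Map F (𝟙 Ω) α (cr₂Map F (𝟙 Ω) β x)
        rw [cr₂Map_comp, Category.comp_id] }
    (LinearMap.ext fun x => cr₂Map_zero_right F _ x)

theorem crossActionFst_arrow (α : Ω ⟶ Ω) :
    crossActionFst F Ω (arrow α) = (cr₂Map F α (𝟙 Ω)).toIntLinearMap :=
  ReducedRing.lift_arrow _ _ _

theorem crossActionSnd_arrow (α : Ω ⟶ Ω) :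
    crossActionSnd F Ω (arrow α) = (cr₂Map F (𝟙 Ω) α).toIntLinearMap :=
  ReducedRing.lift_arrow _ _ _

theorem crossAction_commute (x y : ReducedRing Ω) :
    Commute (crossActionFst F Ω x) (crossActionSnd F Ω y) := by
  induction x using ReducedRing.induction with
  | h0 => rw [map_zero]; exact Commute.zero_left _
  | hadd x x' hx hx' => rw [map_add]; exact hx.add_left hx'
  | hneg x hx => rw [map_neg]; exact hx.neg_left
  | h α =>
    induction y using ReducedRing.induction with
    | h0 => rw [map_zero]; exact Commute.zero_right _
    | hadd x x' hx hx' => rw [map_add]; exact hx.add_right hx'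
    | hneg x hx => rw [map_neg]; exact hx.neg_right
    | h β =>
      rw [crossActionFst_arrow, crossActionSnd_arrow]
      refine LinearMap.ext fun t => ?_
      change cr₂Map F α (𝟙 Ω) (cr₂Map F (𝟙 Ω) β t) = cr₂Map F (𝟙 Ω) β (cr₂Map F α (𝟙 Ω) t)
      rw [cr₂Map_comp, cr₂Map_comp, Category.comp_id, Category.id_comp, Category.comp_id,
        Category.id_comp]

/-- The operation of `Λ ⊗ Λ` on `cr₂ F (Ω, Ω)`. -/
def crossAction : ReducedRing Ω ⊗[ℤ] ReducedRing Ω →+* Module.End ℤ (cr₂ F Ω Ω) :=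
  (Algebra.TensorProduct.lift (crossActionFst F Ω).toIntAlgHom (crossActionSnd F Ω).toIntAlgHom
    (crossAction_commute F Ω)).toRingHom

theorem crossAction_arrow (α β : Ω ⟶ Ω) (m : cr₂ F Ω Ω) :
    crossAction F Ω (arrow α ⊗ₜ[ℤ] arrow β) m = cr₂Map F α β m := by
  have h : crossAction F Ω (arrow α ⊗ₜ[ℤ] arrow β) =
      crossActionFst F Ω (arrow α) * crossActionSnd F Ω (arrow β) :=
    Algebra.TensorProduct.lift_tmul _ _ _ _ _
  rw [h, crossActionFst_arrow, crossActionSnd_arrow]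
  change cr₂Map F α (𝟙 Ω) (cr₂Map F (𝟙 Ω) β m) = _
  rw [cr₂Map_comp, Category.id_comp, Category.comp_id]

/-- The Yoneda map `U (X) → F (X)` belonging to an element of `F (Ω)`. -/
def yonedaMap (x : F.obj Ω) (X : C) : (standardProjective Ω).obj X →+ F.obj X :=
  FreeAbelianGroup.lift fun ξ : Ω ⟶ X => F.map ξ x

omit [HasZeroMorphisms C] [HasFiniteCoproducts C] in
theorem yonedaMap_of (x : F.obj Ω) {X : C} (ξ : Ω ⟶ X) :
    yonedaMap F Ω x X (FreeAbelianGroup.of ξ) = F.map ξ x :=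
  FreeAbelianGroup.lift_apply_of _ _

omit [HasZeroMorphisms C] [HasFiniteCoproducts C] in
theorem map_yonedaMap (x : F.obj Ω) {X Y : C} (f : X ⟶ Y) (y : (standardProjective Ω).obj X) :
    F.map f (yonedaMap F Ω x X y) = yonedaMap F Ω x Y ((standardProjective Ω).map f y) := by
  suffices h : (F.map f).hom.comp (yonedaMap F Ω x X) =
      (yonedaMap F Ω x Y).comp ((standardProjective Ω).map f).hom from DFunLike.congr_fun h y
  refine FreeAbelianGroup.lift_ext _ _ fun ξ => ?_
  change F.map f (yonedaMap F Ω x X (FreeAbelianGroup.of ξ)) =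
    yonedaMap F Ω x Y ((standardProjective Ω).map f (FreeAbelianGroup.of ξ))
  rw [yonedaMap_of, map_map_apply]
  exact (yonedaMap_of F Ω x (ξ ≫ f)).symm

/-- The map on cross-effects which is induced by `yonedaMap`. -/
def yonedaCross (x : F.obj Ω) (X Y : C) : cr₂ (standardProjective Ω) X Y →+ cr₂ F X Y :=
  (cr₂Proj F X Y).comp ((yonedaMap F Ω x (X ⨿ Y)).comp (AddSubgroup.subtype _))

theorem cr₂Map_yonedaCross (x : F.obj Ω) {X Y X' Y' : C} (f : X ⟶ X') (g : Y ⟶ Y')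
    (y : cr₂ (standardProjective Ω) X Y) :
    cr₂Map F f g (yonedaCross F Ω x X Y y) =
      yonedaCross F Ω x X' Y' (cr₂Map (standardProjective Ω) f g y) := by
  change cr₂Map F f g (cr₂Proj F X Y (yonedaMap F Ω x _ y.1)) = cr₂Proj F X' Y'
    (yonedaMap F Ω x _ ((standardProjective Ω).map _ y.1))
  rw [← map_yonedaMap, cr₂Proj_map]

variable {F}

/-- What is divided out consists of foldings of elements killed by both retractions in one argument.
Their images in the cross-effects of `F` are killed too, hence fold to zero, because `cr₂F` is
additive in each argument. -/
theorem bilinKer_le_yonedaCross (hF : IsPolynomial 2 F) (x : F.obj Ω) (X Y : C) :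
    bilinKer (standardProjective Ω) X Y ≤ (yonedaCross F Ω x X Y).ker := by
  refine sup_le ?_ ?_
  · rintro _ ⟨z, ⟨h₁, h₂⟩, rfl⟩
    replace h₁ : cr₂Map _ _ _ z = 0 := h₁
    replace h₂ : cr₂Map _ _ _ z = 0 := h₂
    rw [AddMonoidHom.mem_ker]
    rw [← cr₂Map_yonedaCross, hF.eq_zero_of_left (yonedaCross F Ω x (X ⨿ X) Y z), map_zero]
    · rw [cr₂Map_yonedaCross, h₁, map_zero]
    · rw [cr₂Map_yonedaCross, h₂, map_zero]
  · rintro _ ⟨z, ⟨h₁, h₂⟩, rfl⟩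
    replace h₁ : cr₂Map _ _ _ z = 0 := h₁
    replace h₂ : cr₂Map _ _ _ z = 0 := h₂
    rw [AddMonoidHom.mem_ker]
    rw [← cr₂Map_yonedaCross, hF.eq_add_right (yonedaCross F Ω x X (Y ⨿ Y) z), map_add, cr₂Map_comp,
      cr₂Map_comp, Category.id_comp, Category.assoc, Category.assoc, inl_fold, inr_fold,
      Category.comp_id, Category.comp_id, cr₂Map_yonedaCross, cr₂Map_yonedaCross, h₁, h₂,
      map_zero, add_zero]

/-- The map `T₁₁ cr₂ U (Ω, Ω) → cr₂ F (Ω, Ω)` belonging to an element of `F (Ω)`. -/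
def hopfMap (hF : IsPolynomial 2 F) (x : F.obj Ω) : TU Ω →+ cr₂ F Ω Ω :=
  QuotientAddGroup.lift _ (yonedaCross F Ω x Ω Ω) (bilinKer_le_yonedaCross Ω hF x Ω Ω)

/-- Naturality of the Yoneda map in each term of the projection. In particular the projection built
into `yonedaCross` does not alter the value. -/
theorem yonedaMap_cr₂Proj (x : F.obj Ω) {X Y : C} (y : (standardProjective Ω).obj (X ⨿ Y)) :
    yonedaMap F Ω x (X ⨿ Y) (cr₂Proj (standardProjective Ω) X Y y).1 =
      (cr₂Proj F X Y (yonedaMap F Ω x (X ⨿ Y) y)).1 := by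
  rw [coe_cr₂Proj, coe_cr₂Proj, map_add, map_sub, map_sub, ← map_yonedaMap, ← map_yonedaMap,
    ← map_yonedaMap]

theorem hopfMap_clsHom (hF : IsPolynomial 2 F) (x : F.obj Ω)
    (y : (standardProjective Ω).obj (Ω ⨿ Ω)) :
    hopfMap Ω hF x (clsHom Ω y) = cr₂Proj F Ω Ω (yonedaMap F Ω x (Ω ⨿ Ω) y) := by
  change cr₂Proj F Ω Ω (yonedaMap F Ω x _ (cr₂Proj (standardProjective Ω) Ω Ω y).1) = _
  rw [yonedaMap_cr₂Proj, cr₂Proj_coe]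

theorem hopfMap_cls (hF : IsPolynomial 2 F) (x : F.obj Ω) (ξ : Ω ⟶ Ω ⨿ Ω) :
    hopfMap Ω hF x (cls ξ) = cr₂Proj F Ω Ω (F.map ξ x) :=
  (hopfMap_clsHom Ω hF x _).trans (congrArg _ (yonedaMap_of F Ω x ξ))

theorem hopfMap_add (hF : IsPolynomial 2 F) (x y : F.obj Ω) (t : TU Ω) :
    hopfMap Ω hF (x + y) t = hopfMap Ω hF x t + hopfMap Ω hF y t := by
  induction t using TU.induction with
  | h ξ => simp only [hopfMap_cls, map_add]
  | h0 => simp only [map_zero, add_zero]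
  | hadd x y hx hy => rw [map_add, map_add, map_add, hx, hy]; abel
  | hneg x hx => rw [map_neg, map_neg, map_neg, hx]; abel

/-- `hopfMap` as a biadditive map. -/
def hopfBilin (hF : IsPolynomial 2 F) : TU Ω →+ F.obj Ω →+ cr₂ F Ω Ω :=
  AddMonoidHom.flip (AddMonoidHom.mk' (hopfMap Ω hF) fun x y =>
    AddMonoidHom.ext fun t => hopfMap_add Ω hF x y t)

/-- `hopfMap` as a map out of the tensor product over `ℤ`. -/
def hopfTensor (hF : IsPolynomial 2 F) : TU Ω ⊗[ℤ] F.obj Ω →+ cr₂ F Ω Ω :=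
  TensorProduct.liftAddHom (hopfBilin Ω hF) fun r t x => by
    rw [map_zsmul, map_zsmul, AddMonoidHom.zsmul_apply]

theorem hopfTensor_tmul (hF : IsPolynomial 2 F) (t : TU Ω) (x : F.obj Ω) :
    hopfTensor Ω hF (t ⊗ₜ x) = hopfMap Ω hF x t := rfl

/-- The quadratic module of a reduced quadratic functor. -/
def quadraticModuleOf (hF : IsPolynomial 2 F)
    (hF₀ : ∀ {X Y : C} (x : F.obj X), F.map (0 : X ⟶ Y) x = 0) : QuadraticModule.{w} Ω :=
  letI instMe : Module (ReducedRing Ω) (F.obj Ω) := Module.compHom _ (endAction F Ω hF₀)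
  letI instMee : Module (ReducedRing Ω ⊗[ℤ] ReducedRing Ω) (cr₂ F Ω Ω) :=
    Module.compHom _ (crossAction F Ω)
  have smul_e : ∀ (α : Ω ⟶ Ω) (x : F.obj Ω), (arrow α : ReducedRing Ω) • x = F.map α x :=
    endAction_arrow F Ω hF₀
  have smul_ee : ∀ (α β : Ω ⟶ Ω) (m : cr₂ F Ω Ω),
      (arrow α ⊗ₜ[ℤ] arrow β : ReducedRing Ω ⊗[ℤ] ReducedRing Ω) • m = cr₂Map F α β m :=
    crossAction_arrow F Ω
  have smul_fst : ∀ (α : Ω ⟶ Ω) (m : cr₂ F Ω Ω),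
      (arrow α ⊗ₜ[ℤ] 1 : ReducedRing Ω ⊗[ℤ] ReducedRing Ω) • m = cr₂Map F α (𝟙 Ω) m :=
    fun α m => by rw [← smul_ee, show (arrow (𝟙 Ω) : ReducedRing Ω) = 1 from map_one arrow]
  have map_smul_hopf : ∀ (s : ReducedRing Ω ⊗[ℤ] ReducedRing Ω) (y : TU Ω ⊗[ℤ] F.obj Ω),
      hopfTensor Ω hF (s • y) = s • hopfTensor Ω hF y := by
    refine map_smul_of_arrow _ fun α β y => ?_
    induction y using TensorProduct.induction_on with
    | zero => rw [smul_zero, map_zero, smul_zero]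
    | add x y hx hy => rw [smul_add, map_add, map_add, smul_add, hx, hy]
    | tmul t x =>
      rw [TensorProduct.smul_tmul', hopfTensor_tmul, hopfTensor_tmul]
      induction t using TU.induction with
      | h ξ => rw [smul_cls, hopfMap_cls, hopfMap_cls, smul_ee, ← cr₂Proj_map, map_map_apply]
      | h0 => rw [smul_zero, map_zero, smul_zero]
      | hadd x y hx hy => rw [smul_add, map_add, map_add, smul_add, hx, hy]
      | hneg x hx => rw [smul_neg, map_neg, map_neg, smul_neg, hx]
  -- On generators this is `F(γ ≫ ξ)x = F(ξ)(F(γ)x)`: precomposition on `U` corresponds to the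
  -- operation on `F(Ω)`.
  have hopf_balanced : ∀ (t : TU Ω) (r : ReducedRing Ω) (x : F.obj Ω),
      hopfMap Ω hF x (MulOpposite.op r • t) = hopfMap Ω hF (r • x) t := by
    intro t r x
    have h0 : ∀ t, hopfMap Ω hF 0 t = 0 := fun t => by simpa using hopfMap_add Ω hF 0 0 t
    induction r using ReducedRing.induction with
    | h γ =>
      induction t using TU.induction with
      | h ξ => rw [op_smul_cls, hopfMap_cls, hopfMap_cls, smul_e, map_map_apply]
      | h0 => rw [smul_zero, map_zero, map_zero]
      | hadd x y hx hy => rw [smul_add, map_add, map_add, hx, hy]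
      | hneg x hx => rw [smul_neg, map_neg, map_neg, hx]
    | h0 => rw [MulOpposite.op_zero, zero_smul, zero_smul, map_zero, h0]
    | hadd r r' hr hr' =>
      rw [MulOpposite.op_add, add_smul, add_smul, map_add, hopfMap_add, hr, hr']
    | hneg r hr =>
      rw [MulOpposite.op_neg, neg_smul, neg_smul, map_neg, hr, neg_eq_iff_add_eq_zero,
        ← hopfMap_add, add_neg_cancel, h0]
  { Me := F.obj Ω
    Mee := cr₂ F Ω Ω
    T := cr₂Swap F Ω Ω
    P := (F.map (fold Ω)).hom.comp (AddSubgroup.subtype _)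
    H := Submodule.liftQ _
      { toFun := hopfTensor Ω hF
        map_add' := map_add _
        map_smul' := map_smul_hopf } (by
          refine Submodule.span_le.2 ?_
          rintro _ ⟨t, r, x, rfl⟩
          rw [SetLike.mem_coe, LinearMap.mem_ker, map_sub, sub_eq_zero]
          exact hopf_balanced t r x)
    T_T := cr₂Swap_cr₂Swap
    T_smul := fun s m => by
      induction s using tensor_induction with
      | h α β =>
        rw [Algebra.TensorProduct.comm_tmul, smul_ee, smul_ee, cr₂Swap_cr₂Map]
      | hadd x y hx hy => rw [add_smul, map_add, map_add, add_smul, hx, hy]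
      | hneg x hx => rw [neg_smul, map_neg, map_neg, neg_smul, hx]
    fold_smul := fun ξ m => by
      rw [smul_fst, smul_fst, smul_fst, hF.cr₂Map_comp_fold]
    P_smul := fun r m => by
      have key : ∀ α : Ω ⟶ Ω, ((F.map (fold Ω)).hom.comp (AddSubgroup.subtype _))
          (diagonal Ω (arrow α) • m) =
          (arrow α : ReducedRing Ω) • ((F.map (fold Ω)).hom.comp (AddSubgroup.subtype _)) m := by
        intro α
        rw [diagonal_arrow, smul_ee, smul_e]
        change F.map (fold Ω) (F.map _ m.1) = F.map α (F.map (fold Ω) m.1)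
        rw [map_map_apply, map_map_apply, map_fold]
      induction r using ReducedRing.induction with
      | h α => exact key α
      -- The zero of `Λ` is the class of the zero arrow, so this is the case of a generator again.
      | h0 => exact arrow_zero (Ω := Ω) ▸ key 0
      | hadd x y hx hy => rw [map_add, add_smul, add_smul, map_add, hx, hy]
      | hneg x hx => rw [map_neg, neg_smul, neg_smul, map_neg, hx]
    P_T := fun m => by
      change F.map (fold Ω) (F.map (swap Ω Ω) m.1) = F.map (fold Ω) m.1
      rw [map_map_apply]
      congr 3
      refine coprod.hom_ext ?_ ?_
      · rw [← Category.assoc, inl_swap, inl_fold, inr_fold]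
      · rw [← Category.assoc, inr_swap, inl_fold, inr_fold]
    H_swap := fun t x => by
      change hopfTensor Ω hF (TUSwap Ω t ⊗ₜ x) = cr₂Swap F Ω Ω (hopfTensor Ω hF (t ⊗ₜ x))
      rw [hopfTensor_tmul, hopfTensor_tmul]
      induction t using TU.induction with
      | h ξ => rw [TUSwap_cls, hopfMap_cls, hopfMap_cls, ← cr₂Proj_swap, map_map_apply]
      | h0 => rw [map_zero, map_zero, map_zero]
      | hadd x y hx hy => rw [map_add, map_add, map_add, map_add, hx, hy]
      | hneg x hx => rw [map_neg, map_neg, map_neg, map_neg, hx]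
    qm₁ := fun ξ x => by
      change _ = _ + _ + F.map (fold Ω) (hopfTensor Ω hF (cls ξ ⊗ₜ x)).1
      rw [hopfTensor_tmul, hopfMap_cls, smul_e, smul_e, smul_e]
      exact (hF.isQuadraticMap hF₀ x).map_fold ξ
    -- Since `P` is induced by the folding map, the left side is the projection of the image of `m`
    -- under `fold Ω ≫ ξ`. Both restrictions of this arrow to the summands are `ξ`, which turns the
    -- general formula into the relation.
    qm₂ := fun ξ m => by
      change hopfTensor Ω hF (cls ξ ⊗ₜ F.map (fold Ω) m.1) = _ + cr₂Swap F Ω Ω _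
      rw [hopfTensor_tmul, hopfMap_cls, smul_ee, smul_ee, map_map_apply, hF.cr₂Proj_map_coe]
      simp only [← Category.assoc, inl_fold, inr_fold, Category.id_comp] }

theorem quadraticModuleOf_realizes (hF : IsPolynomial 2 F)
    (hF₀ : ∀ {X Y : C} (x : F.obj X), F.map (0 : X ⟶ Y) x = 0) :
    Realizes F (quadraticModuleOf Ω hF hF₀) (AddEquiv.refl (F.obj Ω))
      (AddEquiv.refl (cr₂ F Ω Ω)) where
  smul_e := endAction_arrow F Ω hF₀
  smul_ee := crossAction_arrow F Ω
  map_T _ := rfl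
  map_P _ := rfl
  map_H ξ x := (hopfTensor_tmul Ω hF _ _).trans (hopfMap_cls Ω hF x ξ)

end QuadraticModuleOf

end

end QuadraticClassification

namespace QuadraticClassification

noncomputable section

/-! ### Operations in a quadratic module -/

section Operations

variable {C : Type u} [Category.{v} C] [HasZeroMorphisms C] [HasFiniteCoproducts C] {Ω : C}

attribute [local simp] coprod.inl_desc coprod.inr_desc coprod.inl_desc_assoc coprod.inr_desc_assoc

namespace QuadraticModule

variable (M : QuadraticModule.{w} Ω)

/-- The operation of an arrow on `M_e`. -/
def act (α : Ω ⟶ Ω) : M.Me →+ M.Me := DistribSMul.toAddMonoidHom M.Me (arrow α : ReducedRing Ω)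

/-- The operation of a pair of arrows on `M_ee`. -/
def pair (α β : Ω ⟶ Ω) : M.Mee →+ M.Mee :=
  DistribSMul.toAddMonoidHom M.Mee (arrow α ⊗ₜ[ℤ] arrow β : ReducedRing Ω ⊗[ℤ] ReducedRing Ω)

/-- The map `x ↦ Ĥ ([ξ] ⊗ x)`. -/
def hopf (ξ : Ω ⟶ Ω ⨿ Ω) : M.Me →+ M.Mee :=
  AddMonoidHom.mk' (fun x => M.H (tens (cls ξ) x)) fun x y => by rw [tens_add_right, map_add]

theorem act_apply (α : Ω ⟶ Ω) (x : M.Me) : M.act α x = (arrow α : ReducedRing Ω) • x := rfl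

theorem pair_apply (α β : Ω ⟶ Ω) (m : M.Mee) : M.pair α β m =
    (arrow α ⊗ₜ[ℤ] arrow β : ReducedRing Ω ⊗[ℤ] ReducedRing Ω) • m := rfl

theorem hopf_apply (ξ : Ω ⟶ Ω ⨿ Ω) (x : M.Me) : M.hopf ξ x = M.H (tens (cls ξ) x) := rfl

omit [HasFiniteCoproducts C] in
theorem arrow_comp (α β : Ω ⟶ Ω) :
    (arrow (α ≫ β) : ReducedRing Ω) = arrow β * arrow α :=
  MonoidHom.map_mul (arrow (Ω := Ω)) β α

omit [HasFiniteCoproducts C] in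
theorem arrow_id : (arrow (𝟙 Ω) : ReducedRing Ω) = 1 := map_one arrow

theorem act_comp (α β : Ω ⟶ Ω) (x : M.Me) : M.act (α ≫ β) x = M.act β (M.act α x) := by
  simp only [act_apply, arrow_comp, mul_smul]

theorem act_id (x : M.Me) : M.act (𝟙 Ω) x = x := by
  rw [act_apply, arrow_id, one_smul]

theorem act_zero (x : M.Me) : M.act 0 x = 0 := by
  rw [act_apply, arrow_zero, zero_smul]

theorem pair_comp (α β α' β' : Ω ⟶ Ω) (m : M.Mee) :
    M.pair (α ≫ α') (β ≫ β') m = M.pair α' β' (M.pair α β m) := by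
  simp only [pair_apply, arrow_comp, ← mul_smul, Algebra.TensorProduct.tmul_mul_tmul]

theorem pair_id (m : M.Mee) : M.pair (𝟙 Ω) (𝟙 Ω) m = m := by
  rw [pair_apply, arrow_id]
  exact one_smul _ m

theorem T_pair (α β : Ω ⟶ Ω) (m : M.Mee) : M.T (M.pair α β m) = M.pair β α (M.T m) := by
  rw [pair_apply, T_smul, Algebra.TensorProduct.comm_tmul, pair_apply]

theorem P_pair (α : Ω ⟶ Ω) (m : M.Mee) : M.P (M.pair α α m) = M.act α (M.P m) := by
  rw [pair_apply, ← diagonal_arrow, P_smul, act_apply]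

/-- The axiom concerns `α ⊗ 1`; the factor `1 ⊗ β` is split off and applied to `m` first. -/
theorem pair_fold_left (ξ : Ω ⟶ Ω ⨿ Ω) (β : Ω ⟶ Ω) (m : M.Mee) : M.pair (ξ ≫ fold Ω) β m =
    M.pair (ξ ≫ rho₁ Ω Ω) β m + M.pair (ξ ≫ rho₂ Ω Ω) β m := by
  have e : ∀ α : Ω ⟶ Ω, M.pair α β m =
      (arrow α ⊗ₜ[ℤ] 1 : ReducedRing Ω ⊗[ℤ] ReducedRing Ω) • M.pair (𝟙 Ω) β m := fun α => by
    rw [← arrow_id, ← pair_apply, ← pair_comp, Category.id_comp, Category.comp_id]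
  rw [e, e (ξ ≫ rho₁ Ω Ω), e (ξ ≫ rho₂ Ω Ω), M.fold_smul]

theorem pair_zero_left (β : Ω ⟶ Ω) (m : M.Mee) : M.pair 0 β m = 0 := by
  simpa using M.pair_fold_left 0 β m

theorem pair_zero_right (α : Ω ⟶ Ω) (m : M.Mee) : M.pair α 0 m = 0 := by
  rw [← M.T_T m, ← T_pair, pair_zero_left, map_zero]

theorem hopf_map (ξ : Ω ⟶ Ω ⨿ Ω) (α β : Ω ⟶ Ω) (x : M.Me) :
    M.hopf (ξ ≫ coprod.map α β) x = M.pair α β (M.hopf ξ x) := by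
  rw [hopf_apply, ← smul_cls, ← smul_tens, map_smul, pair_apply, hopf_apply]

theorem hopf_precomp (γ : Ω ⟶ Ω) (ξ : Ω ⟶ Ω ⨿ Ω) (x : M.Me) :
    M.hopf (γ ≫ ξ) x = M.hopf ξ (M.act γ x) := by
  rw [hopf_apply, ← op_smul_cls, ← tens_smul, hopf_apply, act_apply]

theorem hopf_swap (ξ : Ω ⟶ Ω ⨿ Ω) (x : M.Me) : M.hopf (ξ ≫ swap Ω Ω) x = M.T (M.hopf ξ x) := by
  rw [hopf_apply, ← TUSwap_cls, H_swap, hopf_apply]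

theorem hopf_map_fold (ξ : Ω ⟶ (Ω ⨿ Ω) ⨿ Ω) (x : M.Me) :
    M.hopf (ξ ≫ coprod.map (fold Ω) (𝟙 Ω)) x =
      M.hopf (ξ ≫ coprod.map (rho₁ Ω Ω) (𝟙 Ω)) x + M.hopf (ξ ≫ coprod.map (rho₂ Ω Ω) (𝟙 Ω)) x := by
  rw [hopf_apply, cls_map_fold, tens_add_left, map_add, ← hopf_apply, ← hopf_apply]

theorem hopf_map_fold_left {Z : C} (ξ : Ω ⟶ (Ω ⨿ Ω) ⨿ Z) (g : Z ⟶ Ω) (x : M.Me) :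
    M.hopf (ξ ≫ coprod.map (fold Ω) g) x =
      M.hopf (ξ ≫ coprod.map (rho₁ Ω Ω) g) x + M.hopf (ξ ≫ coprod.map (rho₂ Ω Ω) g) x := by
  simpa using M.hopf_map_fold (ξ ≫ coprod.map (𝟙 _) g) x

theorem hopf_map_fold_right {Z : C} (ξ : Ω ⟶ Z ⨿ (Ω ⨿ Ω)) (g : Z ⟶ Ω) (x : M.Me) :
    M.hopf (ξ ≫ coprod.map g (fold Ω)) x =
      M.hopf (ξ ≫ coprod.map g (rho₁ Ω Ω)) x + M.hopf (ξ ≫ coprod.map g (rho₂ Ω Ω)) x := by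
  have e : ∀ h : Ω ⨿ Ω ⟶ Ω, M.hopf (ξ ≫ coprod.map g h) x =
      M.T (M.hopf ((ξ ≫ swap _ _) ≫ coprod.map h g) x) := fun h => by
    rw [← hopf_swap, Category.assoc, Category.assoc]
    congr 2
    congr 1
    refine coprod.hom_ext ?_ ?_ <;> simp [swap]
  rw [e, e (rho₁ Ω Ω), e (rho₂ Ω Ω), hopf_map_fold_left, map_add]

/-- Additivity of `Ĥ ([ξ] ⊗ x)` for arrows into arbitrary sums. -/
theorem hopf_map_fold_map {X Z : C} (ξ : Ω ⟶ (X ⨿ X) ⨿ Z) (f : X ⟶ Ω) (g : Z ⟶ Ω) (x : M.Me) :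
    M.hopf ((ξ ≫ coprod.map (fold X) (𝟙 Z)) ≫ coprod.map f g) x =
      M.hopf ((ξ ≫ coprod.map (rho₁ X X) (𝟙 Z)) ≫ coprod.map f g) x +
        M.hopf ((ξ ≫ coprod.map (rho₂ X X) (𝟙 Z)) ≫ coprod.map f g) x := by
  have h := M.hopf_map_fold_left (ξ ≫ coprod.map (coprod.map f f) (𝟙 Z)) g x
  simpa only [Category.assoc, coprod.map_map, Category.id_comp, ← map_fold, ← map_rho₁_fold,
    ← map_rho₂_fold] using h

/-- The deviation of `Ĥ ([ξ] ⊗ x)`, as a function of `ξ`. -/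
theorem hopf_fold {X : C} (ξ : Ω ⟶ X ⨿ X) (τ : X ⟶ Ω ⨿ Ω) (x : M.Me) :
    M.hopf ((ξ ≫ fold X) ≫ τ) x =
      M.hopf ((ξ ≫ rho₁ X X) ≫ τ) x + M.hopf ((ξ ≫ rho₂ X X) ≫ τ) x +
        (M.hopf (ξ ≫ coprod.map (τ ≫ rho₁ Ω Ω) (τ ≫ rho₂ Ω Ω)) x +
          M.T (M.hopf (ξ ≫ coprod.map (τ ≫ rho₂ Ω Ω) (τ ≫ rho₁ Ω Ω)) x)) := by
  -- `ζ` applies `τ` to both copies of `X` and keeps the results apart inside each of the two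
  -- arguments. Folding both arguments gives `fold X ≫ τ`, so biadditivity yields four terms: equal
  -- retractions give `τ` on one copy of `X`, unequal ones the mixed terms, one of them up to
  -- interchange.
  let ζ : X ⨿ X ⟶ (Ω ⨿ Ω) ⨿ (Ω ⨿ Ω) := coprod.desc (τ ≫ coprod.map coprod.inl coprod.inl)
    (τ ≫ coprod.map coprod.inr coprod.inr)
  have h₁ : coprod.map (𝟙 Ω) (0 : Ω ⟶ Ω) = rho₁ Ω Ω ≫ coprod.inl := by
    refine coprod.hom_ext ?_ ?_ <;> simp [rho₁]
  have h₂ : coprod.map (0 : Ω ⟶ Ω) (𝟙 Ω) = rho₂ Ω Ω ≫ coprod.inr := by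
    refine coprod.hom_ext ?_ ?_ <;> simp [rho₂]
  have h₀ : coprod.map (0 : Ω ⟶ Ω) (0 : Ω ⟶ Ω) = 0 := by
    refine coprod.hom_ext ?_ ?_ <;> simp
  have e : (ξ ≫ fold X) ≫ τ = (ξ ≫ ζ) ≫ coprod.map (fold Ω) (fold Ω) := by
    rw [Category.assoc, Category.assoc]
    congr 1
    refine coprod.hom_ext ?_ ?_ <;> simp [ζ, fold]
  have e₁₁ : (ξ ≫ ζ) ≫ coprod.map (rho₁ Ω Ω) (rho₁ Ω Ω) = (ξ ≫ rho₁ X X) ≫ τ := by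
    rw [Category.assoc, Category.assoc]
    congr 1
    refine coprod.hom_ext ?_ ?_ <;> simp [ζ, rho₁, h₀]
  have e₂₂ : (ξ ≫ ζ) ≫ coprod.map (rho₂ Ω Ω) (rho₂ Ω Ω) = (ξ ≫ rho₂ X X) ≫ τ := by
    rw [Category.assoc, Category.assoc]
    congr 1
    refine coprod.hom_ext ?_ ?_ <;> simp [ζ, rho₂, h₀]
  have e₁₂ : (ξ ≫ ζ) ≫ coprod.map (rho₁ Ω Ω) (rho₂ Ω Ω) =
      ξ ≫ coprod.map (τ ≫ rho₁ Ω Ω) (τ ≫ rho₂ Ω Ω) := by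
    rw [Category.assoc]
    congr 1
    refine coprod.hom_ext ?_ ?_ <;> simp [ζ, inl_rho₁, inr_rho₁, inl_rho₂, inr_rho₂, h₁, h₂]
  have e₂₁ : (ξ ≫ ζ) ≫ coprod.map (rho₂ Ω Ω) (rho₁ Ω Ω) =
      (ξ ≫ coprod.map (τ ≫ rho₂ Ω Ω) (τ ≫ rho₁ Ω Ω)) ≫ swap Ω Ω := by
    rw [Category.assoc, Category.assoc]
    congr 1
    refine coprod.hom_ext ?_ ?_ <;>
      simp [ζ, inl_rho₁, inr_rho₁, inl_rho₂, inr_rho₂, h₁, h₂, inl_swap, inr_swap]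
  rw [e, hopf_map_fold_left, hopf_map_fold_right, hopf_map_fold_right, e₁₁, e₁₂, e₂₁, e₂₂,
    hopf_swap]
  abel

theorem act_fold (ξ : Ω ⟶ Ω ⨿ Ω) (x : M.Me) : M.act (ξ ≫ fold Ω) x =
    M.act (ξ ≫ rho₁ Ω Ω) x + M.act (ξ ≫ rho₂ Ω Ω) x + M.P (M.hopf ξ x) := M.qm₁ ξ x

theorem hopf_P (ξ : Ω ⟶ Ω ⨿ Ω) (m : M.Mee) : M.hopf ξ (M.P m) =
    M.pair (ξ ≫ rho₁ Ω Ω) (ξ ≫ rho₂ Ω Ω) m + M.T (M.pair (ξ ≫ rho₂ Ω Ω) (ξ ≫ rho₁ Ω Ω) m) :=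
  M.qm₂ ξ m

theorem hopf_zero (x : M.Me) : M.hopf 0 x = 0 := by
  simpa using M.hopf_map_fold 0 x

/-- `inl` is unchanged by `coprod.map (𝟙 Ω) 0`, so the value is in the image of the operation of `(𝟙
Ω, 0)`, which is zero. In this way unit vectors will appear as coordinates. -/
theorem hopf_inl (x : M.Me) : M.hopf coprod.inl x = 0 := by
  have h := M.hopf_map coprod.inl (𝟙 Ω) 0 x
  rwa [coprod.inl_map, Category.id_comp, pair_zero_right] at h

theorem hopf_inr (x : M.Me) : M.hopf coprod.inr x = 0 := by
  have h := M.hopf_map coprod.inr 0 (𝟙 Ω) x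
  rwa [coprod.inr_map, Category.id_comp, pair_zero_left] at h

end QuadraticModule

/-! ### Evaluations of a quadratic module -/

open QuadraticModule

/-- The evaluations of the quadratic module `M` at `X` with values in `A`: the data of a
homomorphism to `A` from the value at `X` of the functor belonging to `M`. -/
structure Evaluation (M : QuadraticModule.{w} Ω) (X : C) (A : Type*) [AddCommGroup A] where
  /-- The values on `M_e`. -/
  p : (Ω ⟶ X) → M.Me →+ A
  /-- The values on `M_ee`. -/
  q : (Ω ⟶ X) → (Ω ⟶ X) → M.Mee →+ A
  /-- The deviation of `p`. -/
  dev : (Ω ⟶ X ⨿ X) → M.Me → A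
  p_comp : ∀ α f x, p (α ≫ f) x = p f (M.act α x)
  isQuadraticMap : ∀ x, IsQuadraticMap (fun f => p f x) (fun ξ => dev ξ x)
  dev_map : ∀ (ξ : Ω ⟶ Ω ⨿ Ω) f g x, dev (ξ ≫ coprod.map f g) x = q f g (M.hopf ξ x)
  q_fold : ∀ (ξ : Ω ⟶ X ⨿ X) g m,
    q (ξ ≫ fold X) g m = q (ξ ≫ rho₁ X X) g m + q (ξ ≫ rho₂ X X) g m
  q_comp : ∀ α β f g m, q (α ≫ f) (β ≫ g) m = q f g (M.pair α β m)
  q_self : ∀ f m, q f f m = p f (M.P m)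
  q_swap : ∀ f g m, q g f m = q f g (M.T m)

namespace Evaluation

variable {M : QuadraticModule.{w} Ω} {X Y : C} {A : Type*} [AddCommGroup A]

/-- The evaluation at an arrow `X ⟶ Ω`. -/
def ofArrow (M : QuadraticModule.{w} Ω) (l : X ⟶ Ω) : Evaluation M X M.Me where
  p f := M.act (f ≫ l)
  q f g := M.P.comp (M.pair (f ≫ l) (g ≫ l))
  dev ξ x := M.P (M.hopf (ξ ≫ coprod.map l l) x)
  p_comp α f x := by rw [Category.assoc, act_comp]
  isQuadraticMap x :=
    { map_fold := fun ξ => by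
        -- This is where the relation for `(∇ξ)x` enters the construction of the functor.
        have h := M.act_fold (ξ ≫ coprod.map l l) x
        simpa only [Category.assoc, ← map_fold, ← map_rho₁_fold, ← map_rho₂_fold] using h
      dev_add := fun ξ => by rw [hopf_map_fold_map, map_add] }
  dev_map ξ f g x := by
    rw [Category.assoc, coprod.map_map, hopf_map, AddMonoidHom.comp_apply]
  q_fold ξ g m := by
    have h := congrArg M.P (M.pair_fold_left (ξ ≫ coprod.map l l) (g ≫ l) m)
    simpa only [Category.assoc, ← map_fold, ← map_rho₁_fold, ← map_rho₂_fold, map_add,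
      AddMonoidHom.comp_apply] using h
  q_comp α β f g m := by
    simp only [AddMonoidHom.comp_apply, Category.assoc]
    rw [pair_comp]
  q_self f m := by rw [AddMonoidHom.comp_apply, P_pair]
  q_swap f g m := by
    rw [AddMonoidHom.comp_apply, AddMonoidHom.comp_apply, ← M.P_T, T_pair]

/-- The evaluation at an arrow `X ⟶ Ω + Ω`. -/
def ofArrowSum (M : QuadraticModule.{w} Ω) (l : X ⟶ Ω ⨿ Ω) : Evaluation M X M.Mee where
  p f := M.hopf (f ≫ l)
  q f g := M.pair (f ≫ l ≫ rho₁ Ω Ω) (g ≫ l ≫ rho₂ Ω Ω) +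
    M.T.comp (M.pair (f ≫ l ≫ rho₂ Ω Ω) (g ≫ l ≫ rho₁ Ω Ω))
  dev ξ x := M.hopf (ξ ≫ coprod.map (l ≫ rho₁ Ω Ω) (l ≫ rho₂ Ω Ω)) x +
    M.T (M.hopf (ξ ≫ coprod.map (l ≫ rho₂ Ω Ω) (l ≫ rho₁ Ω Ω)) x)
  p_comp α f x := by rw [Category.assoc, hopf_precomp]
  isQuadraticMap x :=
    { map_fold := fun ξ => M.hopf_fold ξ l x
      dev_add := fun ξ => by
        simp only [hopf_map_fold_map, map_add]
        abel }
  dev_map ξ f g x := by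
    simp only [Category.assoc, coprod.map_map, hopf_map, AddMonoidHom.add_apply,
      AddMonoidHom.comp_apply]
  q_fold ξ g m := by
    have h := fun k l : X ⟶ Ω => M.pair_fold_left (ξ ≫ coprod.map k k) (g ≫ l) m
    simp only [Category.assoc, ← map_fold, ← map_rho₁_fold, ← map_rho₂_fold] at h
    simp only [Category.assoc, AddMonoidHom.add_apply, AddMonoidHom.comp_apply, h, map_add]
    abel
  q_comp α β f g m := by
    simp only [AddMonoidHom.add_apply, AddMonoidHom.comp_apply, Category.assoc, pair_comp]
  -- This is exactly the relation for `Ĥ([ξ] ⊗ Pm)`, with `ξ = f ≫ l`.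
  q_self f m := by
    simp only [hopf_P, AddMonoidHom.add_apply, AddMonoidHom.comp_apply, Category.assoc]
  q_swap f g m := by
    simp only [AddMonoidHom.add_apply, AddMonoidHom.comp_apply, T_pair, T_T]
    rw [add_comm]

/-- The restriction of an evaluation along an arrow. -/
def precomp (E : Evaluation M Y A) (h : X ⟶ Y) : Evaluation M X A where
  p f := E.p (f ≫ h)
  q f g := E.q (f ≫ h) (g ≫ h)
  dev ξ x := E.dev (ξ ≫ coprod.map h h) x
  p_comp α f x := by rw [Category.assoc, E.p_comp]
  isQuadraticMap x :=
    { map_fold := fun ξ => by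
        have e := (E.isQuadraticMap x).map_fold (ξ ≫ coprod.map h h)
        simpa only [Category.assoc, ← map_fold, ← map_rho₁_fold, ← map_rho₂_fold] using e
      dev_add := fun ξ => by
        have e := (E.isQuadraticMap x).dev_add (ξ ≫ coprod.map (coprod.map h h) h)
        simpa only [Category.assoc, coprod.map_map, Category.id_comp, Category.comp_id, ← map_fold,
          ← map_rho₁_fold, ← map_rho₂_fold] using e }
  dev_map ξ f g x := by rw [Category.assoc, coprod.map_map, E.dev_map]
  q_fold ξ g m := by
    have e := E.q_fold (ξ ≫ coprod.map h h) (g ≫ h) m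
    simpa only [Category.assoc, ← map_fold, ← map_rho₁_fold, ← map_rho₂_fold] using e
  q_comp α β f g m := by rw [Category.assoc, Category.assoc, E.q_comp]
  q_self f m := E.q_self _ m
  q_swap f g m := E.q_swap _ _ m

/-- The restriction of an evaluation along a morphism of quadratic modules. -/
def ofHom {N : QuadraticModule.{w} Ω} (E : Evaluation N X A) (φ : M ⟶ N) : Evaluation M X A where
  p f := (E.p f).comp φ.e.toAddMonoidHom
  q f g := (E.q f g).comp φ.ee.toAddMonoidHom
  dev ξ x := E.dev ξ (φ.e x)
  p_comp α f _ := (E.p_comp α f _).trans (congrArg _ (φ.e.map_smul _ _).symm)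
  isQuadraticMap _ := E.isQuadraticMap _
  dev_map ξ f g _ := (E.dev_map ξ f g _).trans (congrArg _ (φ.comm_H _ _).symm)
  q_fold ξ g _ := E.q_fold ξ g _
  q_comp α β f g _ := (E.q_comp α β f g _).trans (congrArg _ (φ.ee.map_smul _ _).symm)
  q_self f _ := (E.q_self f _).trans (congrArg _ (φ.comm_P _).symm)
  q_swap f g _ := (E.q_swap f g _).trans (congrArg _ (φ.comm_T _).symm)

/-- A family of evaluations as one evaluation. -/
def pi {J : Type*} {B : J → Type*} [∀ j, AddCommGroup (B j)] (E : ∀ j, Evaluation M X (B j)) :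
    Evaluation M X (∀ j, B j) where
  p f := AddMonoidHom.pi fun j => (E j).p f
  q f g := AddMonoidHom.pi fun j => (E j).q f g
  dev ξ x j := (E j).dev ξ x
  p_comp α f x := funext fun j => (E j).p_comp α f x
  isQuadraticMap x :=
    { map_fold := fun ξ => funext fun j => ((E j).isQuadraticMap x).map_fold ξ
      dev_add := fun ξ => funext fun j => ((E j).isQuadraticMap x).dev_add ξ }
  dev_map ξ f g x := funext fun j => (E j).dev_map ξ f g x
  q_fold ξ g m := funext fun j => (E j).q_fold ξ g m
  q_comp α β f g m := funext fun j => (E j).q_comp α β f g m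
  q_self f m := funext fun j => (E j).q_self f m
  q_swap f g m := funext fun j => (E j).q_swap f g m

/-- A pair of evaluations as one evaluation. -/
def prod {B : Type*} [AddCommGroup B] (E : Evaluation M X A) (E' : Evaluation M X B) :
    Evaluation M X (A × B) where
  p f := (E.p f).prod (E'.p f)
  q f g := (E.q f g).prod (E'.q f g)
  dev ξ x := (E.dev ξ x, E'.dev ξ x)
  p_comp α f x := Prod.ext (E.p_comp α f x) (E'.p_comp α f x)
  isQuadraticMap x :=
    { map_fold := fun ξ =>
        Prod.ext ((E.isQuadraticMap x).map_fold ξ) ((E'.isQuadraticMap x).map_fold ξ)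
      dev_add := fun ξ =>
        Prod.ext ((E.isQuadraticMap x).dev_add ξ) ((E'.isQuadraticMap x).dev_add ξ) }
  dev_map ξ f g x := Prod.ext (E.dev_map ξ f g x) (E'.dev_map ξ f g x)
  q_fold ξ g m := Prod.ext (E.q_fold ξ g m) (E'.q_fold ξ g m)
  q_comp α β f g m := Prod.ext (E.q_comp α β f g m) (E'.q_comp α β f g m)
  q_self f m := Prod.ext (E.q_self f m) (E'.q_self f m)
  q_swap f g m := Prod.ext (E.q_swap f g m) (E'.q_swap f g m)

section Lemmas

variable (E : Evaluation M X A)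

theorem q_fold_right (f : Ω ⟶ X) (ξ : Ω ⟶ X ⨿ X) (m : M.Mee) :
    E.q f (ξ ≫ fold X) m = E.q f (ξ ≫ rho₁ X X) m + E.q f (ξ ≫ rho₂ X X) m := by
  have h := fun g => E.q_swap g f m
  rw [h, h, h, E.q_fold]

theorem p_zero (x : M.Me) : E.p 0 x = 0 := (E.isQuadraticMap x).map_zero

theorem q_zero_left (f : Ω ⟶ X) (m : M.Mee) : E.q 0 f m = 0 := by
  simpa using E.q_fold 0 f m

theorem q_zero_right (f : Ω ⟶ X) (m : M.Mee) : E.q f 0 m = 0 := by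
  simpa using E.q_fold_right f 0 m

/-- An additive map is quadratic with deviation zero; this lets the expansion theorem also treat the
values on `M_ee`, one argument at a time. -/
theorem isQuadraticMap_q_left (g : Ω ⟶ X) (m : M.Mee) :
    IsQuadraticMap (fun f => E.q f g m) fun _ => 0 :=
  ⟨fun ξ => by rw [E.q_fold, add_zero], fun _ => (add_zero 0).symm⟩

theorem isQuadraticMap_q_right (f : Ω ⟶ X) (m : M.Mee) :
    IsQuadraticMap (fun g => E.q f g m) fun _ => 0 :=
  ⟨fun ξ => by rw [E.q_fold_right, add_zero], fun _ => (add_zero 0).symm⟩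

end Lemmas

end Evaluation

end Operations

end

end QuadraticClassification

namespace QuadraticClassification

noncomputable section

/-! ### Presentations of objects as sums of copies of a fixed object -/

section Presentation

variable {C : Type u} [Category.{v} C] [HasZeroMorphisms C] [HasFiniteCoproducts C] {Ω : C}

attribute [local simp] coprod.inl_desc coprod.inr_desc coprod.inl_desc_assoc coprod.inr_desc_assoc

variable (Ω) in
/-- An isomorphism of `X` with a finite sum of copies of `Ω`. -/
structure Presentation (X : C) where
  /-- The number of summands. -/
  n : ℕ
  /-- The isomorphism. -/
  iso : X ≅ ∐ fun _ : Fin n => Ω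

namespace Presentation

variable {X : C} (B : Presentation Ω X)

/-- The injections of the summands. -/
def inj (j : Fin B.n) : Ω ⟶ X := Sigma.ι (fun _ : Fin B.n => Ω) j ≫ B.iso.inv

/-- The retractions onto the summands. -/
def ret (j : Fin B.n) : X ⟶ Ω := B.iso.hom ≫ Sigma.desc fun i => if i = j then 𝟙 Ω else 0

/-- The retractions onto the sums of two summands. -/
def ret₂ (j k : Fin B.n) : X ⟶ Ω ⨿ Ω := B.iso.hom ≫ Sigma.desc fun i =>
  if i = j then coprod.inl else if i = k then coprod.inr else 0

theorem inj_ret (i j : Fin B.n) : B.inj i ≫ B.ret j = if i = j then 𝟙 Ω else 0 := by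
  simp [inj, ret]

theorem inj_ret₂ (i j k : Fin B.n) :
    B.inj i ≫ B.ret₂ j k = if i = j then coprod.inl else if i = k then coprod.inr else 0 := by
  simp [inj, ret₂]

theorem ret₂_rho₁ (j k : Fin B.n) : B.ret₂ j k ≫ rho₁ Ω Ω = B.ret j := by
  rw [ret₂, ret, Category.assoc]
  congr 1
  refine Sigma.hom_ext _ _ fun i => ?_
  by_cases h₁ : i = j
  · simp [h₁, inl_rho₁]
  · by_cases h₂ : i = k
    · subst h₂
      simp [h₁, inr_rho₁]
    · simp [h₁, h₂]

/-- For `j = k` the only relevant summand would go to the first copy, by the order of the cases in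
`ret₂`; hence the hypothesis. -/
theorem ret₂_rho₂ {j k : Fin B.n} (h : j ≠ k) : B.ret₂ j k ≫ rho₂ Ω Ω = B.ret k := by
  rw [ret₂, ret, Category.assoc]
  congr 1
  refine Sigma.hom_ext _ _ fun i => ?_
  by_cases h₁ : i = j
  · simp [h₁, inl_rho₂, h]
  · by_cases h₂ : i = k
    · subst h₂
      simp [h₁, inr_rho₂]
    · simp [h₁, h₂]

theorem hom_restrictTo_inv (j : Fin B.n) :
    B.iso.hom ≫ restrictTo (fun _ : Fin B.n => Ω) {j} ≫ B.iso.inv = B.ret j ≫ B.inj j := by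
  rw [ret, inj, Category.assoc]
  congr 1
  refine Sigma.hom_ext _ _ fun i => ?_
  by_cases h : i = j
  · subst h
    simp [restrictTo]
  · simp [restrictTo, h]

theorem hom_separate_map_inv (j k : Fin B.n) :
    B.iso.hom ≫ separate (fun _ : Fin B.n => Ω) {j} {k} ≫ coprod.map B.iso.inv B.iso.inv =
      B.ret₂ j k ≫ coprod.map (B.inj j) (B.inj k) := by
  rw [ret₂, Category.assoc]
  congr 1
  refine Sigma.hom_ext _ _ fun i => ?_
  by_cases h₁ : i = j
  · subst h₁
    simp [separate, inj]
  · by_cases h₂ : i = k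
    · subst h₂
      simp [separate, h₁, inj]
    · simp [separate, h₁, h₂]

end Presentation

/-- The expansion of a quadratic map in terms of a presentation of the target. -/
theorem IsQuadraticMap.eq_sum_presentation {W X : C} {A : Type*} [AddCommGroup A] {p : (W ⟶ X) → A}
    {κ : (W ⟶ X ⨿ X) → A} (h : IsQuadraticMap p κ) (B : Presentation Ω X) (g : W ⟶ X) :
    p g = ∑ i, p (g ≫ B.ret i ≫ B.inj i) +
      ∑ q : Pairs B.n, κ (g ≫ B.ret₂ q.1.1 q.1.2 ≫ coprod.map (B.inj q.1.1) (B.inj q.1.2)) := by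
  let b := B.iso.inv
  have h' : IsQuadraticMap (fun f : W ⟶ ∐ fun _ : Fin B.n => Ω => p (f ≫ b))
      (fun ξ => κ (ξ ≫ coprod.map b b)) := by
    constructor
    · intro ξ
      have e := h.map_fold (ξ ≫ coprod.map b b)
      simpa only [Category.assoc, ← QuadraticClassification.map_fold, ← map_rho₁_fold, ← map_rho₂_fold] using e
    · intro ξ
      have e := h.dev_add (ξ ≫ coprod.map (coprod.map b b) b)
      simpa only [Category.assoc, coprod.map_map, Category.id_comp, Category.comp_id, ← QuadraticClassification.map_fold,
          ← map_rho₁_fold, ← map_rho₂_fold] using e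
  have key := h'.eq_sum _ (g ≫ B.iso.hom)
  simpa only [b, Category.assoc, Iso.hom_inv_id, Category.comp_id, B.hom_restrictTo_inv,
    B.hom_separate_map_inv] using key

namespace Evaluation

variable {M : QuadraticModule.{w} Ω} {X : C} {A : Type*} [AddCommGroup A]
  (E : Evaluation M X A) (B : Presentation Ω X)

/-- In the expansion of `p`, `p_comp` moves `g ≫ ret i` to the operation on `x`, and `dev_map` turns
the deviations into values of `q` on `Ĥ`. The coefficients do not depend on `E`: they are the
coordinates of the universal evaluation. -/
theorem p_eq_sum (g : Ω ⟶ X) (x : M.Me) : E.p g x =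
    ∑ i, E.p (B.inj i) (M.act (g ≫ B.ret i) x) +
      ∑ r : Pairs B.n, E.q (B.inj r.1.1) (B.inj r.1.2) (M.hopf (g ≫ B.ret₂ r.1.1 r.1.2) x) := by
  rw [(E.isQuadraticMap x).eq_sum_presentation B g]
  simp only [← Category.assoc, E.p_comp, E.dev_map]

/-- Biadditivity gives a double sum over the summands. Its diagonal terms are values of `p` on `P`
by `q_self`, and a term below the diagonal is moved above it by `q_swap`, at the cost of `T`. -/
theorem q_eq_sum (f g : Ω ⟶ X) (m : M.Mee) : E.q f g m =
    ∑ i, E.p (B.inj i) (M.P (M.pair (f ≫ B.ret i) (g ≫ B.ret i) m)) +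
      ∑ r : Pairs B.n, E.q (B.inj r.1.1) (B.inj r.1.2)
        (M.pair (f ≫ B.ret r.1.1) (g ≫ B.ret r.1.2) m +
          M.T (M.pair (f ≫ B.ret r.1.2) (g ≫ B.ret r.1.1) m)) := by
  have h : E.q f g m =
      ∑ j, ∑ k, E.q (B.inj j) (B.inj k) (M.pair (f ≫ B.ret j) (g ≫ B.ret k) m) := by
    rw [(E.isQuadraticMap_q_left g m).eq_sum_presentation B f, Finset.sum_const_zero, add_zero]
    refine Finset.sum_congr rfl fun j _ => ?_
    rw [(E.isQuadraticMap_q_right _ m).eq_sum_presentation B g, Finset.sum_const_zero, add_zero]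
    refine Finset.sum_congr rfl fun k _ => ?_
    rw [← Category.assoc, ← Category.assoc, E.q_comp]
  rw [h, sum_sum_eq_diag_add_pairs]
  simp only [E.q_self, map_add, ← E.q_swap]

end Evaluation

/-! ### The value at an object of the functor belonging to a quadratic module -/

namespace Presentation

variable (M : QuadraticModule.{w} Ω) {X : C} (B : Presentation Ω X)

/-- The value at `X` of the functor belonging to `M`, in terms of a presentation of `X`. -/
abbrev Model : Type w := (Fin B.n → M.Me) × (Pairs B.n → M.Mee)

/-- The universal evaluation. -/
def univ : Evaluation M X (B.Model M) :=
  (Evaluation.pi fun j => Evaluation.ofArrow M (B.ret j)).prod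
    (Evaluation.pi fun r : Pairs B.n => Evaluation.ofArrowSum M (B.ret₂ r.1.1 r.1.2))

theorem univ_p_fst (g : Ω ⟶ X) (x : M.Me) (j : Fin B.n) :
    ((B.univ M).p g x).1 j = M.act (g ≫ B.ret j) x := rfl

theorem univ_p_snd (g : Ω ⟶ X) (x : M.Me) (r : Pairs B.n) :
    ((B.univ M).p g x).2 r = M.hopf (g ≫ B.ret₂ r.1.1 r.1.2) x := rfl

theorem univ_q_fst (f g : Ω ⟶ X) (m : M.Mee) (j : Fin B.n) :
    ((B.univ M).q f g m).1 j = M.P (M.pair (f ≫ B.ret j) (g ≫ B.ret j) m) := rfl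

theorem univ_q_snd (f g : Ω ⟶ X) (m : M.Mee) (r : Pairs B.n) :
    ((B.univ M).q f g m).2 r = M.pair (f ≫ B.ret r.1.1) (g ≫ B.ret r.1.2) m +
      M.T (M.pair (f ≫ B.ret r.1.2) (g ≫ B.ret r.1.1) m) := by
  change M.pair (f ≫ B.ret₂ _ _ ≫ rho₁ _ _) (g ≫ B.ret₂ _ _ ≫ rho₂ _ _) m +
    M.T (M.pair (f ≫ B.ret₂ _ _ ≫ rho₂ _ _) (g ≫ B.ret₂ _ _ ≫ rho₁ _ _) m) = _
  rw [ret₂_rho₁, ret₂_rho₂ B r.2.ne]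

variable {M} {A : Type*} [AddCommGroup A]

/-- The map from the model belonging to an evaluation. -/
def desc (E : Evaluation M X A) : B.Model M →+ A :=
  AddMonoidHom.mk' (fun y => ∑ i, E.p (B.inj i) (y.1 i) +
      ∑ r : Pairs B.n, E.q (B.inj r.1.1) (B.inj r.1.2) (y.2 r)) fun y z => by
    simp only [Prod.fst_add, Prod.snd_add, Pi.add_apply, map_add, Finset.sum_add_distrib]
    abel

theorem desc_apply (E : Evaluation M X A) (y : B.Model M) : B.desc E y =
    ∑ i, E.p (B.inj i) (y.1 i) + ∑ r : Pairs B.n, E.q (B.inj r.1.1) (B.inj r.1.2) (y.2 r) := rfl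

theorem desc_p (E : Evaluation M X A) (g : Ω ⟶ X) (x : M.Me) :
    B.desc E ((B.univ M).p g x) = E.p g x := (E.p_eq_sum B g x).symm

theorem desc_q (E : Evaluation M X A) (f g : Ω ⟶ X) (m : M.Mee) :
    B.desc E ((B.univ M).q f g m) = E.q f g m := by
  rw [E.q_eq_sum B, desc_apply]
  simp only [univ_q_fst, univ_q_snd]

/-- The retractions of an injection are identities or zero, and its components in `Ω ⨿ Ω` are
injections or zero, where `Ĥ` vanishes. Together with `univ_q_inj` this shows that the symbols at
the injections are the coordinate inclusions of the model. -/
theorem univ_p_inj (i : Fin B.n) (x : M.Me) :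
    (B.univ M).p (B.inj i) x = (Pi.single i x, 0) := by
  refine Prod.ext (funext fun j => ?_) (funext fun r => ?_)
  · rw [univ_p_fst, inj_ret]
    change _ = Pi.single (M := fun _ : Fin B.n => M.Me) i x j
    split_ifs with h
    · subst h
      rw [M.act_id, Pi.single_eq_same]
    · rw [M.act_zero, Pi.single_eq_of_ne (Ne.symm h)]
  · rw [univ_p_snd, inj_ret₂]
    split_ifs
    · exact M.hopf_inl x
    · exact M.hopf_inr x
    · exact M.hopf_zero x

theorem univ_q_inj (s : Pairs B.n) (m : M.Mee) :
    (B.univ M).q (B.inj s.1.1) (B.inj s.1.2) m = (0, Pi.single s m) := by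
  refine Prod.ext (funext fun j => ?_) (funext fun r => ?_)
  · rw [univ_q_fst, inj_ret, inj_ret]
    change _ = (0 : M.Me)
    by_cases h : s.1.1 = j
    · rw [if_neg (c := s.1.2 = j) (h ▸ s.2.ne'), M.pair_zero_right, map_zero]
    · rw [if_neg h, M.pair_zero_left, map_zero]
  · rw [univ_q_snd]
    simp only [inj_ret]
    change _ = Pi.single (M := fun _ : Pairs B.n => M.Mee) s m r
    by_cases h : r = s
    · subst h
      rw [Pi.single_eq_same, if_pos rfl, if_pos rfl, if_neg r.2.ne, M.pair_zero_left, map_zero,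
        add_zero, M.pair_id]
    · rw [Pi.single_eq_of_ne h]
      have h₁ : M.pair (if s.1.1 = r.1.1 then 𝟙 Ω else 0) (if s.1.2 = r.1.2 then 𝟙 Ω else 0) m
          = 0 := by
        by_cases h₁ : s.1.1 = r.1.1
        · rw [if_neg (c := s.1.2 = r.1.2) fun h₂ => h (Subtype.ext (Prod.ext h₁.symm h₂.symm)),
            M.pair_zero_right]
        · rw [if_neg h₁, M.pair_zero_left]
      have h₂ : M.pair (if s.1.1 = r.1.2 then 𝟙 Ω else 0) (if s.1.2 = r.1.1 then 𝟙 Ω else 0) m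
          = 0 := by
        by_cases h₁ : s.1.1 = r.1.2
        -- Two increasing pairs cannot be interchanged versions of each other, so the summand with
        -- `T` never contributes.
        · rw [if_neg (c := s.1.2 = r.1.1) fun h₂ => absurd r.2 (h₂ ▸ h₁ ▸ s.2.not_gt), M.pair_zero_right]
        · rw [if_neg h₁, M.pair_zero_left]
      rw [h₁, h₂, map_zero, add_zero]

theorem desc_univ (y : B.Model M) : B.desc (B.univ M) y = y := by
  rw [desc_apply]
  simp only [univ_p_inj, univ_q_inj]
  refine Prod.ext (funext fun j => ?_) (funext fun r => ?_)
  · simp [Prod.fst_sum, Finset.sum_apply, Pi.single_apply]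
  · simp [Prod.snd_sum, Finset.sum_apply, Pi.single_apply]

/-- Additive maps out of the model are determined by their values on the universal evaluation. -/
theorem model_ext {f g : B.Model M →+ A} (hp : ∀ h x, f ((B.univ M).p h x) = g ((B.univ M).p h x))
    (hq : ∀ h k m, f ((B.univ M).q h k m) = g ((B.univ M).q h k m)) : f = g := by
  ext1 y
  rw [← B.desc_univ y, desc_apply, map_add, map_add, map_sum, map_sum, map_sum, map_sum]
  simp only [hp, hq]

end Presentation

end Presentation

/-! ### The functor belonging to a quadratic module -/

section FunctorOf

variable {C : Type u} [Category.{v} C] [HasZeroMorphisms C] [HasFiniteCoproducts C] {Ω : C}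
  (M : QuadraticModule.{w} Ω) (B : ∀ X : C, Presentation Ω X)

/-- The functor belonging to a quadratic module. -/
def functorOf : C ⥤ AddCommGrpCat.{w} where
  obj X := AddCommGrpCat.of ((B X).Model M)
  -- Homomorphisms out of the model at `X` are evaluations at `X`; the one used is the universal
  -- evaluation at `Y` restricted along `f`. It sends the symbol of `g` to that of `g ≫ f`, so the
  -- functor laws are checked on symbols.
  map {X Y} f := AddCommGrpCat.ofHom ((B X).desc (((B Y).univ M).precomp f))
  map_id X := by
    refine AddCommGrpCat.hom_ext ((B X).model_ext (fun h x => ?_) fun h k m => ?_)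
    · refine ((B X).desc_p _ _ _).trans ?_
      change ((B X).univ M).p (h ≫ 𝟙 X) x = ((B X).univ M).p h x
      rw [Category.comp_id]
    · refine ((B X).desc_q _ _ _ _).trans ?_
      change ((B X).univ M).q (h ≫ 𝟙 X) (k ≫ 𝟙 X) m = ((B X).univ M).q h k m
      rw [Category.comp_id, Category.comp_id]
  map_comp {X Y Z} f g := by
    refine AddCommGrpCat.hom_ext ((B X).model_ext (fun h x => ?_) fun h k m => ?_)
    · refine ((B X).desc_p _ _ _).trans (Eq.symm ?_)
      refine (congrArg ((B Y).desc _) ((B X).desc_p _ _ _)).trans ?_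
      refine ((B Y).desc_p _ _ _).trans ?_
      change ((B Z).univ M).p ((h ≫ f) ≫ g) x = ((B Z).univ M).p (h ≫ f ≫ g) x
      rw [Category.assoc]
    · refine ((B X).desc_q _ _ _ _).trans (Eq.symm ?_)
      refine (congrArg ((B Y).desc _) ((B X).desc_q _ _ _ _)).trans ?_
      refine ((B Y).desc_q _ _ _ _).trans ?_
      change ((B Z).univ M).q ((h ≫ f) ≫ g) ((k ≫ f) ≫ g) m =
        ((B Z).univ M).q (h ≫ f ≫ g) (k ≫ f ≫ g) m
      rw [Category.assoc, Category.assoc]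

/-- The element of the functor belonging to `M` which is given by `g : Ω ⟶ X` and `x ∈ M_e`. -/
def genE {X : C} (g : Ω ⟶ X) : M.Me →+ (functorOf M B).obj X := ((B X).univ M).p g

/-- The element of the functor belonging to `M` which is given by two arrows `Ω ⟶ X` and an
element of `M_ee`. -/
def genEE {X : C} (f g : Ω ⟶ X) : M.Mee →+ (functorOf M B).obj X := ((B X).univ M).q f g

/-- The universal evaluation, with values in the functor belonging to `M`. -/
def univEval (X : C) : Evaluation M X ((functorOf M B).obj X) := (B X).univ M

variable {A : Type*} [AddCommGroup A]

/-- The map out of the value of the functor which belongs to an evaluation. -/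
def descEval {X : C} (E : Evaluation M X A) : (functorOf M B).obj X →+ A := (B X).desc E

theorem descEval_genE {X : C} (E : Evaluation M X A) (g : Ω ⟶ X) (x : M.Me) :
    descEval M B E (genE M B g x) = E.p g x := (B X).desc_p E g x

theorem descEval_genEE {X : C} (E : Evaluation M X A) (f g : Ω ⟶ X) (m : M.Mee) :
    descEval M B E (genEE M B f g m) = E.q f g m := (B X).desc_q E f g m

theorem map_genE {X Y : C} (f : X ⟶ Y) (g : Ω ⟶ X) (x : M.Me) :
    (functorOf M B).map f (genE M B g x) = genE M B (g ≫ f) x := (B X).desc_p _ g x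

theorem map_genEE {X Y : C} (f : X ⟶ Y) (g h : Ω ⟶ X) (m : M.Mee) :
    (functorOf M B).map f (genEE M B g h m) = genEE M B (g ≫ f) (h ≫ f) m :=
  (B X).desc_q _ g h m

theorem functorOf_ext {X : C} {f g : (functorOf M B).obj X →+ A}
    (hp : ∀ h x, f (genE M B h x) = g (genE M B h x))
    (hq : ∀ h k m, f (genEE M B h k m) = g (genEE M B h k m)) (y : (functorOf M B).obj X) :
    f y = g y :=
  DFunLike.congr_fun ((B X).model_ext hp hq) y

end FunctorOf

end

end QuadraticClassification

namespace QuadraticClassification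

noncomputable section

section Classification

variable {C : Type u} [Category.{v} C] [HasZeroMorphisms C] [HasFiniteCoproducts C] {Ω : C}

attribute [local simp] coprod.inl_desc coprod.inr_desc coprod.inl_desc_assoc coprod.inr_desc_assoc

open QuadraticModule

/-! ### The functor belonging to a quadratic module is quadratic -/

/-- Cutting down to a set that misses `j` can be done after forgetting the summand `j`. Elements of
the cross-effect are therefore killed by every such endomorphism. -/
theorem restrictTo_eq_retraction_comp {n : ℕ} (Y : Fin n → C) {S : Finset (Fin n)} {j : Fin n}
    (hj : j ∉ S) : restrictTo Y S = retraction Y j ≫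
      Sigma.desc fun i : {i : Fin n // i ≠ j} => if i.1 ∈ S then Sigma.ι Y i.1 else 0 := by
  refine Sigma.hom_ext _ _ fun i => ?_
  by_cases h : i = j
  · subst h
    simp [restrictTo, retraction, hj]
  · simp [restrictTo, retraction, h]

/-- Solving `map_fold` for the deviations leaves only values of `p` at restrictions of `g`. In this
form the identity can pass from symbols to arbitrary elements of a functor. -/
theorem IsQuadraticMap.eq_sum_restrictTo {n : ℕ} {Y : Fin n → C} {W : C} {A : Type*}
    [AddCommGroup A] {p : (W ⟶ ∐ Y) → A} {κ : (W ⟶ (∐ Y) ⨿ (∐ Y)) → A} (h : IsQuadraticMap p κ)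
    (g : W ⟶ ∐ Y) : p g = ∑ i, p (g ≫ restrictTo Y {i}) +
      ∑ r : Pairs n, (p (g ≫ restrictTo Y ({r.1.1} ∪ {r.1.2})) - p (g ≫ restrictTo Y {r.1.1}) -
        p (g ≫ restrictTo Y {r.1.2})) := by
  rw [h.eq_sum]
  congr 1
  refine Finset.sum_congr rfl fun r _ => ?_
  have e := h.map_fold (g ≫ separate Y {r.1.1} {r.1.2})
  rw [Category.assoc, Category.assoc, Category.assoc, separate_fold, separate_rho₁,
    separate_rho₂ Y (Finset.disjoint_singleton.2 r.2.ne)] at e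
  rw [e]
  abel

theorem map_id_rho₂ {X X' : C} (f : X ⟶ X') (Y : C) :
    coprod.map f (𝟙 Y) ≫ rho₂ X' Y = rho₂ X Y := by
  refine coprod.hom_ext ?_ ?_ <;> simp [rho₂]

theorem map_id_rho₁ {X X' : C} (f : X ⟶ X') (Y : C) :
    coprod.map f (𝟙 Y) ≫ rho₁ X' Y = rho₁ X Y ≫ f := by
  refine coprod.hom_ext ?_ ?_ <;> simp [rho₁]

/-- A pair of arrows is one arrow out of `Ω ⨿ Ω`, and a biadditive map of pairs is quadratic in it,
with the two mixed terms as deviation. -/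
theorem Evaluation.isQuadraticMap_q {M : QuadraticModule.{w} Ω} {X : C} {A : Type*}
    [AddCommGroup A] (E : Evaluation M X A) (m : M.Mee) :
    IsQuadraticMap (fun f : Ω ⨿ Ω ⟶ X => E.q (coprod.inl ≫ f) (coprod.inr ≫ f) m)
      (fun ξ => E.q (coprod.inl ≫ ξ ≫ rho₁ X X) (coprod.inr ≫ ξ ≫ rho₂ X X) m +
        E.q (coprod.inl ≫ ξ ≫ rho₂ X X) (coprod.inr ≫ ξ ≫ rho₁ X X) m) where
  map_fold ξ := by
    simp only [← Category.assoc]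
    rw [E.q_fold, E.q_fold_right, E.q_fold_right]
    abel
  dev_add ξ := by
    simp only [Category.assoc, map_id_rho₁, map_id_rho₂]
    simp only [← Category.assoc]
    rw [E.q_fold, E.q_fold_right]
    abel

variable (M : QuadraticModule.{w} Ω) (B : ∀ X : C, Presentation Ω X)

theorem genE_zero {X : C} (x : M.Me) : genE M B (0 : Ω ⟶ X) x = 0 := (univEval M B X).p_zero x

theorem genEE_zero_left {X : C} (g : Ω ⟶ X) (m : M.Mee) : genEE M B 0 g m = 0 :=
  (univEval M B X).q_zero_left g m

theorem genEE_zero_right {X : C} (g : Ω ⟶ X) (m : M.Mee) : genEE M B g 0 m = 0 :=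
  (univEval M B X).q_zero_right g m

theorem functorOf_map_zero {X Y : C} (y : (functorOf M B).obj X) :
    (functorOf M B).map (0 : X ⟶ Y) y = 0 := by
  refine functorOf_ext M B (f := ((functorOf M B).map (0 : X ⟶ Y)).hom) (g := 0) ?_ ?_ y
  · intro h x
    refine (map_genE M B _ _ _).trans ?_
    rw [comp_zero, genE_zero]
    rfl
  · intro h k m
    refine (map_genEE M B _ _ _ _).trans ?_
    rw [comp_zero, genEE_zero_left]
    rfl

/-- Both sides are additive in `y`, and on each kind of symbol this is the expansion of a quadratic
map of arrows. So elements are determined by their restrictions to at most two summands. -/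
theorem functorOf_eq_sum {n : ℕ} (Y : Fin n → C) (y : (functorOf M B).obj (∐ Y)) :
    y = ∑ i, (functorOf M B).map (restrictTo Y {i}) y +
      ∑ r : Pairs n, ((functorOf M B).map (restrictTo Y ({r.1.1} ∪ {r.1.2})) y -
        (functorOf M B).map (restrictTo Y {r.1.1}) y -
        (functorOf M B).map (restrictTo Y {r.1.2}) y) := by
  let φ := fun S : Finset (Fin n) => ((functorOf M B).map (restrictTo Y S)).hom
  let ψ : (functorOf M B).obj (∐ Y) →+ (functorOf M B).obj (∐ Y) :=
    ∑ i, φ {i} + ∑ r : Pairs n, (φ ({r.1.1} ∪ {r.1.2}) - φ {r.1.1} - φ {r.1.2})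
  have hψ : ∀ z, ψ z = ∑ i, φ {i} z +
      ∑ r : Pairs n, (φ ({r.1.1} ∪ {r.1.2}) z - φ {r.1.1} z - φ {r.1.2} z) := fun z => by
    simp only [ψ, AddMonoidHom.add_apply, AddMonoidHom.finsetSum_apply, AddMonoidHom.sub_apply]
  refine (functorOf_ext M B (f := AddMonoidHom.id _) (g := ψ) ?_ ?_ y).trans (hψ y)
  · intro h x
    have e : ∀ S, φ S (genE M B h x) = genE M B (h ≫ restrictTo Y S) x :=
      fun S => map_genE M B _ h x
    rw [hψ]
    simp only [e]
    exact ((univEval M B _).isQuadraticMap x).eq_sum_restrictTo h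
  · intro h k m
    have e : ∀ S, φ S (genEE M B h k m) =
        genEE M B (h ≫ restrictTo Y S) (k ≫ restrictTo Y S) m :=
      fun S => map_genEE M B _ h k m
    rw [hψ]
    simp only [e]
    have := ((univEval M B _).isQuadraticMap_q m).eq_sum_restrictTo (coprod.desc h k)
    simp only [coprod.inl_desc, coprod.inr_desc, coprod.inl_desc_assoc,
      coprod.inr_desc_assoc] at this
    exact this

theorem functorOf_isPolynomial : IsPolynomial 2 (functorOf M B) := by
  intro Y
  rw [eq_bot_iff]
  intro y hy
  rw [crossEffect, AddSubgroup.mem_iInf] at hy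
  have h : ∀ i k : Fin 3, (functorOf M B).map (restrictTo Y ({i} ∪ {k})) y = 0 := by
    intro i k
    -- Among three indices, some index is always missed by two.
    obtain ⟨j, hj⟩ : ∃ j, j ∉ ({i} ∪ {k} : Finset (Fin 3)) := by
      revert i k
      decide
    exact map_eq_zero_of_fac (hy j) (restrictTo_eq_retraction_comp Y hj)
  have h' : ∀ i : Fin 3, (functorOf M B).map (restrictTo Y {i}) y = 0 := fun i => by
    simpa using h i i
  rw [AddSubgroup.mem_bot, functorOf_eq_sum M B Y y]
  simp only [h, h', Finset.sum_const_zero, sub_zero, add_zero]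

open scoped ZeroObject in
theorem functorOf_reducedQuadratic [HasZeroObject C] :
    reducedQuadratic.{w} C (functorOf M B) := by
  refine ⟨functorOf_isPolynomial M B, ?_⟩
  have : Subsingleton ((functorOf M B).obj (0 : C)) := by
    refine subsingleton_of_forall_eq 0 fun y => ?_
    have e : 𝟙 (0 : C) = 0 := (isZero_zero C).eq_of_src _ _
    rw [← map_id_apply (functorOf M B) y, e, functorOf_map_zero]
  exact AddCommGrpCat.isZero_of_subsingleton _

/-! ### The quadratic module of the functor belonging to a quadratic module -/

theorem genEE_inl_inr_mem {X Y : C} (f : Ω ⟶ X) (g : Ω ⟶ Y) (m : M.Mee) :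
    genEE M B (f ≫ coprod.inl) (g ≫ coprod.inr) m ∈ cr₂ (functorOf M B) X Y := by
  rw [mem_cr₂, map_genEE, map_genEE]
  simp only [Category.assoc, inl_rho₁, inl_rho₂, inr_rho₁, inr_rho₂, comp_zero, genEE_zero_left,
    genEE_zero_right, and_self]

/-- Checked on symbols. On `(h, x)` it is the definition of the deviation; on `(f, g, m)`, expanding
`q` in both arguments and removing the unmixed terms leaves the mixed ones. It identifies the
cross-effect with `M_ee`. -/
theorem genEE_descEval (y : (functorOf M B).obj (Ω ⨿ Ω)) :
    genEE M B coprod.inl coprod.inr (descEval M B (Evaluation.ofArrowSum M (𝟙 (Ω ⨿ Ω))) y) =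
      (cr₂Proj (functorOf M B) Ω Ω y).1 := by
  let E := univEval M B (Ω ⨿ Ω)
  let k : Ω ⨿ Ω ⟶ (Ω ⨿ Ω) ⨿ (Ω ⨿ Ω) := coprod.map coprod.inl coprod.inr
  have k₀ : k ≫ fold _ = 𝟙 _ := by refine coprod.hom_ext ?_ ?_ <;> simp [k, fold]
  have k₁ : k ≫ rho₁ _ _ = rho₁ Ω Ω ≫ coprod.inl := by
    refine coprod.hom_ext ?_ ?_ <;> simp [k, rho₁]
  have k₂ : k ≫ rho₂ _ _ = rho₂ Ω Ω ≫ coprod.inr := by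
    refine coprod.hom_ext ?_ ?_ <;> simp [k, rho₂]
  refine functorOf_ext M B (f := (genEE M B coprod.inl coprod.inr).comp
    (descEval M B (Evaluation.ofArrowSum M (𝟙 (Ω ⨿ Ω)))))
    (g := (AddSubgroup.subtype _).comp (cr₂Proj (functorOf M B) Ω Ω)) ?_ ?_ y
  · intro h x
    change genEE M B _ _ (descEval M B _ _) = (cr₂Proj (functorOf M B) Ω Ω _).1
    rw [descEval_genE, coe_cr₂Proj, functorOf_map_zero, map_genE, map_genE, add_zero]
    change E.q _ _ (M.hopf (h ≫ 𝟙 _) x) = E.p h x - E.p _ x - E.p _ x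
    have e := (E.isQuadraticMap x).map_fold (h ≫ k)
    rw [Category.assoc, Category.assoc, Category.assoc, k₀, k₁, k₂, Category.comp_id] at e
    rw [← E.dev_map, Category.comp_id, e]
    abel
  · intro f g m
    change genEE M B _ _ (descEval M B _ _) = (cr₂Proj (functorOf M B) Ω Ω _).1
    rw [descEval_genEE, coe_cr₂Proj, functorOf_map_zero, map_genEE, map_genEE, add_zero]
    change E.q _ _ (M.pair (f ≫ 𝟙 _ ≫ _) (g ≫ 𝟙 _ ≫ _) m +
      M.T (M.pair (f ≫ 𝟙 _ ≫ _) (g ≫ 𝟙 _ ≫ _) m)) = E.q f g m - E.q _ _ m - E.q _ _ m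
    have e₁ := E.q_fold (f ≫ k) g m
    have e₂ := fun f' => E.q_fold_right f' (g ≫ k) m
    simp only [Category.assoc, k₀, k₁, k₂, Category.comp_id] at e₁ e₂
    rw [map_add, ← E.q_swap, ← E.q_comp, ← E.q_comp, e₁, e₂, e₂]
    simp only [Category.assoc, Category.id_comp]
    abel

/-- The isomorphism of `M_e` with the value at `Ω` of the functor belonging to `M`. -/
def equivE : M.Me ≃+ (functorOf M B).obj Ω where
  __ := genE M B (𝟙 Ω)
  invFun := descEval M B (Evaluation.ofArrow M (𝟙 Ω))
  left_inv x := by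
    change descEval M B _ (genE M B (𝟙 Ω) x) = x
    rw [descEval_genE]
    change M.act (𝟙 Ω ≫ 𝟙 Ω) x = x
    rw [Category.comp_id, M.act_id]
  right_inv y := by
    refine functorOf_ext M B (f := (genE M B (𝟙 Ω)).comp
      (descEval M B (Evaluation.ofArrow M (𝟙 Ω)))) (g := AddMonoidHom.id _) ?_ ?_ y
    · intro h x
      change genE M B (𝟙 Ω) (descEval M B _ _) = (univEval M B Ω).p h x
      rw [descEval_genE]
      change (univEval M B Ω).p _ (M.act (h ≫ 𝟙 Ω) x) = _
      rw [← Evaluation.p_comp, Category.comp_id, Category.comp_id]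
    · intro f g m
      change genE M B (𝟙 Ω) (descEval M B _ _) = (univEval M B Ω).q f g m
      rw [descEval_genEE]
      change (univEval M B Ω).p _ (M.P (M.pair (f ≫ 𝟙 Ω) (g ≫ 𝟙 Ω) m)) = _
      rw [← Evaluation.q_self, ← Evaluation.q_comp]
      simp only [Category.comp_id]

theorem equivE_apply (x : M.Me) : equivE M B x = genE M B (𝟙 Ω) x := rfl

/-- The isomorphism of `M_ee` with the cross-effect of the functor belonging to `M`. -/
def equivEE : M.Mee ≃+ cr₂ (functorOf M B) Ω Ω where
  __ := (genEE M B coprod.inl coprod.inr).codRestrict (cr₂ (functorOf M B) Ω Ω) fun m => by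
    simpa using genEE_inl_inr_mem M B (𝟙 Ω) (𝟙 Ω) m
  invFun y := descEval M B (Evaluation.ofArrowSum M (𝟙 (Ω ⨿ Ω))) y.1
  left_inv m := by
    change descEval M B _ (genEE M B coprod.inl coprod.inr m) = m
    rw [descEval_genEE]
    change M.pair (coprod.inl ≫ 𝟙 _ ≫ rho₁ Ω Ω) (coprod.inr ≫ 𝟙 _ ≫ rho₂ Ω Ω) m +
      M.T (M.pair (coprod.inl ≫ 𝟙 _ ≫ rho₂ Ω Ω) (coprod.inr ≫ 𝟙 _ ≫ rho₁ Ω Ω) m) = m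
    simp only [Category.id_comp, inl_rho₁, inl_rho₂, inr_rho₁, inr_rho₂, M.pair_id,
      M.pair_zero_left, map_zero, add_zero]
  right_inv y := by
    apply Subtype.ext
    refine (genEE_descEval M B y.1).trans ?_
    rw [cr₂Proj_coe]

theorem coe_equivEE (m : M.Mee) : (equivEE M B m).1 = genEE M B coprod.inl coprod.inr m := rfl

/-- Apart from the clause for `Ĥ`, each clause is one of the axioms of the universal evaluation at
an identity or at the two injections; the clause for `Ĥ` follows from the description of the
projection by `genEE_descEval`. -/
theorem functorOf_realizes : Realizes (functorOf M B) M (equivE M B) (equivEE M B) where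
  smul_e α x := by
    rw [equivE_apply, equivE_apply, map_genE, Category.id_comp]
    have h := (univEval M B Ω).p_comp α (𝟙 Ω) x
    rw [Category.comp_id] at h
    exact h.symm
  smul_ee α β m := by
    apply Subtype.ext
    rw [coe_cr₂Map, coe_equivEE, coe_equivEE, map_genEE, coprod.inl_map, coprod.inr_map]
    exact ((univEval M B _).q_comp α β _ _ m).symm
  map_T m := by
    apply Subtype.ext
    rw [coe_cr₂Swap, coe_equivEE, coe_equivEE, map_genEE, inl_swap, inr_swap]
    exact ((univEval M B _).q_swap _ _ m).symm
  map_P m := by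
    rw [coe_equivEE, equivE_apply, map_genEE, inl_fold, inr_fold]
    exact ((univEval M B _).q_self _ m).symm
  map_H ξ x := by
    apply Subtype.ext
    rw [coe_equivEE, equivE_apply, map_genE, Category.id_comp, ← genEE_descEval, descEval_genE]
    change _ = genEE M B _ _ (M.hopf (ξ ≫ 𝟙 _) x)
    rw [Category.comp_id, hopf_apply]

/-! ### Comparison of a quadratic functor with the functor belonging to its quadratic module -/

variable {F : C ⥤ AddCommGrpCat.{w}} {M} {a : M.Me ≃+ F.obj Ω} {b : M.Mee ≃+ cr₂ F Ω Ω}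

omit [HasZeroMorphisms C] in
theorem desc_eq_map_fold {X Y Z : C} (f : X ⟶ Z) (g : Y ⟶ Z) :
    coprod.desc f g = coprod.map f g ≫ fold Z := by
  refine coprod.hom_ext ?_ ?_ <;> simp [fold]

/-- The evaluation of a quadratic module with values in a functor to which it belongs. -/
def Evaluation.ofFunctor (R : Realizes F M a b) (hF : IsPolynomial 2 F)
    (hF₀ : ∀ {X Y : C} (x : F.obj X), F.map (0 : X ⟶ Y) x = 0) (X : C) :
    Evaluation M X (F.obj X) where
  p f := (F.map f).hom.comp a.toAddMonoidHom
  q f g := (F.map (coprod.desc f g)).hom.comp ((AddSubgroup.subtype _).comp b.toAddMonoidHom)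
  dev ξ x := F.map (fold X) (cr₂Proj F X X (F.map ξ (a x))).1
  p_comp α f x := by
    change F.map _ (a x) = F.map f (a (M.act α x))
    rw [act_apply, R.smul_e, map_map_apply]
  isQuadraticMap x := hF.isQuadraticMap hF₀ (a x)
  dev_map ξ f g x := by
    change _ = F.map _ (b (M.hopf ξ x)).1
    rw [hopf_apply, R.map_H, ← map_map_apply F ξ, cr₂Proj_map, coe_cr₂Map, map_map_apply,
      desc_eq_map_fold]
  q_fold ξ g m := by
    change F.map _ (b m).1 = F.map _ (b m).1 + F.map _ (b m).1
    simp only [desc_eq_map_fold _ g, ← map_map_apply F _ (fold X), ← coe_cr₂Map]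
    rw [hF.cr₂Map_comp_fold, AddSubgroup.coe_add, map_add]
  q_comp α β f g m := by
    change F.map _ (b m).1 = F.map _ (b (M.pair α β m)).1
    rw [pair_apply, R.smul_ee, coe_cr₂Map, map_map_apply, coprod.map_desc]
  q_self f m := by
    change F.map _ (b m).1 = F.map _ (a (M.P m))
    rw [R.map_P, map_map_apply, map_fold, desc_eq_map_fold]
  q_swap f g m := by
    change F.map _ (b m).1 = F.map _ (b (M.T m)).1
    rw [R.map_T, coe_cr₂Swap, map_map_apply]
    congr 3
    refine coprod.hom_ext ?_ ?_ <;> simp [swap]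

variable {N : QuadraticModule.{w} Ω} (R : Realizes F M a b) (hF : IsPolynomial 2 F)
    (hF₀ : ∀ {X Y : C} (x : F.obj X), F.map (0 : X ⟶ Y) x = 0) (φ : N ⟶ M)

/-- The natural transformation from the functor belonging to `N` to a functor `F` which is induced
by a homomorphism from `N` to the quadratic module of `F`. -/
def toFunctor : functorOf N B ⟶ F where
  app X := AddCommGrpCat.ofHom (descEval N B ((Evaluation.ofFunctor R hF hF₀ X).ofHom φ))
  naturality X Y f := by
    refine AddCommGrpCat.hom_ext (AddMonoidHom.ext (functorOf_ext N B ?_ ?_))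
    · intro h x
      change descEval N B _ ((functorOf N B).map f _) = F.map f (descEval N B _ _)
      rw [map_genE, descEval_genE, descEval_genE]
      exact (map_map_apply F _ _ _).symm
    · intro h k m
      change descEval N B _ ((functorOf N B).map f _) = F.map f (descEval N B _ _)
      rw [map_genEE, descEval_genEE, descEval_genEE]
      refine Eq.trans ?_ (map_map_apply F _ _ _).symm
      rw [coprod.desc_comp]
      rfl

theorem toFunctor_genE {X : C} (g : Ω ⟶ X) (x : N.Me) :
    (toFunctor B R hF hF₀ φ).app X (genE N B g x) = F.map g (a (φ.e x)) :=
  descEval_genE N B _ g x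

theorem toFunctor_genEE {X : C} (f g : Ω ⟶ X) (m : N.Mee) :
    (toFunctor B R hF hF₀ φ).app X (genEE N B f g m) =
      F.map (coprod.desc f g) (b (φ.ee m)).1 :=
  descEval_genEE N B _ f g m

theorem toFunctor_id_genE {X : C} (g : Ω ⟶ X) (x : M.Me) :
    (toFunctor B R hF hF₀ (𝟙 M)).app X (genE M B g x) = F.map g (a x) :=
  toFunctor_genE B R hF hF₀ (𝟙 M) g x

theorem toFunctor_id_genEE {X : C} (f g : Ω ⟶ X) (m : M.Mee) :
    (toFunctor B R hF hF₀ (𝟙 M)).app X (genEE M B f g m) = F.map (coprod.desc f g) (b m).1 :=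
  toFunctor_genEE B R hF hF₀ (𝟙 M) f g m

/-- The map `f ↦ F(f)y` is quadratic. Its expansion at the identity of `X` writes `y` as a sum of
elements carried by the injections, each visibly in the image of a symbol. -/
theorem toFunctor_surjective (X : C) :
    Function.Surjective ((toFunctor B R hF hF₀ (𝟙 M)).app X) := by
  intro y
  let ψ := ((toFunctor B R hF hF₀ (𝟙 M)).app X).hom
  suffices h : y ∈ ψ.range from h
  have e := (hF.isQuadraticMap hF₀ y).eq_sum_presentation (B X) (𝟙 X)
  simp only [Category.id_comp, map_id_apply] at e
  rw [e]
  refine add_mem (sum_mem fun i _ => ?_) (sum_mem fun r _ => ?_)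
  · refine ⟨genE M B ((B X).inj i) (a.symm (F.map ((B X).ret i) y)), ?_⟩
    refine (toFunctor_id_genE B R hF hF₀ _ _).trans ?_
    rw [AddEquiv.apply_symm_apply, map_map_apply]
  · refine ⟨genEE M B ((B X).inj r.1.1) ((B X).inj r.1.2)
      (b.symm (cr₂Proj F Ω Ω (F.map ((B X).ret₂ r.1.1 r.1.2) y))), ?_⟩
    refine (toFunctor_id_genEE B R hF hF₀ _ _ _).trans ?_
    rw [AddEquiv.apply_symm_apply, ← map_map_apply F _ (coprod.map _ _), cr₂Proj_map, coe_cr₂Map,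
      map_map_apply, desc_eq_map_fold]

/-- The point is that the right side depends only on the image of `y` in `F(X)`. With `l` a
retraction to `Ω`, it recovers a coordinate in `M_e`; `cr₂Proj_map_toFunctor` does so for `M_ee`. -/
theorem map_toFunctor {X : C} (l : X ⟶ Ω) (y : (functorOf M B).obj X) :
    a (descEval M B (Evaluation.ofArrow M l) y) =
      F.map l ((toFunctor B R hF hF₀ (𝟙 M)).app X y) := by
  refine functorOf_ext M B (f := a.toAddMonoidHom.comp (descEval M B (Evaluation.ofArrow M l)))
    (g := (F.map l).hom.comp ((toFunctor B R hF hF₀ (𝟙 M)).app X).hom) ?_ ?_ y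
  · intro h x
    change a (descEval M B _ _) = F.map l ((toFunctor B R hF hF₀ (𝟙 M)).app X _)
    rw [descEval_genE, toFunctor_id_genE, map_map_apply, ← R.smul_e]
    rfl
  · intro f g m
    change a (descEval M B _ _) = F.map l ((toFunctor B R hF hF₀ (𝟙 M)).app X _)
    rw [descEval_genEE, toFunctor_id_genEE, map_map_apply]
    change a (M.P (M.pair _ _ m)) = _
    rw [R.map_P, pair_apply, R.smul_ee, coe_cr₂Map, map_map_apply, ← desc_eq_map_fold,
      coprod.desc_comp]

theorem cr₂Proj_map_toFunctor {X : C} (l : X ⟶ Ω ⨿ Ω) (y : (functorOf M B).obj X) :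
    b (descEval M B (Evaluation.ofArrowSum M l) y) =
      cr₂Proj F Ω Ω (F.map l ((toFunctor B R hF hF₀ (𝟙 M)).app X y)) := by
  refine functorOf_ext M B (f := b.toAddMonoidHom.comp (descEval M B (Evaluation.ofArrowSum M l)))
    (g := (cr₂Proj F Ω Ω).comp
      ((F.map l).hom.comp ((toFunctor B R hF hF₀ (𝟙 M)).app X).hom)) ?_ ?_ y
  · intro h x
    change b (descEval M B _ _) = cr₂Proj F Ω Ω (F.map l ((toFunctor B R hF hF₀ (𝟙 M)).app X _))
    rw [descEval_genE, toFunctor_id_genE, map_map_apply, ← R.map_H]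
    rfl
  · intro f g m
    change b (descEval M B _ _) = cr₂Proj F Ω Ω (F.map l ((toFunctor B R hF hF₀ (𝟙 M)).app X _))
    rw [descEval_genEE, toFunctor_id_genEE, map_map_apply, hF.cr₂Proj_map_coe]
    change b (M.pair _ _ m + M.T (M.pair _ _ m)) = _
    rw [map_add, R.map_T, pair_apply, pair_apply, R.smul_ee, R.smul_ee]
    simp only [Category.assoc, coprod.inl_desc_assoc, coprod.inr_desc_assoc]

theorem toFunctor_injective (X : C) :
    Function.Injective ((toFunctor B R hF hF₀ (𝟙 M)).app X) := by
  refine (injective_iff_map_eq_zero ((toFunctor B R hF hF₀ (𝟙 M)).app X).hom).2 fun y hy => ?_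
  replace hy : (toFunctor B R hF hF₀ (𝟙 M)).app X y = 0 := hy
  refine Prod.ext (funext fun j => ?_) (funext fun r => ?_)
  · have e : y.1 j = descEval M B (Evaluation.ofArrow M ((B X).ret j)) y := by
      refine functorOf_ext M B (f := (Pi.evalAddMonoidHom (fun _ => M.Me) j).comp
        (AddMonoidHom.fst (Fin (B X).n → M.Me) (Pairs (B X).n → M.Mee))) ?_ ?_ y
      · exact fun h x => (descEval_genE M B (Evaluation.ofArrow M ((B X).ret j)) h x).symm
      · exact fun f g m => (descEval_genEE M B (Evaluation.ofArrow M ((B X).ret j)) f g m).symm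
    rw [e]
    apply a.injective
    rw [map_toFunctor B R hF hF₀, hy, map_zero]
    exact (map_zero a).symm
  · have e : y.2 r = descEval M B (Evaluation.ofArrowSum M ((B X).ret₂ r.1.1 r.1.2)) y := by
      refine functorOf_ext M B (f := (Pi.evalAddMonoidHom (fun _ => M.Mee) r).comp
        (AddMonoidHom.snd (Fin (B X).n → M.Me) (Pairs (B X).n → M.Mee))) ?_ ?_ y
      · exact fun h x => (descEval_genE M B (Evaluation.ofArrowSum M ((B X).ret₂ r.1.1 r.1.2)) h x).symm
      · exact fun f g m => (descEval_genEE M B (Evaluation.ofArrowSum M ((B X).ret₂ r.1.1 r.1.2)) f g m).symm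
    rw [e]
    apply b.injective
    rw [cr₂Proj_map_toFunctor B R hF hF₀, hy, map_zero, map_zero]
    exact (map_zero b).symm

theorem toFunctor_isIso : IsIso (toFunctor B R hF hF₀ (𝟙 M)) := by
  have : ∀ X, IsIso ((toFunctor B R hF hF₀ (𝟙 M)).app X) := fun X =>
    (ConcreteCategory.isIso_iff_bijective _).2
      ⟨toFunctor_injective B R hF hF₀ X, toFunctor_surjective B R hF hF₀ X⟩
  exact NatIso.isIso_of_isIso_app _

/-! ### The equivalence -/

variable {G : C ⥤ AddCommGrpCat.{w}} {a' : N.Me ≃+ G.obj Ω} {b' : N.Mee ≃+ cr₂ G Ω Ω}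

/-- The homomorphism of quadratic modules which is induced by a natural transformation. -/
def homOfNat (R' : Realizes G N a' b') (η : F ⟶ G) : M ⟶ N :=
  have he : ∀ x, a' (a'.symm (η.app Ω (a x))) = η.app Ω (a x) := fun _ => a'.apply_symm_apply _
  have hee : ∀ m, b' (b'.symm (cr₂Nat η Ω Ω (b m))) = cr₂Nat η Ω Ω (b m) :=
    fun _ => b'.apply_symm_apply _
  have nat : ∀ {X Y : C} (f : X ⟶ Y) (x : F.obj X), η.app Y (F.map f x) = G.map f (η.app X x) :=
    fun f x => by rw [← ConcreteCategory.comp_apply, η.naturality, ConcreteCategory.comp_apply]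
  { e :=
      { toFun := fun x => a'.symm (η.app Ω (a x))
        map_add' := fun x y => by rw [map_add, map_add, map_add]
        map_smul' := map_smul_of_arrow'
          (a'.symm.toAddMonoidHom.comp ((η.app Ω).hom.comp a.toAddMonoidHom)) fun α x => by
            change a'.symm (η.app Ω (a _)) = arrow α • a'.symm (η.app Ω (a x))
            apply a'.injective
            rw [he, R'.smul_e, he, R.smul_e, nat] }
    ee :=
      { toFun := fun m => b'.symm (cr₂Nat η Ω Ω (b m))
        map_add' := fun x y => by rw [map_add, map_add, map_add]
        map_smul' := map_smul_of_arrow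
          (b'.symm.toAddMonoidHom.comp ((cr₂Nat η Ω Ω).comp b.toAddMonoidHom)) fun α β m => by
            change b'.symm (cr₂Nat η Ω Ω (b _)) =
              (arrow α ⊗ₜ[ℤ] arrow β : ReducedRing Ω ⊗[ℤ] ReducedRing Ω) •
                b'.symm (cr₂Nat η Ω Ω (b m))
            apply b'.injective
            rw [hee, R'.smul_ee, hee, R.smul_ee, cr₂Nat_cr₂Map] }
    comm_T := fun m => by
      change b'.symm (cr₂Nat η Ω Ω (b _)) = N.T (b'.symm (cr₂Nat η Ω Ω (b m)))
      apply b'.injective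
      rw [hee, R'.map_T, hee, R.map_T]
      exact Subtype.ext (nat _ _)
    comm_P := fun m => by
      change a'.symm (η.app Ω (a _)) = N.P (b'.symm (cr₂Nat η Ω Ω (b m)))
      apply a'.injective
      rw [he, R'.map_P, hee, R.map_P, nat]
      rfl
    comm_H := fun t x => by
      change b'.symm (cr₂Nat η Ω Ω (b _)) = N.H (tens t (a'.symm (η.app Ω (a x))))
      induction t using TU.induction with
      | h ξ =>
        apply b'.injective
        rw [hee, R'.map_H, he, R.map_H, cr₂Nat_cr₂Proj, nat]
      | h0 => rw [tens_zero_left, tens_zero_left]; simp only [map_zero]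
      | hadd t t' ht ht' =>
        rw [tens_add_left, tens_add_left]
        simp only [map_add, ht, ht']
      | hneg t ht =>
        rw [tens_neg_left, tens_neg_left]
        simp only [map_neg, ht] }

end Classification

end

end QuadraticClassification

namespace QuadraticClassification

noncomputable section

/-! ### Natural transformations and homomorphisms of quadratic modules -/

section NatTrans

variable {C : Type u} [Category.{v} C] [HasZeroMorphisms C] [HasFiniteCoproducts C] {Ω : C}
  (B : ∀ X : C, Presentation Ω X) {M N : QuadraticModule.{w} Ω} {F G : C ⥤ AddCommGrpCat.{w}}
  {a : M.Me ≃+ F.obj Ω} {b : M.Mee ≃+ cr₂ F Ω Ω} (R : Realizes F M a b) (hF : IsPolynomial 2 F)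
  (hF₀ : ∀ {X Y : C} (x : F.obj X), F.map (0 : X ⟶ Y) x = 0)

-- Precomposed with the comparison isomorphism, both transformations are determined on symbols, and
-- these are images of elements of `F(Ω)` and of the cross-effect under maps `F(f)`.
include B R hF hF₀ in
theorem natTrans_ext {η θ : F ⟶ G} (he : ∀ x : F.obj Ω, η.app Ω x = θ.app Ω x)
    (hee : ∀ m : cr₂ F Ω Ω, η.app _ m.1 = θ.app _ m.1) : η = θ := by
  have : IsIso (toFunctor B R hF hF₀ (𝟙 M)) := toFunctor_isIso B R hF hF₀
  have nat : ∀ (ζ : F ⟶ G) {X Y : C} (f : X ⟶ Y) (x : F.obj X),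
      ζ.app Y (F.map f x) = G.map f (ζ.app X x) := fun ζ _ _ f x => by
    rw [← ConcreteCategory.comp_apply, ζ.naturality, ConcreteCategory.comp_apply]
  rw [← cancel_epi (toFunctor B R hF hF₀ (𝟙 M))]
  refine NatTrans.ext (funext fun X => AddCommGrpCat.hom_ext (AddMonoidHom.ext
    (functorOf_ext M B ?_ ?_)))
  · intro g x
    change η.app X ((toFunctor B R hF hF₀ (𝟙 M)).app X _) =
      θ.app X ((toFunctor B R hF hF₀ (𝟙 M)).app X _)
    rw [toFunctor_id_genE, nat, nat, he]
  · intro f g m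
    change η.app X ((toFunctor B R hF hF₀ (𝟙 M)).app X _) =
      θ.app X ((toFunctor B R hF hF₀ (𝟙 M)).app X _)
    rw [toFunctor_id_genEE, nat, nat, hee]

variable {a' : N.Me ≃+ G.obj Ω} {b' : N.Mee ≃+ cr₂ G Ω Ω} (R' : Realizes G N a' b')
  (hG : IsPolynomial 2 G) (hG₀ : ∀ {X Y : C} (x : G.obj X), G.map (0 : X ⟶ Y) x = 0)

-- The functor of `M` maps to `F` isomorphically, and to `G` by way of `φ`; `η` is the second map
-- after the inverse of the first. Its restrictions are read off at the symbols of `𝟙 Ω` and of the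
-- two injections.
include B R hF hF₀ R' hG hG₀ in
theorem exists_natTrans (φ : M ⟶ N) : ∃ η : F ⟶ G,
    (∀ x, η.app Ω (a x) = a' (φ.e x)) ∧
      ∀ m, η.app (Ω ⨿ Ω) (b m).1 = (b' (φ.ee m)).1 := by
  have : IsIso (toFunctor B R hF hF₀ (𝟙 M)) := toFunctor_isIso B R hF hF₀
  have key : ∀ {X : C} (y : (functorOf M B).obj X),
      (inv (toFunctor B R hF hF₀ (𝟙 M)) ≫ toFunctor B R' hG hG₀ φ).app X
        ((toFunctor B R hF hF₀ (𝟙 M)).app X y) = (toFunctor B R' hG hG₀ φ).app X y :=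
    fun {X} y => by
      rw [← ConcreteCategory.comp_apply, ← NatTrans.comp_app, IsIso.hom_inv_id_assoc]
  have hd : coprod.desc coprod.inl coprod.inr = 𝟙 (Ω ⨿ Ω) :=
    coprod.hom_ext (by rw [coprod.inl_desc, Category.comp_id])
      (by rw [coprod.inr_desc, Category.comp_id])
  refine ⟨inv (toFunctor B R hF hF₀ (𝟙 M)) ≫ toFunctor B R' hG hG₀ φ, fun x => ?_, fun m => ?_⟩
  · have e := key (genE M B (𝟙 Ω) x)
    rwa [toFunctor_id_genE, toFunctor_genE, map_id_apply, map_id_apply] at e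
  · have e := key (genEE M B coprod.inl coprod.inr m)
    rwa [toFunctor_id_genEE, toFunctor_genEE, hd, map_id_apply, map_id_apply] at e

end NatTrans

/-! ### The functor `F ↦ (F(Ω), cr₂F(Ω, Ω))` is an equivalence -/

section Equivalence

variable {C : Type u} [Category.{v} C] [HasZeroObject C] [HasZeroMorphisms C]
  [HasFiniteCoproducts C] (Ω : C)

theorem QuadraticFunctor.map_zero (F : QuadraticFunctor.{w} C) {X Y : C} (x : F.obj.obj X) :
    F.obj.map (0 : X ⟶ Y) x = 0 :=
  map_eq_zero_of_isZero F.property.2 x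

/-- The quadratic module of a reduced quadratic functor. -/
abbrev quadraticModule (F : QuadraticFunctor.{w} C) : QuadraticModule.{w} Ω :=
  quadraticModuleOf Ω F.property.1 F.map_zero

theorem quadraticModule_realizes (F : QuadraticFunctor.{w} C) :
    Realizes F.obj (quadraticModule Ω F) (AddEquiv.refl (F.obj.obj Ω))
      (AddEquiv.refl (cr₂ F.obj Ω Ω)) :=
  quadraticModuleOf_realizes Ω F.property.1 F.map_zero

variable (C) in
/-- The functor which assigns to a reduced quadratic functor its quadratic module. -/
def toQuadraticModule : QuadraticFunctor.{w} C ⥤ QuadraticModule.{w} Ω where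
  obj F := quadraticModule Ω F
  map {F G} η := homOfNat (quadraticModule_realizes Ω F) (quadraticModule_realizes Ω G) η.hom
  map_id _ := rfl
  map_comp _ _ := rfl

theorem toQuadraticModule_map_e {F G : QuadraticFunctor.{w} C} (η : F ⟶ G) (x : F.obj.obj Ω) :
    ((toQuadraticModule C Ω).map η).e x = η.hom.app Ω x := rfl

theorem toQuadraticModule_map_ee {F G : QuadraticFunctor.{w} C} (η : F ⟶ G)
    (m : cr₂ F.obj Ω Ω) : ((toQuadraticModule C Ω).map η).ee m = cr₂Nat η.hom Ω Ω m := rfl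

variable {Ω} (B : ∀ X : C, Presentation Ω X)

include B in
theorem toQuadraticModule_faithful : (toQuadraticModule.{w} C Ω).Faithful where
  map_injective {F _ _ _} h :=
    ObjectProperty.hom_ext _ <|
      natTrans_ext B (quadraticModule_realizes Ω F) F.property.1 F.map_zero
        (fun x => LinearMap.congr_fun (congrArg QuadraticModule.Hom.e h) x)
        (fun m => congrArg Subtype.val (LinearMap.congr_fun (congrArg QuadraticModule.Hom.ee h) m))

include B in
theorem toQuadraticModule_full : (toQuadraticModule.{w} C Ω).Full where
  map_surjective {F G} φ := by
    obtain ⟨η, h₁, h₂⟩ := exists_natTrans B (quadraticModule_realizes Ω F) F.property.1 F.map_zero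
      (quadraticModule_realizes Ω G) G.property.1 G.map_zero φ
    exact ⟨ObjectProperty.homMk η,
      QuadraticModule.Hom.ext (LinearMap.ext h₁) (LinearMap.ext fun m => Subtype.ext (h₂ m))⟩

/-- Two quadratic modules which belong to the same functor are isomorphic. -/
def isoOfRealizes {F : C ⥤ AddCommGrpCat.{w}} {M N : QuadraticModule.{w} Ω}
    {a : M.Me ≃+ F.obj Ω} {b : M.Mee ≃+ cr₂ F Ω Ω} {a' : N.Me ≃+ F.obj Ω}
    {b' : N.Mee ≃+ cr₂ F Ω Ω} (R : Realizes F M a b) (R' : Realizes F N a' b') : M ≅ N where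
  hom := homOfNat R R' (𝟙 F)
  inv := homOfNat R' R (𝟙 F)
  hom_inv_id := by
    refine QuadraticModule.Hom.ext (LinearMap.ext fun x => ?_) (LinearMap.ext fun m => ?_)
    · change a.symm (a' (a'.symm (a x))) = x
      rw [a'.apply_symm_apply, a.symm_apply_apply]
    · change b.symm (b' (b'.symm (b m))) = m
      rw [b'.apply_symm_apply, b.symm_apply_apply]
  inv_hom_id := by
    refine QuadraticModule.Hom.ext (LinearMap.ext fun x => ?_) (LinearMap.ext fun m => ?_)
    · change a'.symm (a (a.symm (a' x))) = x
      rw [a.apply_symm_apply, a'.symm_apply_apply]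
    · change b'.symm (b (b.symm (b' m))) = m
      rw [b.apply_symm_apply, b'.symm_apply_apply]

include B in
theorem toQuadraticModule_essSurj : (toQuadraticModule.{w} C Ω).EssSurj where
  mem_essImage M :=
    ⟨⟨functorOf M B, functorOf_reducedQuadratic M B⟩,
      ⟨isoOfRealizes (quadraticModule_realizes Ω _) (functorOf_realizes M B)⟩⟩

include B in
theorem toQuadraticModule_isEquivalence : (toQuadraticModule.{w} C Ω).IsEquivalence where
  faithful := toQuadraticModule_faithful B
  full := toQuadraticModule_full B
  essSurj := toQuadraticModule_essSurj B

end Equivalence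

end

end QuadraticClassification

theorem theoremS {C : Type u} [Category.{v} C] [HasZeroObject C] [HasZeroMorphisms C]
    [HasFiniteCoproducts C] (Ω : C)
    (hΩ : ∀ X : C, ∃ n : ℕ, Nonempty (X ≅ ∐ fun _ : Fin n => Ω)) :
    ∃ (Θ : QuadraticClassification.QuadraticFunctor.{w} C ≌
        QuadraticClassification.QuadraticModule.{w} Ω)
      (a : ∀ F, (Θ.functor.obj F).Me ≃+ F.obj.obj Ω)
      (b : ∀ F, (Θ.functor.obj F).Mee ≃+ QuadraticClassification.cr₂ F.obj Ω Ω),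
      (∀ F, QuadraticClassification.Realizes F.obj (Θ.functor.obj F) (a F) (b F)) ∧
      (∀ {F G : QuadraticClassification.QuadraticFunctor.{w} C} (η : F ⟶ G)
        (x : (Θ.functor.obj F).Me),
        a G ((Θ.functor.map η).e x) = η.hom.app Ω (a F x)) ∧
      (∀ {F G : QuadraticClassification.QuadraticFunctor.{w} C} (η : F ⟶ G)
        (m : (Θ.functor.obj F).Mee),
        b G ((Θ.functor.map η).ee m) = QuadraticClassification.cr₂Nat η.hom Ω Ω (b F m)) := by
  -- A presentation of each object is chosen here. The functor to quadratic modules does not involve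
  -- the choice; only the proof that it is an equivalence does. Its values are literally `F(Ω)` and
  -- `cr₂F(Ω, Ω)`, so `a` and `b` are identities.
  have := QuadraticClassification.toQuadraticModule_isEquivalence.{w} (Ω := Ω)
    fun X => ⟨(hΩ X).choose, (hΩ X).choose_spec.some⟩
  exact ⟨(QuadraticClassification.toQuadraticModule C Ω).asEquivalence,
    fun F => AddEquiv.refl (F.obj.obj Ω),
    fun F => AddEquiv.refl (QuadraticClassification.cr₂ F.obj Ω Ω),
    QuadraticClassification.quadraticModule_realizes Ω,
    QuadraticClassification.toQuadraticModule_map_e Ω,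
    QuadraticClassification.toQuadraticModule_map_ee Ω⟩
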